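/- Let $n\ge 0$ and let $\langle a,b\rangle=\sum_i a_ib_i\in\mathbb Z_2$ be the standard scalar product on $\mathbb Z_2^n$. A $\mathbb Z_2^n$-manifold $M$ of dimension $p|\mathbf q$ is a second-countable Hausdorff space $|M|$ with a sheaf $\mathcal O_M$ of $\mathbb Z_2^n$-graded real algebras with local stalks, satisfying $st=(-1)^{\langle \deg s,\deg t\rangle}ts$ for homogeneous sections, which is locally isomorphic to $(\mathcal U, C^\infty_{\mathcal U}[[\xi]])$, with $\mathcal U\subseteq\mathbb R^p$ open and formal variables $\xi^A$ of non-zero degrees ($q_i$ of them of degree $\gamma_i$). Write $x^I=(x^a,\xi^A)$ for local coordinates and $\deg I$ for the degree of $x^I$. Differential forms on $M$ are the functions on the $\mathbb Z_2^{n+1}$-tangent bundle $\mathbb TM$, which has local coordinates $x^I$ of degree $(0,\deg I)$ and $\mathrm dx^I$ of degree $(1,\deg I)$, glued by $\mathrm dx^{I'}=\mathrm dx^I\,\partial x^{I'}/\partial x^I$; $p$-forms are those of order $p$ in the $\mathrm dx^I$, and $\mathrm d=\mathrm dx^I\,\partial/\partial x^I$, where $\partial/\partial x^I$ is the left derivative.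 A symplectic structure of degree $\gamma\in\mathbb Z_2^n$ is a closed two-form $\omega$ of $\mathbb Z_2^n$-degree $\gamma$ which is nondegenerate, i.e. locally $\omega=\frac12\mathrm dx^I\mathrm dx^J\omega_{JI}$ with $\omega_{JI}=-(-1)^{\langle\deg J,\deg I\rangle}\omega_{IJ}$ and the matrix $(\omega_{JI})$ is invertible. For $\gamma\in\mathbb Z_2^n$, a $\gamma$-shifted cotangent bundle $\Pi_\gamma T^*M$ of a $\mathbb Z_2^n$-manifold $M$ is a $\mathbb Z_2^n$-manifold with a morphism $\pi$ to $M$ and, over each coordinate chart $(U,x^I)$ of $M$, a chart with domain $\pi^{-1}(U)$ and coordinates $(x^I,p^\gamma_J)$, where $x^I$ is pulled back from $M$, $\deg p^\gamma_J=\deg J+\gamma$, and the momenta of degree zero take all real values, such that the admissible coordinate changes over overlaps of charts of $M$ are $$x^{I'}=x^{I'}(x),\qquad p^\gamma_{J'}=\sum_I(-1)^{\langle \deg I+\deg J',\gamma\rangle}\frac{\partial x^I}{\partial x^{J'}}\,p^\gamma_I .$$ **Theorem.** For every $\mathbb Z_2^n$-manifold $M$ and every $\gamma\in\mathbb Z_2^n$,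 a $\gamma$-shifted cotangent bundle $\Pi_\gamma T^*M$ exists, and on every such bundle there is a symplectic structure $\omega_\gamma$ of degree $\gamma$ which over every coordinate chart of $M$ is given, in the associated coordinates $(x^I,p^\gamma_J)$, by $$\omega_\gamma=\sum_I(-1)^{\langle\deg I,\gamma\rangle}\,\mathrm dx^I\,\mathrm dp^\gamma_I .$$ In particular, this expression is invariant under the admissible coordinate changes, and $\omega_\gamma$ is the only two-form on $\Pi_\gamma T^*M$ with these local expressions. For $\gamma=0$ it is the canonical form $\omega_0=\sum_I\mathrm dx^I\,\mathrm dp_I$ of degree zero on $T^*M=\Pi_0T^*M$. -/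

import Mathlib

universe u

noncomputable section

namespace Z2n

open scoped Matrix
open TopologicalSpace CategoryTheory Opposite

/-! ### Degrees and signs -/

/-- The group `ℤ₂ⁿ`. The standard scalar product of `a` and `b` is `a ⬝ᵥ b : ZMod 2`. -/
abbrev Deg (n : ℕ) : Type := Fin n → ZMod 2

/-- The sign `(-1) ^ z`. -/
def sgn (z : ZMod 2) : ℤ := (-1) ^ z.val

theorem sgn_zero : sgn 0 = 1 := by decide

theorem sgn_add (a b : ZMod 2) : sgn (a + b) = sgn a * sgn b := by
  revert a b; decide

/-! ### Formal power series in `ℤ₂ⁿ`-graded variables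

Monomials are written in increasing order, `ξ^α = ξ_1^(α 1) ξ_2^(α 2) ⋯`, and a series is
`∑ α, ξ^α f_α` with coefficients `f_α` in a commutative algebra `R` of degree zero. -/

section Series

set_option linter.unusedSectionVars false

variable {n : ℕ} {J : Type} [Fintype J] [LinearOrder J] (deg : J → Deg n)

/-- The exponents of the non-vanishing monomials: since `ξ_j ξ_j = -ξ_j ξ_j` when
`⟨deg j, deg j⟩ = 1`, such a variable occurs at most once. -/
def Adm (α : J →₀ ℕ) : Prop := ∀ j, deg j ⬝ᵥ deg j ≠ 0 → α j ≤ 1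

/-- The exponent of the sign in `ξ^α ξ^β = ± ξ^(α+β)`: each factor `ξ_j` of `ξ^β` is moved to the
left past the factors `ξ_i`, `j < i`, of `ξ^α`. -/
def reorder (α β : J →₀ ℕ) : ZMod 2 :=
  ∑ i, ∑ j, if j < i then (α i : ZMod 2) * (β j : ZMod 2) * (deg i ⬝ᵥ deg j) else 0

/-- The degree of the monomial `ξ^α`. -/
def monoDeg (α : J →₀ ℕ) : Deg n := ∑ j, α j • deg j

variable (R : Type*) [CommRing R] [Algebra ℝ R]

/-- The real vector space of coefficient families of formal power series. -/
def seriesSpace : Submodule ℝ ((J →₀ ℕ) → R) where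
  carrier := {f | ∀ α, ¬ Adm deg α → f α = 0}
  add_mem' := by
    intro f g hf hg α h
    simp [hf α h, hg α h]
  zero_mem' := by intro α _; rfl
  smul_mem' := by
    intro c f hf α h
    simp [hf α h]

/-- The algebra `R[[ξ]]` of formal power series in the graded variables `ξ_j` of degree `deg j`,
subject to `ξ_i ξ_j = (-1)^⟨deg i, deg j⟩ ξ_j ξ_i`. -/
def GSeries : Type _ := ↥(seriesSpace deg R)

instance : AddCommGroup (GSeries deg R) := inferInstanceAs (AddCommGroup ↥(seriesSpace deg R))

instance : Module ℝ (GSeries deg R) := inferInstanceAs (Module ℝ ↥(seriesSpace deg R))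

variable {deg R}

theorem Adm.of_le {α β : J →₀ ℕ} (h : Adm deg β) (hle : α ≤ β) : Adm deg α :=
  fun j hj => (hle j).trans (h j hj)

theorem adm_zero : Adm deg 0 := fun _ _ => Nat.zero_le _

theorem adm_single (j : J) : Adm deg (Finsupp.single j 1) := by
  intro i _
  rw [Finsupp.single_apply]
  split_ifs <;> omega

theorem reorder_add_left (α β γ : J →₀ ℕ) :
    reorder deg (α + β) γ = reorder deg α γ + reorder deg β γ := by
  simp only [reorder, ← Finset.sum_add_distrib]
  refine Finset.sum_congr rfl fun i _ => Finset.sum_congr rfl fun j _ => ?_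
  split_ifs
  · simp only [Finsupp.add_apply, Nat.cast_add]; ring
  · simp

theorem reorder_add_right (α β γ : J →₀ ℕ) :
    reorder deg α (β + γ) = reorder deg α β + reorder deg α γ := by
  simp only [reorder, ← Finset.sum_add_distrib]
  refine Finset.sum_congr rfl fun i _ => Finset.sum_congr rfl fun j _ => ?_
  split_ifs
  · simp only [Finsupp.add_apply, Nat.cast_add]; ring
  · simp

theorem reorder_zero_left (α : J →₀ ℕ) : reorder deg 0 α = 0 := by simp [reorder]

theorem reorder_zero_right (α : J →₀ ℕ) : reorder deg α 0 = 0 := by simp [reorder]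

namespace GSeries

/-- The coefficient of `ξ^α`. -/
def coeff (f : GSeries deg R) (α : J →₀ ℕ) : R := f.1 α

theorem coeff_eq_zero (f : GSeries deg R) {α : J →₀ ℕ} (h : ¬ Adm deg α) : f.coeff α = 0 :=
  f.2 α h

theorem ext {f g : GSeries deg R} (h : ∀ α, Adm deg α → f.coeff α = g.coeff α) : f = g := by
  refine Subtype.ext (funext fun α => ?_)
  by_cases hα : Adm deg α
  · exact h α hα
  · exact (f.2 α hα).trans (g.2 α hα).symm

open Classical in
/-- The series with prescribed coefficients at the admissible exponents. -/
def mk (c : (J →₀ ℕ) → R) : GSeries deg R :=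
  ⟨fun α => if Adm deg α then c α else 0, fun _ h => if_neg h⟩

theorem coeff_mk (c : (J →₀ ℕ) → R) {α : J →₀ ℕ} (h : Adm deg α) :
    (mk c : GSeries deg R).coeff α = c α := if_pos h

@[simp] theorem coeff_add (f g : GSeries deg R) (α : J →₀ ℕ) :
    (f + g).coeff α = f.coeff α + g.coeff α := rfl

@[simp] theorem coeff_zero (α : J →₀ ℕ) : (0 : GSeries deg R).coeff α = 0 := rfl

@[simp] theorem coeff_smul (c : ℝ) (f : GSeries deg R) (α : J →₀ ℕ) :
    (c • f).coeff α = c • f.coeff α := rfl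

open Classical in
/-- The constant series. -/
def const (r : R) : GSeries deg R := mk fun α => if α = 0 then r else 0

open Classical in
/-- The variable `ξ_j`. -/
def var (j : J) : GSeries deg R := mk fun α => if α = Finsupp.single j 1 then 1 else 0

instance : One (GSeries deg R) := ⟨const 1⟩

open Classical in
instance : Mul (GSeries deg R) :=
  ⟨fun f g => mk fun α => ∑ p ∈ Finset.HasAntidiagonal.antidiagonal α,
    sgn (reorder deg p.1 p.2) • (f.coeff p.1 * g.coeff p.2)⟩

open Classical in
theorem coeff_mul (f g : GSeries deg R) {α : J →₀ ℕ} (h : Adm deg α) :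
    (f * g).coeff α = ∑ p ∈ Finset.HasAntidiagonal.antidiagonal α,
      sgn (reorder deg p.1 p.2) • (f.coeff p.1 * g.coeff p.2) := coeff_mk _ h

open Classical in
theorem coeff_const (r : R) (α : J →₀ ℕ) :
    (const r : GSeries deg R).coeff α = if α = 0 then r else 0 := by
  by_cases h : Adm deg α
  · exact coeff_mk _ h
  · rw [coeff_eq_zero _ h, if_neg]
    rintro rfl
    exact h adm_zero

theorem const_mul_coeff (r : R) (f : GSeries deg R) (α : J →₀ ℕ) :
    (const r * f).coeff α = r * f.coeff α := by
  classical
  by_cases h : Adm deg α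
  · rw [coeff_mul _ _ h, Finset.sum_eq_single (0, α)]
    · simp [coeff_const, reorder_zero_left, sgn_zero]
    · rintro ⟨a, b⟩ hp hne
      have ha : a ≠ 0 := by
        rintro rfl
        exact hne (by simpa using hp)
      simp [coeff_const, ha]
    · intro hn
      exact absurd (by simp) hn
  · simp [coeff_eq_zero _ h]

theorem mul_const_coeff (r : R) (f : GSeries deg R) (α : J →₀ ℕ) :
    (f * const r).coeff α = r * f.coeff α := by
  classical
  by_cases h : Adm deg α
  · rw [coeff_mul _ _ h, Finset.sum_eq_single (α, 0)]
    · simp [coeff_const, reorder_zero_right, sgn_zero, mul_comm]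
    · rintro ⟨a, b⟩ hp hne
      have hb : b ≠ 0 := by
        rintro rfl
        exact hne (by simpa using hp)
      simp [coeff_const, hb]
    · intro hn
      exact absurd (by simp) hn
  · simp [coeff_eq_zero _ h]

theorem mul_assoc_aux (f g h : GSeries deg R) : f * g * h = f * (g * h) := by
  classical
  refine ext fun α hα => ?_
  have hl : ∀ p ∈ Finset.HasAntidiagonal.antidiagonal α, Adm deg p.1 := fun p hp =>
    hα.of_le (by rw [← Finset.HasAntidiagonal.mem_antidiagonal.1 hp]; exact le_self_add)
  have hr : ∀ p ∈ Finset.HasAntidiagonal.antidiagonal α, Adm deg p.2 := fun p hp =>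
    hα.of_le (by rw [← Finset.HasAntidiagonal.mem_antidiagonal.1 hp]; exact le_add_self)
  rw [coeff_mul _ _ hα, coeff_mul _ _ hα]
  have e₁ := Finset.sum_congr rfl fun p hp =>
    congrArg (fun r => sgn (reorder deg p.1 p.2) • (r * h.coeff p.2)) (coeff_mul f g (hl p hp))
  have e₂ := Finset.sum_congr rfl fun p hp =>
    congrArg (fun r => sgn (reorder deg p.1 p.2) • (f.coeff p.1 * r)) (coeff_mul g h (hr p hp))
  refine e₁.trans (Eq.trans ?_ e₂.symm)
  simp only [Finset.sum_mul, Finset.mul_sum, Finset.smul_sum, Finset.sum_sigma']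
  refine Finset.sum_nbij' (fun ⟨⟨_i, j⟩, ⟨k, l⟩⟩ => ⟨(k, l + j), (l, j)⟩)
    (fun ⟨⟨i, _j⟩, ⟨k, l⟩⟩ => ⟨(i + k, l), (i, k)⟩) ?_ ?_ ?_ ?_ ?_
  · rintro ⟨⟨i, j⟩, ⟨k, l⟩⟩ hx
    simp only [Finset.mem_sigma, Finset.HasAntidiagonal.mem_antidiagonal] at hx ⊢
    exact ⟨by rw [← hx.1, ← hx.2, add_assoc], trivial⟩
  · rintro ⟨⟨i, j⟩, ⟨k, l⟩⟩ hx
    simp only [Finset.mem_sigma, Finset.HasAntidiagonal.mem_antidiagonal] at hx ⊢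
    exact ⟨by rw [← hx.1, ← hx.2, add_assoc], trivial⟩
  · rintro ⟨⟨i, j⟩, ⟨k, l⟩⟩ hx
    simp only [Finset.mem_sigma, Finset.HasAntidiagonal.mem_antidiagonal] at hx
    obtain ⟨-, rfl⟩ := hx
    rfl
  · rintro ⟨⟨i, j⟩, ⟨k, l⟩⟩ hx
    simp only [Finset.mem_sigma, Finset.HasAntidiagonal.mem_antidiagonal] at hx
    obtain ⟨-, rfl⟩ := hx
    rfl
  · rintro ⟨⟨i, j⟩, ⟨k, l⟩⟩ hx
    simp only [Finset.mem_sigma, Finset.HasAntidiagonal.mem_antidiagonal] at hx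
    obtain ⟨-, rfl⟩ := hx
    simp only [reorder_add_left, reorder_add_right, sgn_add, zsmul_eq_mul, Int.cast_mul]
    ring

instance : Ring (GSeries deg R) :=
  { (inferInstance : AddCommGroup (GSeries deg R)) with
    mul := (· * ·)
    one := 1
    left_distrib := by
      classical
      intro f g h
      refine ext fun α hα => ?_
      simp only [coeff_mul _ _ hα, coeff_add, mul_add, smul_add, Finset.sum_add_distrib]
    right_distrib := by
      classical
      intro f g h
      refine ext fun α hα => ?_
      simp only [coeff_mul _ _ hα, coeff_add, add_mul, smul_add, Finset.sum_add_distrib]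
    zero_mul := by
      classical
      intro f
      refine ext fun α hα => ?_
      simp [coeff_mul _ _ hα]
    mul_zero := by
      classical
      intro f
      refine ext fun α hα => ?_
      simp [coeff_mul _ _ hα]
    mul_assoc := mul_assoc_aux
    one_mul := fun f => ext fun α _ => (const_mul_coeff 1 f α).trans (one_mul _)
    mul_one := fun f => ext fun α _ => (mul_const_coeff 1 f α).trans (one_mul _) }

instance : Algebra ℝ (GSeries deg R) :=
  Algebra.ofModule
    (by
      classical
      intro c f g
      refine ext fun α hα => ?_
      simp only [coeff_mul _ _ hα, coeff_smul, Finset.smul_sum]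
      refine Finset.sum_congr rfl fun p _ => ?_
      rw [smul_mul_assoc, smul_comm])
    (by
      classical
      intro c f g
      refine ext fun α hα => ?_
      simp only [coeff_mul _ _ hα, coeff_smul, Finset.smul_sum]
      refine Finset.sum_congr rfl fun p _ => ?_
      rw [mul_smul_comm, smul_comm])

variable (deg R) in
/-- The homogeneous series of degree `δ`. -/
def homog (δ : Deg n) : Submodule ℝ (GSeries deg R) where
  carrier := {f | ∀ α, f.coeff α ≠ 0 → monoDeg deg α = δ}
  add_mem' := by
    intro f g hf hg α h
    by_cases hfα : f.coeff α = 0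
    · refine hg α fun hgα => h ?_
      rw [coeff_add, hfα, hgα, add_zero]
    · exact hf α hfα
  zero_mem' := fun α h => absurd rfl h
  smul_mem' := by
    intro c f hf α h
    refine hf α fun hfα => h ?_
    rw [coeff_smul, hfα, smul_zero]

/-- Coefficientwise application of a linear map. -/
def mapCoeff {S : Type*} [CommRing S] [Algebra ℝ S] (φ : R →ₗ[ℝ] S) :
    GSeries deg R →ₗ[ℝ] GSeries deg S where
  toFun f := ⟨fun α => φ (f.coeff α), fun α h => by
    change φ (f.coeff α) = 0
    rw [coeff_eq_zero f h, map_zero]⟩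
  map_add' f g := ext fun α _ => φ.map_add (f.coeff α) (g.coeff α)
  map_smul' c f := ext fun α _ => φ.map_smul c (f.coeff α)

/-- Coefficientwise application of an algebra morphism. -/
def mapAlg {S : Type*} [CommRing S] [Algebra ℝ S] (φ : R →ₐ[ℝ] S) :
    GSeries deg R →ₐ[ℝ] GSeries deg S :=
  AlgHom.ofLinearMap (mapCoeff φ.toLinearMap)
    (by
      classical
      refine ext fun α _ => ?_
      change φ ((const 1 : GSeries deg R).coeff α) = (const 1 : GSeries deg S).coeff α
      rw [coeff_const, coeff_const]
      split_ifs <;> simp)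
    (by
      classical
      intro f g
      refine ext fun α hα => ?_
      change φ ((f * g).coeff α) = _
      rw [coeff_mul _ _ hα, coeff_mul _ _ hα, map_sum]
      refine Finset.sum_congr rfl fun p _ => ?_
      rw [map_zsmul, map_mul]
      rfl)

/-- The left partial derivative `∂/∂ξ_j`: it sends `ξ^(α + e_j) f` to
`(-1)^(∑_{i<j} α_i ⟨deg i, deg j⟩) (α_j + 1) ξ^α f`. -/
def pderiv (j : J) : GSeries deg R →ₗ[ℝ] GSeries deg R where
  toFun f := mk fun α =>
    sgn (∑ i, if i < j then (α i : ZMod 2) * (deg i ⬝ᵥ deg j) else 0) •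
      (α j + 1) • f.coeff (α + Finsupp.single j 1)
  map_add' f g := ext fun α hα => by
    simp only [coeff_mk _ hα, coeff_add, smul_add]
  map_smul' c f := ext fun α hα => by
    simp only [coeff_mk _ hα, coeff_smul, RingHom.id_apply]
    rw [smul_comm _ c, smul_comm _ c]

end GSeries

end Series

/-! ### Smooth functions on open subsets of `ℝᵖ` -/

section Smooth

open scoped ContDiff

variable {B : Type} [Fintype B]

/-- The algebra `C^∞(W)` of smooth real functions on an open set `W`. -/
def Smooth (W : Opens (B → ℝ)) : Subalgebra ℝ (W → ℝ) where
  carrier := {f | ∃ F : (B → ℝ) → ℝ, ContDiffOn ℝ ∞ F W ∧ ∀ x : W, F x = f x}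
  mul_mem' := by
    rintro f g ⟨F, hF, hf⟩ ⟨G, hG, hg⟩
    exact ⟨F * G, hF.mul hG, fun x => by simp [hf, hg]⟩
  add_mem' := by
    rintro f g ⟨F, hF, hf⟩ ⟨G, hG, hg⟩
    exact ⟨F + G, hF.add hG, fun x => by simp [hf, hg]⟩
  algebraMap_mem' := fun r => ⟨fun _ => r, contDiffOn_const, fun _ => rfl⟩

/-- Restriction of smooth functions. -/
def Smooth.res {W' W : Opens (B → ℝ)} (h : W' ≤ W) : Smooth W →ₐ[ℝ] Smooth W' where
  toFun f := ⟨fun x => f.1 ⟨x.1, h x.2⟩, by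
    obtain ⟨F, hF, hf⟩ := f.2
    exact ⟨F, hF.mono h, fun x => hf ⟨x.1, h x.2⟩⟩⟩
  map_one' := rfl
  map_mul' _ _ := rfl
  map_zero' := rfl
  map_add' _ _ := rfl
  commutes' _ := rfl

/-- The coordinate function `x_b` on `W`. -/
def Smooth.coord (W : Opens (B → ℝ)) (b : B) : Smooth W :=
  ⟨fun x => x.1 b, fun x => x b, (contDiff_apply ℝ ℝ b).contDiffOn, fun _ => rfl⟩

/-- The extension by zero of a smooth function on `W` to all of `ℝᵖ`. -/
def Smooth.extend {W : Opens (B → ℝ)} (f : Smooth W) : (B → ℝ) → ℝ :=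
  Function.extend Subtype.val f.1 0

theorem Smooth.extend_apply {W : Opens (B → ℝ)} (f : Smooth W) (x : W) :
    Smooth.extend f x = f.1 x :=
  Subtype.val_injective.extend_apply _ _ x

theorem Smooth.contDiffOn_extend {W : Opens (B → ℝ)} (f : Smooth W) :
    ContDiffOn ℝ ∞ (Smooth.extend f) W := by
  obtain ⟨F, hF, hf⟩ := f.2
  exact hF.congr fun x hx => (Smooth.extend_apply f ⟨x, hx⟩).trans (hf ⟨x, hx⟩).symm

theorem Smooth.differentiableAt_extend {W : Opens (B → ℝ)} (f : Smooth W) (x : W) :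
    DifferentiableAt ℝ (Smooth.extend f) x :=
  ((Smooth.contDiffOn_extend f).differentiableOn (by simp)).differentiableAt
    (W.isOpen.mem_nhds x.2)

open Classical in
/-- The partial derivative `∂/∂x_b` on `C^∞(W)`. -/
def Smooth.pderiv {W : Opens (B → ℝ)} (b : B) : Smooth W →ₗ[ℝ] Smooth W where
  toFun f := ⟨fun x => fderiv ℝ (Smooth.extend f) x (Pi.single b 1),
    fun x => fderiv ℝ (Smooth.extend f) x (Pi.single b 1),
    ((Smooth.contDiffOn_extend f).fderiv_of_isOpen W.isOpen (by simp)).clm_apply contDiffOn_const,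
    fun _ => rfl⟩
  map_add' f g := by
    refine Subtype.ext (funext fun x => ?_)
    have h : Smooth.extend (f + g) =ᶠ[nhds x.1] Smooth.extend f + Smooth.extend g := by
      filter_upwards [W.isOpen.mem_nhds x.2] with y hy
      change _ = Smooth.extend f (⟨y, hy⟩ : W) + Smooth.extend g (⟨y, hy⟩ : W)
      rw [Smooth.extend_apply f, Smooth.extend_apply g]
      exact Smooth.extend_apply (f + g) ⟨y, hy⟩
    change fderiv ℝ (Smooth.extend (f + g)) x _ =
      fderiv ℝ (Smooth.extend f) x _ + fderiv ℝ (Smooth.extend g) x _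
    rw [h.fderiv_eq, fderiv_add (Smooth.differentiableAt_extend f x)
      (Smooth.differentiableAt_extend g x)]
    rfl
  map_smul' c f := by
    refine Subtype.ext (funext fun x => ?_)
    have h : Smooth.extend (c • f) =ᶠ[nhds x.1] c • Smooth.extend f := by
      filter_upwards [W.isOpen.mem_nhds x.2] with y hy
      change _ = c • Smooth.extend f (⟨y, hy⟩ : W)
      rw [Smooth.extend_apply f]
      exact Smooth.extend_apply (c • f) ⟨y, hy⟩
    change fderiv ℝ (Smooth.extend (c • f)) x _ = c • fderiv ℝ (Smooth.extend f) x _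
    rw [h.fderiv_eq, fderiv_const_smul (Smooth.differentiableAt_extend f x)]
    rfl

end Smooth

/-! ### Coordinate systems and `ℤ₂ⁿ`-domains -/

/-- An ordered finite list of coordinates `x^I` with degrees `deg I ∈ ℤ₂ⁿ`. Those of degree zero
are the genuine coordinates, the others are the formal ones. It fixes a dimension `p|𝐪`: there are
`p` coordinates of degree zero and `q_i` coordinates of each degree `γ_i ≠ 0`. -/
structure Coords (n : ℕ) where
  idx : Type
  [fintype : Fintype idx]
  [order : LinearOrder idx]
  deg : idx → Deg n

attribute [instance] Coords.fintype Coords.order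

namespace Coords

variable {n : ℕ} (D : Coords n)

/-- The coordinates of degree zero. -/
abbrev Base : Type := {i : D.idx // D.deg i = 0}

/-- The formal coordinates. -/
abbrev Formal : Type := {i : D.idx // D.deg i ≠ 0}

/-- The space `ℝᵖ`. -/
abbrev Space : Type := D.Base → ℝ

/-- Degrees of the formal coordinates. -/
abbrev formalDeg (A : D.Formal) : Deg n := D.deg A.1

/-- The functions `C^∞(W)[[ξ]]` on the `ℤ₂ⁿ`-domain over `W`. -/
abbrev Fun (W : Opens D.Space) : Type := GSeries D.formalDeg (Smooth W)

/-- Restriction of functions. -/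
def Fun.res {W' W : Opens D.Space} (h : W' ≤ W) : D.Fun W →ₐ[ℝ] D.Fun W' :=
  GSeries.mapAlg (Smooth.res h)

/-- The coordinate function `x^I`. -/
def coord (W : Opens D.Space) (i : D.idx) : D.Fun W :=
  if h : D.deg i = 0 then GSeries.const (Smooth.coord W ⟨i, h⟩) else GSeries.var ⟨i, h⟩

/-- The partial derivative `∂/∂x^I`. -/
def partialD (W : Opens D.Space) (i : D.idx) : D.Fun W →ₗ[ℝ] D.Fun W :=
  if h : D.deg i = 0 then GSeries.mapCoeff (Smooth.pderiv ⟨i, h⟩) else GSeries.pderiv ⟨i, h⟩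

/-- The formal variables `ξ^A`, `dx^I` of the `ℤ₂ⁿ⁺¹`-tangent bundle of a domain. -/
abbrev FormVar : Type := Lex (D.Formal ⊕ D.idx)

/-- The `ℤ₂ⁿ⁺¹`-degrees: `(0, deg A)` for `ξ^A` and `(1, deg I)` for `dx^I`. -/
def formDeg (v : D.FormVar) : Deg (n + 1) :=
  Sum.elim (fun A => Fin.cons 0 (D.deg A.1)) (fun i => Fin.cons 1 (D.deg i)) (ofLex v)

/-- The algebra `C^∞(W)[[ξ, dx, dξ]]` of functions on the `ℤ₂ⁿ⁺¹`-tangent bundle of the domain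
over `W`. -/
abbrev Form (W : Opens D.Space) : Type := GSeries D.formDeg (Smooth W)

/-- Restriction of forms. -/
def Form.res {W' W : Opens D.Space} (h : W' ≤ W) : D.Form W →ₐ[ℝ] D.Form W' :=
  GSeries.mapAlg (Smooth.res h)

open Classical in
/-- The inclusion of functions into forms, as series without any `dx^I`. -/
def ofFun (W : Opens D.Space) (f : D.Fun W) : D.Form W :=
  GSeries.mk fun α =>
    if ∀ i, α (toLex (Sum.inr i)) = 0 then
      f.coeff (Finsupp.equivFunOnFinite.symm fun A => α (toLex (Sum.inl A)))
    else 0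

/-- The generator `dx^I`. -/
def dx (W : Opens D.Space) (i : D.idx) : D.Form W := GSeries.var (toLex (Sum.inr i))

/-- The partial derivative `∂/∂x^I` acting on forms, with `∂(dx^J)/∂x^I = 0`. -/
def partialForm (W : Opens D.Space) (i : D.idx) : D.Form W →ₗ[ℝ] D.Form W :=
  if h : D.deg i = 0 then GSeries.mapCoeff (Smooth.pderiv ⟨i, h⟩)
  else GSeries.pderiv (toLex (Sum.inl ⟨i, h⟩))

/-- The de Rham derivative `d = dx^I ∂/∂x^I`. -/
def extD (W : Opens D.Space) (ω : D.Form W) : D.Form W :=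
  ∑ i, D.dx W i * D.partialForm W i ω

variable {D}

/-- `ω` is a `p`-form: it is homogeneous of order `p` in the `dx^I`. -/
def IsPForm {W : Opens D.Space} (p : ℕ) (ω : D.Form W) : Prop :=
  ∀ α, ω.coeff α ≠ 0 → ∑ i, α (toLex (Sum.inr i)) = p

/-- `ω` has `ℤ₂ⁿ`-degree `δ` (the last `n` components of the `ℤ₂ⁿ⁺¹`-degree). -/
def HasDegree {W : Opens D.Space} (δ : Deg n) (ω : D.Form W) : Prop :=
  ∀ α, ω.coeff α ≠ 0 → Fin.tail (monoDeg D.formDeg α) = δ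

/-- Nondegeneracy of `ω = ½ dx^I dx^J ω_JI` in the given coordinates: the matrix of its
components, with `ω_JI = -(-1)^⟨deg J, deg I⟩ ω_IJ`, has a two-sided inverse. -/
def IsNondegenerate {W : Opens D.Space} (ω : D.Form W) : Prop :=
  ∃ c : Matrix D.idx D.idx (D.Fun W),
    (∀ i j, c j i = -(sgn (D.deg j ⬝ᵥ D.deg i) • c i j)) ∧
    ω = (1 / 2 : ℝ) • ∑ i, ∑ j, D.dx W i * D.dx W j * D.ofFun W (c j i) ∧
    ∃ b : Matrix D.idx D.idx (D.Fun W), b * c = 1 ∧ c * b = 1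

end Coords

/-! ### `ℤ₂ⁿ`-manifolds -/

/-- A locally `ℤ₂ⁿ`-ringed space: a second-countable Hausdorff space with a sheaf of
`ℤ₂ⁿ`-graded `ℤ₂ⁿ`-commutative real algebras whose stalks are local rings. -/
structure RingedSpace (n : ℕ) where
  space : TopCat.{u}
  [t2 : T2Space space]
  [secondCountable : SecondCountableTopology space]
  sheaf : TopCat.Sheaf (AlgCat.{u} ℝ) space
  /-- the homogeneous sections of each degree over each open set -/
  grading : ∀ U : Opens space, Deg n → Submodule ℝ (sheaf.presheaf.obj (op U))
  graded : ∀ U, SetLike.GradedMonoid (grading U)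
  isInternal : ∀ U, DirectSum.IsInternal (grading U)
  map_mem : ∀ {U V : Opens space} (h : U ≤ V) (δ : Deg n) (s : sheaf.presheaf.obj (op V)),
    s ∈ grading V δ → (sheaf.presheaf.map (homOfLE h).op).hom s ∈ grading U δ
  graded_comm : ∀ (U : Opens space) (a b : Deg n) (s t : sheaf.presheaf.obj (op U)),
    s ∈ grading U a → t ∈ grading U b → s * t = sgn (a ⬝ᵥ b) • (t * s)
  isLocal_stalk : ∀ x : space, IsLocalRing
    (TopCat.Presheaf.stalk (C := RingCat.{u}) (X := space)
      (sheaf.presheaf ⋙ forget₂ (AlgCat.{u} ℝ) RingCat.{u}) x)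

namespace RingedSpace

variable {n : ℕ} (X : RingedSpace.{u} n)

/-- The algebra of sections over `U`. -/
abbrev Sec (U : Opens X.space) : Type u := X.sheaf.presheaf.obj (op U)

/-- Restriction of sections. -/
def res {U V : Opens X.space} (h : U ≤ V) : X.Sec V →ₐ[ℝ] X.Sec U :=
  (X.sheaf.presheaf.map (homOfLE h).op).hom

/-- Morphisms of `ℤ₂ⁿ`-ringed spaces. -/
structure Hom (X Y : RingedSpace.{u} n) where
  base : C(X.space, Y.space)
  pull : ∀ V : Opens Y.space, Y.Sec V →ₐ[ℝ] X.Sec (Opens.comap base V)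
  pull_mem : ∀ (V : Opens Y.space) (δ : Deg n) (s : Y.Sec V),
    s ∈ Y.grading V δ → pull V s ∈ X.grading (Opens.comap base V) δ
  pull_res : ∀ {V V' : Opens Y.space} (h : V' ≤ V) (s : Y.Sec V),
    pull V' (Y.res h s) = X.res (OrderHomClass.mono (Opens.comap base) h) (pull V s)

/-- A chart: an isomorphism of `ℤ₂ⁿ`-ringed spaces from an open part of `X` to a `ℤ₂ⁿ`-domain with
coordinates `D`. -/
structure Chart (D : Coords n) where
  homeo : OpenPartialHomeomorph X.space D.Space
  /-- the isomorphism between the sections over `U` and the functions on the image of `U` -/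
  readAux : ∀ U : Opens X.space, (U : Set X.space) ⊆ homeo.source →
    (X.Sec U ≃ₐ[ℝ]
      D.Fun ⟨homeo.target ∩ homeo.symm ⁻¹' U, homeo.symm.isOpen_inter_preimage U.isOpen⟩)
  readAux_mem : ∀ (U : Opens X.space) (hU : (U : Set X.space) ⊆ homeo.source) (δ : Deg n)
    (s : X.Sec U), s ∈ X.grading U δ ↔ readAux U hU s ∈ GSeries.homog _ _ δ
  readAux_res : ∀ (U V : Opens X.space) (hV : (V : Set X.space) ⊆ homeo.source) (h : U ≤ V)
    (s : X.Sec V), readAux U (fun _ hx => hV (h hx)) (X.res h s) =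
      Coords.Fun.res D (Set.inter_subset_inter_right _ (Set.preimage_mono h)) (readAux V hV s)

namespace Chart

variable {X} {D : Coords n} (c : X.Chart D)

/-- The chart domain in `X`. -/
def source : Opens X.space := ⟨c.homeo.source, c.homeo.open_source⟩

/-- The image of an open set (of its intersection with the chart domain) in `ℝᵖ`. -/
def img (U : Opens X.space) : Opens D.Space :=
  ⟨c.homeo.target ∩ c.homeo.symm ⁻¹' U, c.homeo.symm.isOpen_inter_preimage U.isOpen⟩

theorem img_mono {U V : Opens X.space} (h : U ≤ V) : c.img U ≤ c.img V :=
  fun _ hy => ⟨hy.1, h hy.2⟩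

/-- The coordinate expression of sections over `U`. -/
def read (U : Opens X.space) (hU : U ≤ c.source) : X.Sec U ≃ₐ[ℝ] D.Fun (c.img U) :=
  c.readAux U hU

/-- The coordinate `x^I` of the chart, as a section over `U`. -/
def coord (U : Opens X.space) (hU : U ≤ c.source) (i : D.idx) : X.Sec U :=
  (c.read U hU).symm (D.coord _ i)

/-- The partial derivative `∂/∂x^I` of the chart, acting on sections over `U`. -/
def partialD (U : Opens X.space) (hU : U ≤ c.source) (i : D.idx) (s : X.Sec U) : X.Sec U :=
  (c.read U hU).symm (D.partialD _ i (c.read U hU s))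

/-- The coordinate transformation `ψ*` from the coordinates of `c'` to those of `c` over `U`. -/
def trans (c c' : X.Chart D) (U : Opens X.space) (h : U ≤ c.source) (h' : U ≤ c'.source) :
    D.Fun (c'.img U) ≃ₐ[ℝ] D.Fun (c.img U) :=
  (c'.read U h').symm.trans (c.read U h)

/-- `Ψ` is the transformation `𝕋ψ*` of forms induced by a coordinate transformation `ψ*`: the
morphism of `ℤ₂ⁿ⁺¹`-graded algebras that extends `ψ*` and sends `dy^I` to `d(ψ* y^I)`. -/
structure IsTangentLift {V W : Opens D.Space} (ψ : D.Fun V ≃ₐ[ℝ] D.Fun W)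
    (Ψ : D.Form V →ₐ[ℝ] D.Form W) : Prop where
  map_mem : ∀ δ, ∀ ω ∈ GSeries.homog D.formDeg (Smooth V) δ,
    Ψ ω ∈ GSeries.homog D.formDeg (Smooth W) δ
  map_ofFun : ∀ f, Ψ (D.ofFun V f) = D.ofFun W (ψ f)
  map_dx : ∀ i, Ψ (D.dx V i) = D.extD W (D.ofFun W (ψ (D.coord V i)))

end Chart

end RingedSpace

/-- A `ℤ₂ⁿ`-manifold with local coordinates of type `D`. -/
structure Manifold {n : ℕ} (D : Coords n) extends RingedSpace.{u} n where
  exists_chart : ∀ x : space, ∃ c : toRingedSpace.Chart D, x ∈ c.source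

namespace Manifold

variable {n : ℕ} {D : Coords n} (M : Manifold.{u} D)

/-- Charts of a manifold. -/
abbrev Chart : Type u := M.toRingedSpace.Chart D

/-- The differential `p`-forms, i.e. the functions on the `ℤ₂ⁿ⁺¹`-tangent bundle that are
homogeneous of order `p` in the differentials: families of local expressions in all charts that
are related by the transformations `𝕋ψ*`. -/
structure DiffForm (p : ℕ) where
  loc : ∀ c : M.Chart, D.Form (c.img c.source)
  isPForm : ∀ c, Coords.IsPForm p (loc c)
  compat : ∀ c c' : M.Chart, ∃ Ψ : D.Form (c'.img (c.source ⊓ c'.source)) →ₐ[ℝ]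
      D.Form (c.img (c.source ⊓ c'.source)),
    RingedSpace.Chart.IsTangentLift (c.trans c' (c.source ⊓ c'.source) inf_le_left inf_le_right) Ψ ∧
    Ψ (Coords.Form.res D (c'.img_mono inf_le_right) (loc c')) =
      Coords.Form.res D (c.img_mono inf_le_left) (loc c)

variable {M}

/-- A symplectic structure of degree `γ`: a two-form of `ℤ₂ⁿ`-degree `γ` that is closed and
nondegenerate. Nondegeneracy is a local condition that does not depend on the coordinates in
which it is tested, as the components transform by invertible Jacobian matrices. -/
structure IsSymplectic (γ : Deg n) (ω : M.DiffForm 2) : Prop where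
  hasDegree : ∀ c, Coords.HasDegree γ (ω.loc c)
  closed : ∀ c : M.Chart, D.extD _ (ω.loc c) = 0
  nondegenerate : ∀ x : M.space, ∃ c : M.Chart, x ∈ c.source ∧ Coords.IsNondegenerate (ω.loc c)

end Manifold

/-! ### Shifted cotangent bundles -/

/-- The coordinates `x^I` of degree `deg I` and `p_J` of degree `deg J + γ`. -/
def Coords.cot {n : ℕ} (D : Coords n) (γ : Deg n) : Coords n where
  idx := Lex (D.idx ⊕ D.idx)
  deg v := Sum.elim D.deg (fun j => D.deg j + γ) (ofLex v)

namespace Coords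

variable {n : ℕ} (D : Coords n) (γ : Deg n)

/-- The index of the coordinate `x^I`. -/
def xIdx (i : D.idx) : (D.cot γ).idx := toLex (Sum.inl i)

/-- The index of the momentum `p_I`. -/
def pIdx (i : D.idx) : (D.cot γ).idx := toLex (Sum.inr i)

/-- The bundle projection in coordinates, forgetting the momenta of degree zero. -/
def baseProj (z : (D.cot γ).Space) : D.Space := fun b => z ⟨D.xIdx γ b.1, b.2⟩

/-- The local form `(-1)^⟨deg I, γ⟩ dx^I dp_I`. -/
def canonicalForm (W : Opens (D.cot γ).Space) : (D.cot γ).Form W :=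
  ∑ i, sgn (D.deg i ⬝ᵥ γ) • ((D.cot γ).dx W (D.xIdx γ i) * (D.cot γ).dx W (D.pIdx γ i))

end Coords

/-- The `γ`-shifted cotangent bundle `Π_γ T*M` of `M`: a `ℤ₂ⁿ`-manifold over `M` with, over each
chart of `M` with coordinates `x^I`, a chart with coordinates `(x^I, p_J)`, where the degree of
`p_J` is `deg J + γ` and the degree zero momenta take all real values, such that the momenta over
two charts are related by
`p_{J'} = (-1)^⟨deg I + deg J', γ⟩ (∂x^I/∂x^{J'}) p_I`. -/
structure ShiftedCotangentBundle {n : ℕ} {D : Coords n} (M : Manifold.{u} D) (γ : Deg n) where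
  total : Manifold.{u} (D.cot γ)
  proj : RingedSpace.Hom total.toRingedSpace M.toRingedSpace
  adapted : M.Chart → total.Chart
  source_eq : ∀ c : M.Chart, (adapted c).source = Opens.comap proj.base c.source
  target_eq : ∀ c : M.Chart, (adapted c).homeo.target = D.baseProj γ ⁻¹' c.homeo.target
  coord_x : ∀ (c : M.Chart) (V : Opens M.space) (hV : V ≤ c.source) (i : D.idx),
    (adapted c).coord (Opens.comap proj.base V)
        ((OrderHomClass.mono (Opens.comap proj.base) hV).trans (source_eq c).ge) (D.xIdx γ i) =
      proj.pull V (c.coord V hV i)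
  coord_p : ∀ (c c' : M.Chart) (V : Opens M.space) (hV : V ≤ c.source) (hV' : V ≤ c'.source)
      (j : D.idx),
    (adapted c').coord (Opens.comap proj.base V)
        ((OrderHomClass.mono (Opens.comap proj.base) hV').trans (source_eq c').ge) (D.pIdx γ j) =
      ∑ i, sgn ((D.deg i + D.deg j) ⬝ᵥ γ) •
        (proj.pull V (c'.partialD V hV' j (c.coord V hV i)) *
          (adapted c).coord (Opens.comap proj.base V)
            ((OrderHomClass.mono (Opens.comap proj.base) hV).trans (source_eq c).ge)
            (D.pIdx γ i))

end Z2n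

end

/-!
The proof rests on one fact about `ℤ₂ⁿ`-domains: a morphism of domains is the same as a family of
functions of the prescribed degrees, the images of the coordinates, whose values lie in the target.

* *Uniqueness* (`eq_zero_of_coordinates`, `fun_hom_ext`). By Hadamard's lemma, and an expansion in
  the formal variables, a function differs from a polynomial in the coordinates by an element of an
  arbitrarily high power of the ideal of functions vanishing at a given point. A linear map that
  kills `1` and turns multiplication by the coordinates into multiplication by their images has
  therefore values that vanish to infinite order at every point, so it is zero. This applies to the
  difference of two morphisms, but also gives the chain rule (`partialD_hom`) and `d² = 0` on
  functions (`extD_differential`).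
* *Existence* (`exists_subst`, `exists_fun_hom`). A smooth function is composed with series by the
  Taylor expansion about their constant terms, a sum which is finite in each order of the formal
  variables.

Let `E` be a shifted cotangent bundle. For a chart of `M` consider, besides the form of the theorem,
the tautological one-form `∑ (-1)^⟨deg I, γ⟩ dx^I p_I` (`tautForm`). Under an admissible coordinate
change the Jacobian matrices in `dx^{I'}` and in `p_{J'}` are inverse to each other by the chain
rule, and the sign `(-1)^⟨deg I + deg J', γ⟩` turns `(-1)^⟨deg J', γ⟩` into `(-1)^⟨deg I, γ⟩`; thus
the one-form is independent of the chart (`tautForm_eq`). The two-form is minus its de Rham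
derivative (`canForm_eq_neg_extD`), hence is independent of the chart as well and closed. It is
nondegenerate because its matrix has exactly one entry in each row and column, a sign
(`isNondegenerate_canonicalForm`). The local expressions glue to a form on `E` (`exists_loc`,
`canonical`), and since the adapted charts cover `E`, no other form has these expressions
(`Manifold.DiffForm.eq_of_cover`).

To construct a shifted cotangent bundle, the underlying space is taken to be the fibre bundle over
`|M|` of the momenta of degree zero (`cotCore`), with the transition functions given by the constant
terms of the admissible coordinate changes. The coordinate changes themselves define morphisms of
domains over the charts of this space (`cotHom`), which satisfy the cocycle condition because
Jacobian matrices do (`jac_comp`, `cotHom_comp`). Domains with transformations that satisfy the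
cocycle condition glue to a `ℤ₂ⁿ`-manifold (`GluingData.manifold`), whose sections are the
compatible families of functions on the charts; locality of the stalks holds since a series with
invertible constant term is invertible. The result is `shiftedCotangentBundle`.
-/

noncomputable section

namespace Z2n

open scoped Matrix
open TopologicalSpace GSeries CategoryTheory Opposite

set_option linter.unusedSectionVars false

/-! ### Algebra of graded power series -/

theorem sgn_mul_self (a : ZMod 2) : sgn a * sgn a = 1 := by revert a; decide

theorem sgn_eq_one_or (a : ZMod 2) : sgn a = 1 ∨ sgn a = -1 := by revert a; decide

theorem sgn_injective : Function.Injective sgn := by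
  intro a b; revert a b; decide

theorem sgn_smul_sgn_smul {A : Type*} [AddCommGroup A] (a b : ZMod 2) (x : A) :
    sgn a • sgn b • x = sgn (a + b) • x := by
  rw [smul_smul, sgn_add]

theorem sgn_smul_self_smul {A : Type*} [AddCommGroup A] (a : ZMod 2) (x : A) :
    sgn a • sgn a • x = x := by
  rw [smul_smul, sgn_mul_self, one_smul]

theorem deg_add_self {n : ℕ} (a : Deg n) : a + a = 0 :=
  funext fun i => CharTwo.add_self_eq_zero (a i)

namespace GSeries

variable {n : ℕ} {J : Type} [Fintype J] [LinearOrder J] {deg : J → Deg n}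
variable {R : Type*} [CommRing R] [Algebra ℝ R]

/-- The coefficient functional of `ξ^α`. -/
def coeffL (α : J →₀ ℕ) : GSeries deg R →ₗ[ℝ] R where
  toFun f := f.coeff α
  map_add' _ _ := rfl
  map_smul' _ _ := rfl

@[simp] theorem coeff_sub (f g : GSeries deg R) (α : J →₀ ℕ) :
    (f - g).coeff α = f.coeff α - g.coeff α := rfl

@[simp] theorem coeff_zsmul (z : ℤ) (f : GSeries deg R) (α : J →₀ ℕ) :
    (z • f).coeff α = z • f.coeff α := (coeffL (deg := deg) (R := R) α).map_smul_of_tower z f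

theorem coeff_sum {ι : Type*} (s : Finset ι) (f : ι → GSeries deg R) (α : J →₀ ℕ) :
    (∑ i ∈ s, f i).coeff α = ∑ i ∈ s, (f i).coeff α :=
  map_sum (coeffL (deg := deg) (R := R) α) f s

theorem coeff_ext {f g : GSeries deg R} (h : ∀ α, f.coeff α = g.coeff α) : f = g :=
  ext fun α _ => h α

open Classical in
theorem coeff_one (α : J →₀ ℕ) :
    (1 : GSeries deg R).coeff α = if α = 0 then 1 else 0 := coeff_const 1 α

open Classical in
theorem coeff_var (j : J) (α : J →₀ ℕ) :
    (var j : GSeries deg R).coeff α = if α = Finsupp.single j 1 then 1 else 0 := by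
  by_cases h : Adm deg α
  · exact coeff_mk _ h
  · rw [coeff_eq_zero _ h, if_neg]
    rintro rfl
    exact h (adm_single j)

/-- The constant series form a subalgebra isomorphic to the coefficient algebra. -/
def constHom : R →ₐ[ℝ] GSeries deg R :=
  AlgHom.ofLinearMap
    { toFun := const
      map_add' := fun a b => coeff_ext fun α => by
        rw [coeff_add, coeff_const, coeff_const, coeff_const]; split_ifs <;> simp
      map_smul' := fun c a => coeff_ext fun α => by
        simp only [coeff_smul, coeff_const, RingHom.id_apply]; split_ifs <;> simp }
    rfl
    (fun a b => coeff_ext fun α => by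
      change (const (a * b) : GSeries deg R).coeff α = (const a * const b : GSeries deg R).coeff α
      rw [const_mul_coeff, coeff_const, coeff_const]; split_ifs <;> simp)

theorem constHom_apply (r : R) : (constHom r : GSeries deg R) = const r := rfl

theorem const_add (a b : R) : (const (a + b) : GSeries deg R) = const a + const b :=
  map_add constHom a b

theorem const_sub (a b : R) : (const (a - b) : GSeries deg R) = const a - const b :=
  map_sub constHom a b

theorem const_mul (a b : R) : (const (a * b) : GSeries deg R) = const a * const b :=
  map_mul constHom a b

theorem const_sum {ι : Type*} (s : Finset ι) (f : ι → R) :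
    (const (∑ i ∈ s, f i) : GSeries deg R) = ∑ i ∈ s, const (f i) :=
  map_sum constHom f s

theorem const_algebraMap (c : ℝ) :
    (const (algebraMap ℝ R c) : GSeries deg R) = algebraMap ℝ _ c :=
  AlgHom.commutes constHom c

theorem const_comm (r : R) (f : GSeries deg R) : const r * f = f * const r :=
  coeff_ext fun α => by rw [const_mul_coeff, mul_const_coeff]

/-- The constant term, as an algebra morphism. -/
def body : GSeries deg R →ₐ[ℝ] R :=
  AlgHom.ofLinearMap (coeffL 0)
    (by change (1 : GSeries deg R).coeff 0 = 1; simp [coeff_one])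
    (by
      classical
      intro f g
      change (f * g).coeff 0 = f.coeff 0 * g.coeff 0
      rw [coeff_mul _ _ adm_zero]
      simp [reorder_zero_left, sgn_zero])

theorem body_apply (f : GSeries deg R) : body f = f.coeff 0 := rfl

@[simp] theorem body_const (r : R) : body (const r : GSeries deg R) = r := by
  simp [body_apply, coeff_const]

@[simp] theorem body_var (j : J) : body (var j : GSeries deg R) = 0 := by
  rw [body_apply, coeff_var, if_neg]
  intro h
  simpa using DFunLike.congr_fun h j

/-! ### Products with a single variable -/

theorem var_mul_coeff_single_add (j : J) (f : GSeries deg R) {β : J →₀ ℕ}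
    (h : Adm deg (Finsupp.single j 1 + β)) :
    (var j * f).coeff (Finsupp.single j 1 + β) =
      sgn (reorder deg (Finsupp.single j 1) β) • f.coeff β := by
  classical
  rw [coeff_mul _ _ h, Finset.sum_eq_single (Finsupp.single j 1, β)]
  · simp [coeff_var]
  · rintro ⟨a, b⟩ hp hne
    have ha : a ≠ Finsupp.single j 1 := by
      rintro rfl
      exact hne (by simpa using hp)
    simp [coeff_var, ha]
  · intro hn
    exact absurd (by simp) hn

theorem var_mul_coeff_eq_zero (j : J) (f : GSeries deg R) {α : J →₀ ℕ} (h : α j = 0) :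
    (var j * f).coeff α = 0 := by
  classical
  by_cases hα : Adm deg α
  · rw [coeff_mul _ _ hα]
    refine Finset.sum_eq_zero fun p hp => ?_
    have : p.1 ≠ Finsupp.single j 1 := by
      intro e
      rw [Finset.HasAntidiagonal.mem_antidiagonal] at hp
      rw [← hp, Finsupp.add_apply, e] at h
      simp at h
    simp [coeff_var, this]
  · exact coeff_eq_zero _ hα

theorem exists_single_add {α : J →₀ ℕ} {j : J} (h : α j ≠ 0) :
    ∃ β, α = Finsupp.single j 1 + β := by
  refine ⟨α - Finsupp.single j 1, (add_tsub_cancel_of_le ?_).symm⟩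
  rw [Finsupp.single_le_iff]
  omega

/-! ### Filtrations by the order of vanishing -/

/-- For an ideal `I` of the coefficient algebra, the `k`-th power of the ideal generated by `I` and
the variables: the coefficient of `ξ^α` lies in `I ^ (k - |α|)`. -/
def Fil (I : Ideal R) (k : ℕ) : Submodule ℝ (GSeries deg R) where
  carrier := {f | ∀ α, f.coeff α ∈ I ^ (k - α.degree)}
  add_mem' hf hg α := add_mem (hf α) (hg α)
  zero_mem' α := zero_mem _
  smul_mem' c f hf α := by
    rw [coeff_smul, Algebra.smul_def]
    exact Ideal.mul_mem_left _ _ (hf α)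

theorem mul_mem_Fil {I : Ideal R} {k l : ℕ} {f g : GSeries deg R} (hf : f ∈ Fil I k)
    (hg : g ∈ Fil I l) : f * g ∈ Fil I (k + l) := by
  classical
  intro α
  by_cases hα : Adm deg α
  · rw [coeff_mul _ _ hα]
    refine sum_mem fun p hp => zsmul_mem ?_ _
    have h1 : α.degree = p.1.degree + p.2.degree := by
      rw [← Finset.HasAntidiagonal.mem_antidiagonal.1 hp, map_add]
    have h2 := Ideal.mul_mem_mul (hf p.1) (hg p.2)
    rw [← pow_add] at h2
    exact Ideal.pow_le_pow_right (by omega) h2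
  · rw [coeff_eq_zero _ hα]
    exact zero_mem _

theorem mem_Fil_zero (I : Ideal R) (f : GSeries deg R) : f ∈ Fil I 0 := fun α => by simp

theorem mem_Fil_one {I : Ideal R} {f : GSeries deg R} (h : body f ∈ I) : f ∈ Fil I 1 := by
  intro α
  by_cases hα : α = 0
  · subst hα; simpa [body_apply] using h
  · have : 1 ≤ α.degree := by
      rw [Nat.one_le_iff_ne_zero, Ne, Finsupp.degree_eq_zero_iff]; exact hα
    rw [Nat.sub_eq_zero_of_le this]; simp

theorem mul_mem_Fil_left {I : Ideal R} {k : ℕ} (f : GSeries deg R) {g : GSeries deg R}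
    (hg : g ∈ Fil I k) : f * g ∈ Fil I k := by
  simpa using mul_mem_Fil (mem_Fil_zero I f) hg

theorem mul_mem_Fil_right {I : Ideal R} {k : ℕ} {f : GSeries deg R} (g : GSeries deg R)
    (hf : f ∈ Fil I k) : f * g ∈ Fil I k := by
  simpa using mul_mem_Fil hf (mem_Fil_zero I g)

theorem mem_Fil_bot {k : ℕ} {f : GSeries deg R} :
    f ∈ Fil (⊥ : Ideal R) k ↔ ∀ α, α.degree < k → f.coeff α = 0 := by
  refine forall_congr' fun α => ?_
  by_cases h : α.degree < k
  · rw [← Ideal.zero_eq_bot, zero_pow (by omega)]; simp [h]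
  · rw [Nat.sub_eq_zero_of_le (by omega)]; simp [h]

theorem eq_zero_of_mem_Fil_bot {f : GSeries deg R} (h : ∀ k, f ∈ Fil (⊥ : Ideal R) k) : f = 0 :=
  coeff_ext fun α => mem_Fil_bot.1 (h (α.degree + 1)) α (Nat.lt_succ_self _)

/-- Convergence of a series of graded power series in the topology given by the total order in the
variables. -/
def HasPSum (a : ℕ → GSeries deg R) (S : GSeries deg R) : Prop :=
  ∀ N, S - ∑ k ∈ Finset.range N, a k ∈ Fil (⊥ : Ideal R) N

theorem HasPSum.unique {a : ℕ → GSeries deg R} {S T : GSeries deg R} (hS : HasPSum a S)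
    (hT : HasPSum a T) : S = T := by
  refine sub_eq_zero.1 (eq_zero_of_mem_Fil_bot fun k => ?_)
  have := sub_mem (hS k) (hT k)
  rwa [sub_sub_sub_cancel_right] at this

/-- The sum of a series whose `k`-th term has order at least `k`. -/
def psum (a : ℕ → GSeries deg R) : GSeries deg R :=
  mk fun α => ∑ k ∈ Finset.range (α.degree + 1), (a k).coeff α

theorem hasPSum_psum {a : ℕ → GSeries deg R} (h : ∀ k, a k ∈ Fil (⊥ : Ideal R) k) :
    HasPSum a (psum a) := by
  intro N
  rw [mem_Fil_bot]
  intro α hα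
  by_cases hA : Adm deg α
  · rw [coeff_sub, psum, coeff_mk _ hA, coeff_sum, sub_eq_zero]
    refine Finset.sum_subset (by intro k hk; simp at hk ⊢; omega) fun k _ hk => ?_
    exact mem_Fil_bot.1 (h k) α (by simp at hk; omega)
  · exact coeff_eq_zero _ hA

theorem HasPSum.add {a b : ℕ → GSeries deg R} {S T : GSeries deg R} (hS : HasPSum a S)
    (hT : HasPSum b T) : HasPSum (fun k => a k + b k) (S + T) := by
  intro N
  rw [Finset.sum_add_distrib, add_sub_add_comm]
  exact add_mem (hS N) (hT N)

theorem HasPSum.mul_left {a : ℕ → GSeries deg R} {S : GSeries deg R} (y : GSeries deg R)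
    (hS : HasPSum a S) : HasPSum (fun k => y * a k) (y * S) := by
  intro N
  rw [← Finset.mul_sum, ← mul_sub]
  exact mul_mem_Fil_left y (hS N)

theorem HasPSum.smul {a : ℕ → GSeries deg R} {S : GSeries deg R} (c : ℝ)
    (hS : HasPSum a S) : HasPSum (fun k => c • a k) (c • S) := by
  intro N
  rw [← Finset.smul_sum, ← smul_sub]
  exact Submodule.smul_mem _ c (hS N)

/-- Multiplication by an element of positive order allows an index shift. -/
theorem HasPSum.shift {a b : ℕ → GSeries deg R} {S y : GSeries deg R}
    (hy : y ∈ Fil (⊥ : Ideal R) 1) (hS : HasPSum a S) (h0 : b 0 = 0)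
    (hb : ∀ k, b (k + 1) = y * a k) : HasPSum b (y * S) := by
  intro N
  cases N with
  | zero => exact mem_Fil_zero _ _
  | succ N =>
    rw [Finset.sum_range_succ', h0, add_zero, Finset.sum_congr rfl fun k _ => hb k,
      ← Finset.mul_sum, ← mul_sub, add_comm]
    exact mul_mem_Fil hy (hS N)

theorem HasPSum.of_single {a : ℕ → GSeries deg R} (h : ∀ k, a (k + 1) = 0) :
    HasPSum a (a 0) := by
  intro N
  cases N with
  | zero => exact mem_Fil_zero _ _
  | succ N => simp [Finset.sum_range_succ', h]

/-! ### Invertible series -/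

/-- The inverse is the geometric series. -/
theorem isUnit_of_body_eq_one {f : GSeries deg R} (h : body f = 1) : IsUnit f := by
  set y := 1 - f with hy
  have hy1 : y ∈ Fil (⊥ : Ideal R) 1 := mem_Fil_one (by simp [hy, h])
  have hk : ∀ k, y ^ k ∈ Fil (⊥ : Ideal R) k := by
    intro k
    induction k with
    | zero => exact mem_Fil_zero _ _
    | succ k ih => rw [pow_succ]; exact mul_mem_Fil ih hy1
  have hS := hasPSum_psum hk
  set S := psum fun k => y ^ k
  have hf : f = 1 - y := by simp [hy]
  have e1 : f * S = 1 := by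
    refine sub_eq_zero.1 (eq_zero_of_mem_Fil_bot fun k => ?_)
    have := mul_mem_Fil_left f (hS k)
    have e : f * S - 1 = f * (S - ∑ i ∈ Finset.range k, y ^ i) - y ^ k := by
      rw [mul_sub, hf, mul_neg_geom_sum]; abel
    rw [e]
    exact sub_mem this (hk k)
  have e2 : S * f = 1 := by
    refine sub_eq_zero.1 (eq_zero_of_mem_Fil_bot fun k => ?_)
    have := mul_mem_Fil_right f (hS k)
    have e : S * f - 1 = (S - ∑ i ∈ Finset.range k, y ^ i) * f - y ^ k := by
      rw [sub_mul, hf, geom_sum_mul_neg]; abel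
    rw [e]
    exact sub_mem this (hk k)
  exact ⟨⟨f, S, e1, e2⟩, rfl⟩

/-- A series is invertible as soon as its constant term is. -/
theorem isUnit_of_isUnit_body {f : GSeries deg R} (h : IsUnit (body f)) : IsUnit f := by
  obtain ⟨u, hu⟩ := h
  have h1 : IsUnit (const (↑u⁻¹ : R) * f) :=
    isUnit_of_body_eq_one (by rw [map_mul, body_const, ← hu, Units.inv_mul])
  have h2 : f = const (↑u : R) * (const (↑u⁻¹ : R) * f) := by
    rw [← mul_assoc, ← const_mul, Units.mul_inv]; exact (one_mul f).symm
  rw [h2]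
  exact (u.isUnit.map (constHom (deg := deg) (R := R))).mul h1

/-! ### Homogeneous series and parity automorphisms -/

theorem monoDeg_add (α β : J →₀ ℕ) : monoDeg deg (α + β) = monoDeg deg α + monoDeg deg β := by
  simp [monoDeg, add_smul, Finset.sum_add_distrib]

theorem monoDeg_zero : monoDeg deg (0 : J →₀ ℕ) = 0 := by simp [monoDeg]

theorem monoDeg_single (j : J) : monoDeg deg (Finsupp.single j 1) = deg j := by
  classical
  rw [monoDeg, Finset.sum_eq_single j] <;> simp +contextual [eq_comm]

theorem mem_homog {δ : Deg n} {f : GSeries deg R} :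
    f ∈ homog deg R δ ↔ ∀ α, monoDeg deg α ≠ δ → f.coeff α = 0 :=
  forall_congr' fun _ => not_imp_comm

theorem const_mem_homog (r : R) : const r ∈ homog deg R 0 := by
  rw [mem_homog]
  intro α hα
  rw [coeff_const, if_neg]
  rintro rfl
  exact hα monoDeg_zero

theorem one_mem_homog : (1 : GSeries deg R) ∈ homog deg R 0 := const_mem_homog 1

theorem var_mem_homog (j : J) : (var j : GSeries deg R) ∈ homog deg R (deg j) := by
  rw [mem_homog]
  intro α hα
  rw [coeff_var, if_neg]
  rintro rfl
  exact hα (monoDeg_single j)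

theorem mul_mem_homog {a b : Deg n} {f g : GSeries deg R} (hf : f ∈ homog deg R a)
    (hg : g ∈ homog deg R b) : f * g ∈ homog deg R (a + b) := by
  classical
  rw [mem_homog] at *
  intro α hα
  by_cases hA : Adm deg α
  · rw [coeff_mul _ _ hA]
    refine Finset.sum_eq_zero fun p hp => ?_
    rw [Finset.HasAntidiagonal.mem_antidiagonal] at hp
    by_cases h1 : monoDeg deg p.1 = a
    · rw [hg p.2, mul_zero, smul_zero]
      rintro h2
      exact hα (by rw [← hp, monoDeg_add, h1, h2])
    · rw [hf p.1 h1, zero_mul, smul_zero]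
  · exact coeff_eq_zero _ hA

theorem body_eq_zero_of_mem_homog {a : Deg n} {f : GSeries deg R} (hf : f ∈ homog deg R a)
    (ha : a ≠ 0) : body f = 0 :=
  mem_homog.1 hf 0 (by rw [monoDeg_zero]; exact ha.symm)

/-- Exchanging the factors of an admissible product of monomials produces the sign of their
degrees: the diagonal terms of the scalar product vanish, as a variable with `⟨deg j, deg j⟩ ≠ 0`
occurs in at most one of the factors. -/
theorem reorder_add_reorder {α β : J →₀ ℕ} (h : Adm deg (α + β)) :
    reorder deg α β + reorder deg β α = monoDeg deg α ⬝ᵥ monoDeg deg β := by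
  have e : monoDeg deg α ⬝ᵥ monoDeg deg β =
      ∑ i, ∑ j, (α i : ZMod 2) * (β j : ZMod 2) * (deg i ⬝ᵥ deg j) := by
    simp only [monoDeg, sum_dotProduct, dotProduct_sum]
    rw [Finset.sum_comm]
    refine Finset.sum_congr rfl fun i _ => Finset.sum_congr rfl fun j _ => ?_
    rw [smul_dotProduct, dotProduct_smul, nsmul_eq_mul, nsmul_eq_mul, mul_assoc]
  have e2 : reorder deg β α = ∑ i, ∑ j, if i < j then
      (α i : ZMod 2) * (β j : ZMod 2) * (deg i ⬝ᵥ deg j) else 0 := by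
    rw [reorder, Finset.sum_comm]
    refine Finset.sum_congr rfl fun i _ => Finset.sum_congr rfl fun j _ => ?_
    rw [dotProduct_comm (deg j), mul_comm (β j : ZMod 2)]
  rw [e, e2, reorder, ← Finset.sum_add_distrib]
  refine Finset.sum_congr rfl fun i _ => ?_
  rw [← Finset.sum_add_distrib]
  refine Finset.sum_congr rfl fun j _ => ?_
  rcases lt_trichotomy i j with hij | rfl | hij
  · simp [hij, hij.not_gt]
  · simp only [lt_irrefl, if_false, add_zero]
    by_cases hi : deg i ⬝ᵥ deg i = 0
    · rw [hi, mul_zero]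
    · have := h i hi
      rw [Finsupp.add_apply] at this
      rcases (by omega : α i = 0 ∨ β i = 0) with h0 | h0 <;> simp [h0]
  · simp [hij, hij.not_gt]

/-- The parity automorphism of a degree `κ`: multiplication by `(-1)^⟨κ, δ⟩` on the series of
degree `δ`. -/
def parityL (κ : Deg n) : GSeries deg R →ₗ[ℝ] GSeries deg R where
  toFun f := mk fun α => sgn (κ ⬝ᵥ monoDeg deg α) • f.coeff α
  map_add' f g := ext fun α hα => by simp only [coeff_mk _ hα, coeff_add, smul_add]
  map_smul' c f := ext fun α hα => by
    simp only [coeff_mk _ hα, coeff_smul, RingHom.id_apply]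
    rw [smul_comm]

theorem coeff_parityL (κ : Deg n) (f : GSeries deg R) (α : J →₀ ℕ) :
    (parityL κ f).coeff α = sgn (κ ⬝ᵥ monoDeg deg α) • f.coeff α := by
  by_cases hα : Adm deg α
  · exact coeff_mk _ hα
  · rw [coeff_eq_zero _ hα, coeff_eq_zero _ hα, smul_zero]

/-- The parity automorphism of a degree `κ`, as an algebra morphism. -/
def parity (κ : Deg n) : GSeries deg R →ₐ[ℝ] GSeries deg R :=
  AlgHom.ofLinearMap (parityL κ)
    (by
      refine coeff_ext fun α => ?_
      rw [coeff_parityL, coeff_one]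
      split_ifs with h
      · rw [h, monoDeg_zero, dotProduct_zero, sgn_zero, one_smul]
      · rw [smul_zero])
    (by
      classical
      intro f g
      refine ext fun α hα => ?_
      rw [coeff_parityL, coeff_mul _ _ hα, coeff_mul _ _ hα, Finset.smul_sum]
      refine Finset.sum_congr rfl fun p hp => ?_
      rw [Finset.HasAntidiagonal.mem_antidiagonal] at hp
      rw [coeff_parityL, coeff_parityL, ← hp, monoDeg_add, dotProduct_add, sgn_add,
        smul_mul_smul_comm, smul_comm])

theorem coeff_parity (κ : Deg n) (f : GSeries deg R) (α : J →₀ ℕ) :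
    (parity κ f).coeff α = sgn (κ ⬝ᵥ monoDeg deg α) • f.coeff α := coeff_parityL κ f α

theorem parity_of_mem_homog (κ : Deg n) {δ : Deg n} {f : GSeries deg R}
    (hf : f ∈ homog deg R δ) : parity κ f = sgn (κ ⬝ᵥ δ) • f := by
  refine coeff_ext fun α => ?_
  rw [coeff_parity, coeff_zsmul]
  by_cases h : monoDeg deg α = δ
  · rw [h]
  · simp [mem_homog.1 hf α h]

theorem parity_parity (κ κ' : Deg n) (f : GSeries deg R) :
    parity κ (parity κ' f) = parity (κ + κ') f :=
  coeff_ext fun α => by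
    rw [coeff_parity, coeff_parity, coeff_parity, sgn_smul_sgn_smul, add_dotProduct]

theorem parity_zero (f : GSeries deg R) : parity 0 f = f :=
  coeff_ext fun α => by rw [coeff_parity, zero_dotProduct, sgn_zero, one_smul]

/-- A homogeneous series is moved past any other one at the cost of a parity automorphism. -/
theorem mul_eq_parity_mul {a : Deg n} {f : GSeries deg R} (hf : f ∈ homog deg R a)
    (g : GSeries deg R) : f * g = parity a g * f := by
  classical
  refine ext fun α hα => ?_
  rw [coeff_mul _ _ hα, coeff_mul _ _ hα]
  refine Finset.sum_nbij' Prod.swap Prod.swap (by simp [add_comm]) (by simp [add_comm])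
    (fun _ _ => rfl) (fun _ _ => rfl) ?_
  rintro ⟨p, q⟩ hp
  rw [Finset.HasAntidiagonal.mem_antidiagonal] at hp
  simp only [Prod.fst_swap, Prod.snd_swap]
  by_cases h1 : monoDeg deg p = a
  · rw [coeff_parity, ← h1, ← reorder_add_reorder (by rwa [hp]), smul_mul_assoc,
      sgn_smul_sgn_smul, add_comm (reorder deg p q), ← add_assoc, CharTwo.add_self_eq_zero,
      zero_add, mul_comm]
  · simp [mem_homog.1 hf p h1]

/-- Graded commutativity. -/
theorem mul_comm_of_mem_homog {a b : Deg n} {f g : GSeries deg R} (hf : f ∈ homog deg R a)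
    (hg : g ∈ homog deg R b) : f * g = sgn (a ⬝ᵥ b) • (g * f) := by
  rw [mul_eq_parity_mul hf, parity_of_mem_homog a hg, smul_mul_assoc]

theorem comm_of_mem_homog_zero {f : GSeries deg R} (hf : f ∈ homog deg R 0)
    (g : GSeries deg R) : f * g = g * f := by
  rw [mul_eq_parity_mul hf, parity_zero]

theorem eq_zero_of_eq_neg {A : Type*} [AddCommGroup A] [Module ℝ A] {x : A} (h : x = -x) :
    x = 0 := by
  have h2 : (2 : ℝ) • x = 0 := by rw [two_smul]; nth_rewrite 1 [h]; simp
  simpa using h2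

/-- The homogeneous series are the joint eigenvectors of the parity automorphisms. -/
theorem mem_homog_iff_parity {δ : Deg n} {f : GSeries deg R} :
    f ∈ homog deg R δ ↔ ∀ κ, parity κ f = sgn (κ ⬝ᵥ δ) • f := by
  refine ⟨fun h κ => parity_of_mem_homog κ h, fun h => mem_homog.2 fun α hα => ?_⟩
  obtain ⟨i, hi⟩ : ∃ i, monoDeg deg α i ≠ δ i := by
    by_contra! hc
    exact hα (funext hc)
  have h1 := congrArg (fun g => coeff g α) (h (Pi.single i 1))
  simp only [coeff_parity, coeff_zsmul, single_one_dotProduct] at h1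
  have h2 : sgn (monoDeg deg α i) ≠ sgn (δ i) := fun e => hi (sgn_injective e)
  apply eq_zero_of_eq_neg
  rcases sgn_eq_one_or (monoDeg deg α i) with e1 | e1 <;>
    rcases sgn_eq_one_or (δ i) with e2 | e2 <;> rw [e1, e2] at h1 h2
  · exact absurd rfl h2
  · simpa using h1
  · simpa using h1.symm
  · exact absurd rfl h2

/-! ### Ordered monomials in elements obeying the commutation relations -/

section Mono

variable {A : Type*} [Ring A] [Algebra ℝ A]

/-- The part of the ordered monomial `η^α` with factors indexed by a list. -/
def listMono (η : J → A) (α : J →₀ ℕ) (l : List J) : A := (l.map fun j => η j ^ α j).prod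

/-- The ordered monomial `η^α` in elements `η_j` of an algebra. -/
def mono (η : J → A) (α : J →₀ ℕ) : A := listMono η α (Finset.univ.sort (· ≤ ·))

theorem listMono_cons (η : J → A) (α : J →₀ ℕ) (j : J) (l : List J) :
    listMono η α (j :: l) = η j ^ α j * listMono η α l := by simp [listMono]

theorem listMono_congr (η : J → A) {α β : J →₀ ℕ} {l : List J} (h : ∀ j ∈ l, α j = β j) :
    listMono η α l = listMono η β l := by
  unfold listMono
  rw [List.map_congr_left fun j hj => by rw [h j hj]]

theorem sum_map_sort {M : Type*} [AddCommMonoid M] (f : J → M) :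
    ((Finset.univ.sort (· ≤ ·)).map f).sum = ∑ j, f j := by
  rw [((Finset.sort_perm_toList _ _).map f).sum_eq, Finset.sum_map_toList]

theorem mul_pow_of_graded_comm {x y : A} {z : ZMod 2} (h : x * y = sgn z • (y * x)) (k : ℕ) :
    x * y ^ k = sgn ((k : ZMod 2) * z) • (y ^ k * x) := by
  induction k with
  | zero => simp [sgn_zero]
  | succ k ih =>
    rw [pow_succ, ← mul_assoc, ih, smul_mul_assoc, mul_assoc, h, mul_smul_comm, smul_smul,
      ← sgn_add, ← mul_assoc, Nat.cast_succ, add_mul, one_mul]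

variable {η : J → A} (hη : ∀ i j, η i * η j = sgn (deg i ⬝ᵥ deg j) • (η j * η i))

include hη in
theorem mul_listMono (i : J) (α : J →₀ ℕ) (l : List J) (hl : l.Pairwise (· < ·)) (hi : i ∈ l) :
    η i * listMono η α l =
      sgn ((l.map fun j => if j < i then (α j : ZMod 2) * (deg i ⬝ᵥ deg j) else 0).sum) •
        listMono η (Finsupp.single i 1 + α) l := by
  induction l with
  | nil => simp at hi
  | cons j l ih =>
    rw [List.pairwise_cons] at hl
    rw [listMono_cons, listMono_cons, List.map_cons, List.sum_cons]
    by_cases hij : i = j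
    · subst hij
      have h1 : (l.map fun j => if j < i then (α j : ZMod 2) * (deg i ⬝ᵥ deg j) else 0) =
          l.map fun _ => 0 :=
        List.map_congr_left fun j hj => if_neg (hl.1 j hj).not_gt
      have h2 : listMono η (Finsupp.single i 1 + α) l = listMono η α l :=
        listMono_congr η fun j hj => by simp [(hl.1 j hj).ne]
      rw [h1, h2]
      simp [sgn_zero, ← mul_assoc, pow_add]
    · have hil : i ∈ l := by simpa [hij] using hi
      have hji := hl.1 i hil
      rw [← mul_assoc, mul_pow_of_graded_comm (hη i j), smul_mul_assoc, mul_assoc, ih hl.2 hil,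
        mul_smul_comm, sgn_smul_sgn_smul, if_pos hji]
      simp [hij]

include hη in
/-- Multiplying an ordered monomial by a generator moves the generator to its place, at the cost of
the sign `reorder`; this is the rule by which monomials in the formal variables multiply. -/
theorem mul_mono (i : J) (α : J →₀ ℕ) :
    η i * mono η α =
      sgn (reorder deg (Finsupp.single i 1) α) • mono η (Finsupp.single i 1 + α) := by
  have h : reorder deg (Finsupp.single i 1) α = ((Finset.univ.sort (· ≤ ·)).map fun j =>
      if j < i then (α j : ZMod 2) * (deg i ⬝ᵥ deg j) else 0).sum := by
    rw [reorder, Finset.sum_eq_single i]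
    · rw [sum_map_sort]
      simp
    · intro b _ hb
      simp [hb.symm]
    · simp
  rw [h]
  exact mul_listMono hη i α _ (Finset.sortedLT_sort _).pairwise (by simp)

include hη in
/-- Inadmissible monomials vanish, since an element that anticommutes with itself has square zero. -/
theorem mono_eq_zero {α : J →₀ ℕ} (hα : ¬ Adm deg α) : mono η α = 0 := by
  simp only [Adm, not_forall, not_le] at hα
  obtain ⟨j, hj, h2⟩ := hα
  have h3 : η j * η j = 0 := by
    apply eq_zero_of_eq_neg
    have h4 : deg j ⬝ᵥ deg j = 1 := by
      revert hj; generalize deg j ⬝ᵥ deg j = z; revert z; decide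
    have := hη j j
    rw [h4] at this
    simpa [sgn, ZMod.val_one] using this
  apply List.prod_eq_zero
  rw [List.mem_map]
  refine ⟨j, by simp, ?_⟩
  obtain ⟨k, hk⟩ := Nat.exists_eq_add_of_le h2
  rw [hk, pow_add, pow_succ, pow_one, h3, zero_mul]

theorem mono_zero (η : J → A) : mono η 0 = 1 := by
  simp [mono, listMono]

end Mono

theorem mono_mem_Fil {m : ℕ} {J' : Type} [Fintype J'] [LinearOrder J'] {deg' : J' → Deg m}
    {η : J → GSeries deg' R} (hη : ∀ j, body (η j) = 0) (α : J →₀ ℕ) :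
    mono η α ∈ Fil (⊥ : Ideal R) α.degree := by
  have key : ∀ l : List J, listMono η α l ∈ Fil (⊥ : Ideal R) (l.map α).sum := by
    intro l
    induction l with
    | nil => exact mem_Fil_zero _ _
    | cons j l ih =>
      rw [listMono_cons, List.map_cons, List.sum_cons]
      refine mul_mem_Fil ?_ ih
      generalize α j = k
      induction k with
      | zero => exact mem_Fil_zero _ _
      | succ k ih => rw [pow_succ]; exact mul_mem_Fil ih (mem_Fil_one (by simp [hη j]))
  have h := key (Finset.univ.sort (· ≤ ·))
  have e : ((Finset.univ.sort (· ≤ ·)).map α).sum = α.degree := by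
    rw [sum_map_sort, Finsupp.degree_eq_sum]
  rwa [e] at h

end GSeries

/-! ### Smooth functions: product rule, Hadamard's lemma, pullback and gluing -/

section Smooth

open scoped ContDiff

/-- Differentiation under the integral sign, iterated `n` times. The target is general because the
induction passes to the derivative. -/
theorem contDiff_nat_intervalIntegral {E : Type} [NormedAddCommGroup E] [NormedSpace ℝ E]
    [FiniteDimensional ℝ E] (n : ℕ) {G : Type} [NormedAddCommGroup G] [NormedSpace ℝ G]
    [CompleteSpace G] {F : E → ℝ → G} (hF : ContDiff ℝ n (Function.uncurry F)) :
    ContDiff ℝ n fun x => ∫ t in (0 : ℝ)..1, F x t := by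
  induction n generalizing G with
  | zero =>
    rw [Nat.cast_zero, contDiff_zero] at *
    exact intervalIntegral.continuous_parametric_intervalIntegral_of_continuous' hF 0 1
  | succ n ih =>
    have hn : ((n + 1 : ℕ) : ℕ∞ω) = (n : ℕ∞ω) + 1 := by norm_cast
    rw [hn] at hF
    set F' : E → ℝ → E →L[ℝ] G := fun x t =>
      (fderiv ℝ (Function.uncurry F) (x, t)).comp (ContinuousLinearMap.inl ℝ E ℝ) with hF'
    have hc : ContDiff ℝ n (Function.uncurry F') :=
      (hF.fderiv_right le_rfl).clm_comp contDiff_const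
    rw [hn, contDiff_succ_iff_hasFDerivAt]
    refine ⟨fun x => ∫ t in (0 : ℝ)..1, F' x t, ih hc, fun x => ?_⟩
    have hd : ∀ x t, HasFDerivAt (fun x => F x t) (F' x t) x := by
      intro x t
      have h1 : HasFDerivAt (Function.uncurry F) (fderiv ℝ (Function.uncurry F) (x, t)) (x, t) :=
        ((hF.differentiable (by simp)) _).hasFDerivAt
      exact HasFDerivAt.comp (f := fun e => (e, t)) x h1 (hasFDerivAt_prodMk_left x t)
    obtain ⟨C, hC⟩ := ((isCompact_closedBall x 1).prod (isCompact_Icc (a := (0 : ℝ)) (b := 1))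
      ).exists_bound_of_continuousOn hc.continuous.continuousOn
    have hFc : ∀ x, Continuous (F x) := fun x =>
      hF.continuous.comp (Continuous.prodMk_right x)
    refine intervalIntegral.hasFDerivAt_integral_of_dominated_of_fderiv_le
      (F := F) (F' := F') (bound := fun _ => C) (s := Metric.closedBall x 1)
      (Metric.closedBall_mem_nhds x one_pos) ?_ ?_ ?_ ?_ ?_ ?_
    · exact Filter.Eventually.of_forall fun x => (hFc x).aestronglyMeasurable
    · exact (hFc x).intervalIntegrable _ _
    · exact (hc.continuous.comp (Continuous.prodMk_right x)).aestronglyMeasurable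
    · refine Filter.Eventually.of_forall fun t ht y hy => hC (y, t) ⟨hy, ?_⟩
      rw [Set.uIoc_of_le zero_le_one] at ht
      exact ⟨ht.1.le, ht.2⟩
    · exact intervalIntegrable_const
    · exact Filter.Eventually.of_forall fun t _ y _ => hd y t

theorem contDiff_intervalIntegral {E : Type} [NormedAddCommGroup E] [NormedSpace ℝ E]
    [FiniteDimensional ℝ E] {G : Type} [NormedAddCommGroup G] [NormedSpace ℝ G]
    [CompleteSpace G] {F : E → ℝ → G} (hF : ContDiff ℝ ∞ (Function.uncurry F)) :
    ContDiff ℝ ∞ fun x => ∫ t in (0 : ℝ)..1, F x t :=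
  contDiff_infty.2 fun n => contDiff_nat_intervalIntegral n (contDiff_infty.1 hF n)

variable {B : Type} [Fintype B]

/-- Hadamard's lemma on all of `ℝᵖ`. -/
theorem exists_hadamard_of_contDiff {F : (B → ℝ) → ℝ} (hF : ContDiff ℝ ∞ F) (y₀ : B → ℝ) :
    ∃ h : B → (B → ℝ) → ℝ, (∀ b, ContDiff ℝ ∞ (h b)) ∧
      ∀ y, F y = F y₀ + ∑ b, (y b - y₀ b) * h b y := by
  classical
  have hF' : ContDiff ℝ ∞ (fderiv ℝ F) := hF.fderiv_right (by simp)
  refine ⟨fun b y => ∫ t in (0 : ℝ)..1, fderiv ℝ F (y₀ + t • (y - y₀)) (Pi.single b 1),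
    fun b => contDiff_intervalIntegral ?_, fun y => ?_⟩
  · refine (hF'.comp ?_).clm_apply contDiff_const
    exact contDiff_const.add (contDiff_snd.smul (contDiff_fst.sub contDiff_const))
  · have hd : ∀ t ∈ Set.uIcc (0 : ℝ) 1, HasDerivAt (fun t : ℝ => F (y₀ + t • (y - y₀)))
        (fderiv ℝ F (y₀ + t • (y - y₀)) (y - y₀)) t := by
      intro t _
      have h1 : HasDerivAt (fun t : ℝ => y₀ + t • (y - y₀)) (y - y₀) t := by
        simpa using ((hasDerivAt_id t).smul_const (y - y₀)).const_add y₀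
      exact ((hF.differentiable (by simp)) _).hasFDerivAt.comp_hasDerivAt t h1
    have hc : ∀ v, Continuous fun t : ℝ => fderiv ℝ F (y₀ + t • (y - y₀)) v := fun v =>
      (hF'.continuous.comp (by fun_prop)).clm_apply continuous_const
    have h2 := intervalIntegral.integral_eq_sub_of_hasDerivAt hd ((hc _).intervalIntegrable _ _)
    have h3 : ∀ t : ℝ, fderiv ℝ F (y₀ + t • (y - y₀)) (y - y₀) =
        ∑ b, (y b - y₀ b) * fderiv ℝ F (y₀ + t • (y - y₀)) (Pi.single b 1) := by
      intro t
      have h4 : y - y₀ = ∑ b, (y b - y₀ b) • (Pi.single b 1 : B → ℝ) := by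
        ext c; simp [Finset.sum_apply, Pi.single_apply]
      conv_lhs => rw [h4, map_sum]
      simp only [← h4, map_smul, smul_eq_mul]
    simp only [h3] at h2
    rw [intervalIntegral.integral_finsetSum fun b _ =>
      ((hc _).const_mul _ |>.intervalIntegrable _ _)] at h2
    simp only [intervalIntegral.integral_const_mul] at h2
    simp at h2
    simp [h2]

variable {W : Opens (B → ℝ)}

namespace Smooth

theorem ext' {f g : Smooth W} (h : ∀ x, f.1 x = g.1 x) : f = g := Subtype.ext (funext h)

/-- The smooth function given on `W` by a function that is smooth on `W`. -/
def ofContDiffOn (W : Opens (B → ℝ)) (F : (B → ℝ) → ℝ) (hF : ContDiffOn ℝ ∞ F W) : Smooth W :=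
  ⟨fun x => F x, F, hF, fun _ => rfl⟩

/-- Evaluation at a point. -/
def eval (x : W) : Smooth W →ₐ[ℝ] ℝ := (Pi.evalAlgHom ℝ _ x).comp (Smooth W).val

theorem eval_apply (x : W) (f : Smooth W) : eval x f = f.1 x := rfl

theorem eval_ext {f g : Smooth W} (h : ∀ x, eval x f = eval x g) : f = g := ext' h

@[simp] theorem eval_coord (x : W) (b : B) : eval x (coord W b) = x.1 b := rfl

theorem isUnit_of_eval_ne_zero {f : Smooth W} (h : ∀ x, eval x f ≠ 0) : IsUnit f := by
  refine IsUnit.of_mul_eq_one (ofContDiffOn W (fun x => (extend f x)⁻¹)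
    ((contDiffOn_extend f).inv fun x hx => ?_)) (ext' fun x => ?_)
  · rw [extend_apply f ⟨x, hx⟩]; exact h ⟨x, hx⟩
  · change f.1 x * (extend f x)⁻¹ = 1
    rw [extend_apply]
    exact mul_inv_cancel₀ (h x)

/-- Hadamard's lemma on an arbitrary open set. -/
theorem exists_hadamard (f : Smooth W) (y₀ : W) :
    ∃ g : B → Smooth W,
      f = algebraMap ℝ _ (eval y₀ f) + ∑ b, (coord W b - algebraMap ℝ _ (y₀.1 b)) * g b := by
  classical
  obtain ⟨r, hr, hrW⟩ := Metric.nhds_basis_closedBall.mem_iff.1 (W.isOpen.mem_nhds y₀.2)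
  let χ : ContDiffBump y₀.1 := ⟨r / 2, r, by positivity, by linarith⟩
  have hχ : ContDiff ℝ ∞ χ := χ.contDiff
  have hχ1 : χ =ᶠ[nhds y₀.1] 1 := χ.eventuallyEq_one
  -- The product of `f` with the bump function is smooth on the whole space.
  have hF : ContDiff ℝ ∞ fun y => χ y * extend f y := by
    rw [contDiff_iff_contDiffAt]
    intro y
    by_cases hy : y ∈ W
    · exact hχ.contDiffAt.mul ((contDiffOn_extend f).contDiffAt (W.isOpen.mem_nhds hy))
    · have h0 : (fun y => χ y * extend f y) =ᶠ[nhds y] fun _ => 0 := by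
        have : (Metric.closedBall y₀.1 r)ᶜ ∈ nhds y :=
          Metric.isClosed_closedBall.isOpen_compl.mem_nhds fun h => hy (hrW h)
        filter_upwards [this] with z hz
        have : χ z = 0 := χ.zero_of_le_dist (by
          rw [Set.mem_compl_iff, Metric.mem_closedBall, not_le] at hz; exact hz.le)
        rw [this, zero_mul]
      exact contDiffAt_const.congr_of_eventuallyEq h0
  obtain ⟨h, hh, hFh⟩ := exists_hadamard_of_contDiff hF y₀.1
  set S : (B → ℝ) → ℝ := fun y => ∑ b, (y b - y₀.1 b) ^ 2 with hS
  have hS0 : ∀ y, S y = 0 → y = y₀.1 := by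
    intro y hy
    rw [hS, Finset.sum_eq_zero_iff_of_nonneg fun b _ => sq_nonneg _] at hy
    exact funext fun b => sub_eq_zero.1 (pow_eq_zero_iff two_ne_zero |>.1 (hy b (by simp)))
  have hSd : ContDiff ℝ ∞ S := by
    refine ContDiff.sum fun b _ => ((contDiff_apply ℝ ℝ b).sub contDiff_const).pow 2
  -- Away from `y₀`, the remainder is divided by the squared Euclidean distance.
  have hq : ContDiff ℝ ∞ fun y => (1 - χ y) * (S y)⁻¹ := by
    rw [contDiff_iff_contDiffAt]
    intro y
    by_cases hy : y = y₀.1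
    · subst hy
      refine contDiffAt_const (c := (0 : ℝ)) |>.congr_of_eventuallyEq ?_
      filter_upwards [hχ1] with z hz
      rw [hz]; simp
    · exact (contDiffAt_const.sub hχ.contDiffAt).mul (hSd.contDiffAt.inv fun h0 => hy (hS0 y h0))
  refine ⟨fun b => ofContDiffOn W
    (fun y => h b y + (y b - y₀.1 b) * ((1 - χ y) * (S y)⁻¹) * extend f y) ?_, ?_⟩
  · exact (hh b).contDiffOn.add ((((contDiff_apply ℝ ℝ b).sub contDiff_const).mul
      hq).contDiffOn.mul (contDiffOn_extend f))
  · refine eval_ext fun y => ?_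
    have h1 : χ y₀.1 = 1 := hχ1.eq_of_nhds
    have h2 := hFh y.1
    have h3 : S y.1 * ((1 - χ y.1) * (S y.1)⁻¹) = 1 - χ y.1 := by
      by_cases hy : S y.1 = 0
      · rw [hS0 _ hy, h1]; simp
      · field_simp
    rw [extend_apply, extend_apply, h1, one_mul] at h2
    have h4 : ∀ b, eval y (ofContDiffOn W
        (fun y => h b y + (y b - y₀.1 b) * ((1 - χ y) * (S y)⁻¹) * extend f y)
        ((hh b).contDiffOn.add ((((contDiff_apply ℝ ℝ b).sub contDiff_const).mul
          hq).contDiffOn.mul (contDiffOn_extend f)))) =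
        h b y + (y.1 b - y₀.1 b) * ((1 - χ y) * (S y)⁻¹) * eval y f := fun b => by
      rw [eval_apply y f, ← extend_apply]; rfl
    simp only [map_add, map_sum, map_mul, map_sub, AlgHom.commutes, eval_coord, h4,
      Algebra.algebraMap_self, RingHom.id_apply, mul_add, Finset.sum_add_distrib]
    have h5 : ∑ b, (y.1 b - y₀.1 b) * ((y.1 b - y₀.1 b) * ((1 - χ y) * (S y)⁻¹) * eval y f) =
        S y.1 * ((1 - χ y.1) * (S y.1)⁻¹) * eval y f := by
      rw [hS, Finset.sum_mul, Finset.sum_mul]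
      exact Finset.sum_congr rfl fun b _ => by ring
    rw [h5, h3, ← add_assoc]
    change eval y f = (f.1 y₀ + _) + _
    rw [← h2]
    change eval y f = χ y.1 * eval y f + _
    ring

theorem pderiv_mul (b : B) (f g : Smooth W) :
    pderiv b (f * g) = pderiv b f * g + f * pderiv b g := by
  classical
  refine ext' fun x => ?_
  have h : extend (f * g) =ᶠ[nhds x.1] fun y => extend f y * extend g y := by
    filter_upwards [W.isOpen.mem_nhds x.2] with y hy
    have e := extend_apply (f * g) ⟨y, hy⟩
    rw [extend_apply f ⟨y, hy⟩, extend_apply g ⟨y, hy⟩]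
    exact e
  change fderiv ℝ (extend (f * g)) x _ =
    fderiv ℝ (extend f) x _ * g.1 x + f.1 x * fderiv ℝ (extend g) x _
  rw [h.fderiv_eq, fderiv_fun_mul (differentiableAt_extend f x) (differentiableAt_extend g x),
    extend_apply, extend_apply]
  simp [mul_comm]
  ring

theorem pderiv_one (b : B) : pderiv b (1 : Smooth W) = 0 := by
  have := pderiv_mul b (1 : Smooth W) 1
  rwa [mul_one, mul_one, one_mul, left_eq_add] at this

open Classical in
theorem pderiv_coord (b c : B) : pderiv b (coord W c) = if c = b then 1 else 0 := by
  refine ext' fun x => ?_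
  have h : extend (coord W c) =ᶠ[nhds x.1] fun y => y c := by
    filter_upwards [W.isOpen.mem_nhds x.2] with y hy
    exact extend_apply (coord W c) ⟨y, hy⟩
  change fderiv ℝ (extend (coord W c)) x _ = _
  rw [h.fderiv_eq, (hasFDerivAt_apply c x.1).fderiv]
  split_ifs with hc
  · subst hc; simp
  · simp [hc]

/-- Pullback of smooth functions along a smooth map `W → V` with components `u_b`. -/
def pullback {B' : Type} [Fintype B'] {V : Opens (B' → ℝ)} (u : B' → Smooth W)
    (hu : ∀ x, (fun b => eval x (u b)) ∈ V) : Smooth V →ₐ[ℝ] Smooth W where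
  toFun f := ⟨fun x => f.1 ⟨fun b => eval x (u b), hu x⟩,
    fun x => extend f fun b => extend (u b) x,
    by
      refine (contDiffOn_extend f).comp (contDiffOn_pi.2 fun b => contDiffOn_extend (u b)) ?_
      intro x hx
      have : (fun b => extend (u b) x) = fun b => eval ⟨x, hx⟩ (u b) :=
        funext fun b => extend_apply (u b) ⟨x, hx⟩
      change (fun b => extend (u b) x) ∈ V
      rw [this]
      exact hu ⟨x, hx⟩,
    by
      intro x
      have : (fun b => extend (u b) x) = fun b => eval x (u b) :=
        funext fun b => extend_apply (u b) x
      change extend f (fun b => extend (u b) x) = _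
      rw [this]
      exact extend_apply f ⟨_, hu x⟩⟩
  map_one' := rfl
  map_mul' _ _ := rfl
  map_zero' := rfl
  map_add' _ _ := rfl
  commutes' _ := rfl

/-- Gluing of smooth functions. -/
theorem exists_glue {ι : Type*} (U : ι → Opens (B → ℝ)) (hU : ∀ i, U i ≤ W)
    (hcov : ∀ x ∈ W, ∃ i, x ∈ U i) (f : ∀ i, Smooth (U i))
    (hf : ∀ i j x (hi : x ∈ U i) (hj : x ∈ U j), eval ⟨x, hi⟩ (f i) = eval ⟨x, hj⟩ (f j)) :
    ∃ g : Smooth W, ∀ i, res (hU i) g = f i := by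
  classical
  choose k hk using fun x : W => hcov x.1 x.2
  set G : (B → ℝ) → ℝ := fun x => if h : x ∈ W then eval ⟨x, hk ⟨x, h⟩⟩ (f (k ⟨x, h⟩)) else 0
  have hG : ∀ i x (hi : x ∈ U i), G x = eval ⟨x, hi⟩ (f i) := by
    intro i x hi
    simp only [G, dif_pos (hU i hi)]
    exact hf _ _ _ _ _
  refine ⟨ofContDiffOn W G fun x hx => ContDiffAt.contDiffWithinAt ?_, fun i => ext' fun x =>
    hG i x x.2⟩
  obtain ⟨i, hi⟩ := hcov x hx
  have h1 : ContDiffAt ℝ ∞ (extend (f i)) x :=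
    (contDiffOn_extend (f i)).contDiffAt ((U i).isOpen.mem_nhds hi)
  refine h1.congr_of_eventuallyEq ?_
  filter_upwards [(U i).isOpen.mem_nhds hi] with y hy
  exact (hG i y hy).trans (extend_apply (f i) ⟨y, hy⟩).symm

end Smooth

end Smooth

/-! ### Maps determined by their effect on coordinates, and substitution -/

namespace GSeries

section General

variable {n : ℕ} {J : Type} [Fintype J] [LinearOrder J] {deg : J → Deg n}
variable {R : Type*} [CommRing R] [Algebra ℝ R]

theorem reorder_single_left (j : J) (β : J →₀ ℕ) :
    reorder deg (Finsupp.single j 1) β =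
      ∑ i, if i < j then (β i : ZMod 2) * (deg j ⬝ᵥ deg i) else 0 := by
  rw [reorder, Finset.sum_eq_single j]
  · simp
  · intro b _ hb
    simp [hb.symm]
  · simp

/-- Every series is the sum of its constant term and multiples of the variables: each monomial is
divided by its first variable. -/
theorem exists_eq_const_add_sum (f : GSeries deg R) :
    ∃ h : J → GSeries deg R, f = const (body f) + ∑ j, var j * h j := by
  classical
  refine ⟨fun j => mk fun β => if ∀ i < j, β i = 0 then
    f.coeff (Finsupp.single j 1 + β) else 0, ext fun α hα => ?_⟩
  rw [coeff_add, coeff_sum, coeff_const]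
  by_cases h0 : α = 0
  · subst h0
    rw [if_pos rfl, Finset.sum_eq_zero fun j _ => var_mul_coeff_eq_zero j _ rfl, add_zero]
    rfl
  · rw [if_neg h0, zero_add]
    have hne : α.support.Nonempty := by simpa using h0
    set j := α.support.min' hne with hj
    have hjα : α j ≠ 0 := by simpa using α.support.min'_mem hne
    have hmin : ∀ i < j, α i = 0 := by
      intro i hi
      by_contra hc
      exact absurd (α.support.min'_le i (by simpa using hc)) (not_le.2 hi)
    rw [Finset.sum_eq_single j]
    · obtain ⟨β, hβ⟩ := exists_single_add hjα
      have hz : ∀ i < j, β i = 0 := by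
        intro i hi
        have := hmin i hi
        rw [hβ] at this
        simpa using (add_eq_zero.1 this).2
      have hA : Adm deg β := hα.of_le (by rw [hβ]; exact le_add_self)
      rw [hβ] at hα ⊢
      rw [var_mul_coeff_single_add j _ hα, coeff_mk _ hA, if_pos hz, reorder_single_left,
        Finset.sum_eq_zero, sgn_zero, one_smul]
      intro i _
      split_ifs with hi
      · simp [hz i hi]
      · rfl
    · intro i _ hij
      by_cases hi : α i = 0
      · exact var_mul_coeff_eq_zero i _ hi
      · have hji : j < i := lt_of_le_of_ne (α.support.min'_le i (by simpa using hi)) hij.symm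
        obtain ⟨β, hβ⟩ := exists_single_add hi
        have hA : Adm deg β := hα.of_le (by rw [hβ]; exact le_add_self)
        rw [hβ] at hα ⊢
        rw [var_mul_coeff_single_add i _ hα, coeff_mk _ hA, if_neg, smul_zero]
        intro hc
        apply hjα
        rw [hβ, Finsupp.add_apply, hc j hji, Finsupp.single_apply, if_neg hij]
    · simp

end General

variable {n m : ℕ} {J J' : Type} [Fintype J] [LinearOrder J] [Fintype J'] [LinearOrder J']
  {deg : J → Deg n} {deg' : J' → Deg m} {B B' : Type} [Fintype B] [Fintype B']
  {W : Opens (B → ℝ)} {V : Opens (B' → ℝ)}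

/-- The value at a point of the constant term, as an algebra morphism. -/
def valueHom (x : W) : GSeries deg (Smooth W) →ₐ[ℝ] ℝ := (Smooth.eval x).comp body

/-- The value at a point of the constant term. -/
def value (x : W) (f : GSeries deg (Smooth W)) : ℝ := Smooth.eval x (body f)

@[simp] theorem value_const (x : W) (f : Smooth W) :
    value x (const f : GSeries deg (Smooth W)) = Smooth.eval x f := by
  rw [value, body_const]

@[simp] theorem value_var (x : W) (j : J) :
    value x (var j : GSeries deg (Smooth W)) = 0 := by
  rw [value, body_var, map_zero]

@[simp] theorem value_sub (x : W) (f g : GSeries deg (Smooth W)) :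
    value x (f - g) = value x f - value x g := map_sub (valueHom x) f g

@[simp] theorem value_add (x : W) (f g : GSeries deg (Smooth W)) :
    value x (f + g) = value x f + value x g := map_add (valueHom x) f g

@[simp] theorem value_mul (x : W) (f g : GSeries deg (Smooth W)) :
    value x (f * g) = value x f * value x g := map_mul (valueHom x) f g

@[simp] theorem value_zero (x : W) : value x (0 : GSeries deg (Smooth W)) = 0 :=
  map_zero (valueHom x)

@[simp] theorem value_one (x : W) : value x (1 : GSeries deg (Smooth W)) = 1 :=
  map_one (valueHom x)

@[simp] theorem value_zsmul (x : W) (z : ℤ) (f : GSeries deg (Smooth W)) :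
    value x (z • f) = z • value x f := map_zsmul (valueHom x) z f

@[simp] theorem value_algebraMap (x : W) (c : ℝ) :
    value x (algebraMap ℝ (GSeries deg (Smooth W)) c) = c := AlgHom.commutes (valueHom x) c

theorem value_sum {ι : Type*} (x : W) (s : Finset ι) (f : ι → GSeries deg (Smooth W)) :
    value x (∑ i ∈ s, f i) = ∑ i ∈ s, value x (f i) := map_sum (valueHom x) f s

/-- The ideal of smooth functions vanishing at a point. -/
def vanishing (x : W) : Ideal (Smooth W) := RingHom.ker (Smooth.eval x)

theorem mem_Fil_vanishing_one {x : W} {f : GSeries deg (Smooth W)} (h : value x f = 0) :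
    f ∈ Fil (vanishing x) 1 :=
  mem_Fil_one h

/-- A series all of whose coefficients vanish to infinite order at each point is zero. -/
theorem eq_zero_of_mem_Fil_vanishing {f : GSeries deg (Smooth W)}
    (h : ∀ (x : W) k, f ∈ Fil (vanishing x) k) : f = 0 := by
  refine coeff_ext fun α => Smooth.eval_ext fun x => ?_
  have := h x (α.degree + 1) α
  rw [Nat.add_sub_cancel_left, pow_one] at this
  exact (RingHom.mem_ker.1 this).trans (map_zero _).symm

/-- Hadamard's lemma for graded power series with smooth coefficients. -/
theorem exists_hadamard (f : GSeries deg (Smooth W)) (y₀ : W) :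
    ∃ (g : B → GSeries deg (Smooth W)) (h : J → GSeries deg (Smooth W)),
      f = algebraMap ℝ _ (value y₀ f) +
        ∑ b, (const (Smooth.coord W b) * g b - y₀.1 b • g b) + ∑ j, var j * h j := by
  obtain ⟨h, hh⟩ := exists_eq_const_add_sum f
  obtain ⟨g, hg⟩ := Smooth.exists_hadamard (body f) y₀
  refine ⟨fun b => const (g b), h, ?_⟩
  conv_lhs => rw [hh, hg]
  rw [const_add, const_algebraMap, const_sum]
  congr 2
  refine Finset.sum_congr rfl fun b _ => ?_
  rw [const_mul, const_sub, sub_mul, const_algebraMap, ← Algebra.smul_def]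

/-- A linear map that vanishes on constants and commutes with the multiplication by coordinates up
to a substitution of the coordinates vanishes identically. By Hadamard's lemma its values lie in all
powers of the maximal ideals of the points. -/
theorem eq_zero_of_coordinates (δ : GSeries deg' (Smooth V) →ₗ[ℝ] GSeries deg (Smooth W))
    (y : B' → GSeries deg (Smooth W)) (η : J' → GSeries deg (Smooth W))
    (hy : ∀ x : W, (fun b => value x (y b)) ∈ V) (hη : ∀ (x : W) j, value x (η j) = 0)
    (h1 : δ 1 = 0) (hb : ∀ b f, δ (const (Smooth.coord V b) * f) = y b * δ f)
    (hj : ∀ j f, δ (var j * f) = η j * δ f) : δ = 0 := by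
  refine LinearMap.ext fun f => eq_zero_of_mem_Fil_vanishing fun (x : W) k => ?_
  induction k generalizing f with
  | zero => exact mem_Fil_zero _ _
  | succ k ih =>
    obtain ⟨g, h, e⟩ := exists_hadamard f ⟨_, hy x⟩
    rw [e, map_add, map_add, Algebra.algebraMap_eq_smul_one, map_smul, h1, smul_zero, zero_add,
      map_sum, map_sum]
    refine add_mem (sum_mem fun b _ => ?_) (sum_mem fun j _ => ?_)
    · rw [map_sub, map_smul, hb, Algebra.smul_def, ← sub_mul, add_comm]
      refine mul_mem_Fil (mem_Fil_vanishing_one ?_) (ih _)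
      simp
    · rw [hj, add_comm]
      exact mul_mem_Fil (mem_Fil_vanishing_one (hη x j)) (ih _)

/-- Two algebra morphisms over the same map of the underlying spaces agree if they agree on the
coordinates. -/
theorem algHom_ext (Φ Ψ : GSeries deg' (Smooth V) →ₐ[ℝ] GSeries deg (Smooth W))
    (hV : ∀ x : W, (fun b => value x (Φ (const (Smooth.coord V b)))) ∈ V)
    (h0 : ∀ (x : W) j, value x (Φ (var j)) = 0)
    (hb : ∀ b, Φ (const (Smooth.coord V b)) = Ψ (const (Smooth.coord V b)))
    (hj : ∀ j, Φ (var j) = Ψ (var j)) : Φ = Ψ := by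
  have := eq_zero_of_coordinates (Φ.toLinearMap - Ψ.toLinearMap)
    (fun b => Φ (const (Smooth.coord V b))) (fun j => Φ (var j)) hV h0
    (by simp) (fun b f => by simp [← hb, mul_sub]) (fun j f => by simp [← hj, mul_sub])
  exact AlgHom.ext fun f => sub_eq_zero.1 (LinearMap.congr_fun this f)

/-- The product rule for maps that are known to be multiplicative for coordinates. -/
theorem map_mul_of_coordinates (Φ : GSeries deg' (Smooth V) →ₗ[ℝ] GSeries deg (Smooth W))
    (y : B' → GSeries deg (Smooth W)) (η : J' → GSeries deg (Smooth W))
    (hy : ∀ x : W, (fun b => value x (y b)) ∈ V) (hη : ∀ (x : W) j, value x (η j) = 0)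
    (h1 : Φ 1 = 1) (hb : ∀ b f, Φ (const (Smooth.coord V b) * f) = y b * Φ f)
    (hj : ∀ j f, Φ (var j * f) = η j * Φ f) (f g : GSeries deg' (Smooth V)) :
    Φ (f * g) = Φ f * Φ g := by
  have := eq_zero_of_coordinates
    (Φ ∘ₗ LinearMap.mulRight ℝ g - LinearMap.mulRight ℝ (Φ g) ∘ₗ Φ) y η hy hη
    (by simp [h1]) (fun b f => by simp [hb, mul_sub, mul_assoc])
    (fun j f => by simp [hj, mul_sub, mul_assoc])
  exact sub_eq_zero.1 (LinearMap.congr_fun this f)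

/-- An algebra morphism preserves degrees if it does so on the coordinates. -/
theorem map_mem_homog {deg' : J' → Deg n}
    (Φ : GSeries deg' (Smooth V) →ₐ[ℝ] GSeries deg (Smooth W))
    (hV : ∀ x : W, (fun b => value x (Φ (const (Smooth.coord V b)))) ∈ V)
    (h0 : ∀ (x : W) j, value x (Φ (var j)) = 0)
    (hb : ∀ b, Φ (const (Smooth.coord V b)) ∈ homog deg (Smooth W) 0)
    (hj : ∀ j, Φ (var j) ∈ homog deg (Smooth W) (deg' j)) {δ : Deg n}
    {f : GSeries deg' (Smooth V)} (hf : f ∈ homog deg' (Smooth V) δ) :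
    Φ f ∈ homog deg (Smooth W) δ := by
  rw [mem_homog_iff_parity]
  intro κ
  have e : Φ.comp (parity κ) = (parity κ).comp Φ := by
    refine algHom_ext _ _ ?_ ?_ ?_ ?_
    · intro x
      simpa [parity_of_mem_homog κ (const_mem_homog _), sgn_zero] using hV x
    · intro x j
      simp [parity_of_mem_homog κ (var_mem_homog j), h0]
    · intro b
      simp [parity_of_mem_homog κ (const_mem_homog _), parity_of_mem_homog κ (hb b)]
    · intro j
      simp [parity_of_mem_homog κ (var_mem_homog j), parity_of_mem_homog κ (hj j)]
  have e' := DFunLike.congr_fun e f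
  simp only [AlgHom.comp_apply, parity_of_mem_homog κ hf, map_zsmul] at e'
  exact e'.symm

/-! ### Composition of smooth functions with series -/

section Subst

variable (y : B' → GSeries deg (Smooth W)) (η : J' → GSeries deg (Smooth W))
  (hV : ∀ x : W, (fun b => value x (y b)) ∈ V)

/-- The `k`-th term of the Taylor expansion of `f(y)` about the constant terms of the `y_b`. -/
def taylorTerm : ℕ → Smooth V →ₗ[ℝ] GSeries deg (Smooth W)
  | 0 => constHom.toLinearMap ∘ₗ (Smooth.pullback (fun b => body (y b)) hV).toLinearMap
  | k + 1 => ((k + 1 : ℝ)⁻¹) • ∑ b, LinearMap.mulLeft ℝ (y b - const (body (y b))) ∘ₗ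
      taylorTerm k ∘ₗ Smooth.pderiv b

theorem taylorTerm_succ (k : ℕ) (f : Smooth V) :
    taylorTerm y hV (k + 1) f = ((k + 1 : ℝ)⁻¹) • ∑ b, (y b - const (body (y b))) *
      taylorTerm y hV k (Smooth.pderiv b f) := by
  simp [taylorTerm, LinearMap.sum_apply]

theorem taylorTerm_mem (k : ℕ) (f : Smooth V) :
    taylorTerm y hV k f ∈ Fil (⊥ : Ideal (Smooth W)) k := by
  induction k generalizing f with
  | zero => exact mem_Fil_zero _ _
  | succ k ih =>
    rw [taylorTerm_succ]
    refine Submodule.smul_mem _ _ (sum_mem fun b _ => ?_)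
    rw [add_comm]
    exact mul_mem_Fil (mem_Fil_one (by simp)) (ih _)

/-- The composite `f(y)` of a smooth function with series `y_b`. -/
def taylor : Smooth V →ₗ[ℝ] GSeries deg (Smooth W) where
  toFun f := psum fun k => taylorTerm y hV k f
  map_add' f g := (hasPSum_psum (taylorTerm_mem y hV · (f + g))).unique (by
    simpa using (hasPSum_psum (taylorTerm_mem y hV · f)).add
      (hasPSum_psum (taylorTerm_mem y hV · g)))
  map_smul' c f := (hasPSum_psum (taylorTerm_mem y hV · (c • f))).unique (by
    simpa using (hasPSum_psum (taylorTerm_mem y hV · f)).smul c)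

theorem hasPSum_taylor (f : Smooth V) :
    HasPSum (fun k => taylorTerm y hV k f) (taylor y hV f) :=
  hasPSum_psum (taylorTerm_mem y hV · f)

theorem taylor_one : taylor y hV 1 = 1 := by
  have h0 : taylorTerm y hV 0 1 = 1 := by simp [taylorTerm]
  have h := hasPSum_taylor y hV 1
  have h' := HasPSum.of_single (a := fun k => taylorTerm y hV k 1) fun k => by
    simp [taylorTerm_succ, Smooth.pderiv_one]
  exact (h.unique h').trans h0

variable (hc : ∀ b g, y b * g = g * y b)

include hc in
/-- The product with a coordinate, term by term: `y_b` is its constant term plus a correction that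
raises the order by one. -/
theorem taylorTerm_coord_mul (b : B') (f : Smooth V) (k : ℕ) :
    taylorTerm y hV (k + 1) (Smooth.coord V b * f) =
      const (body (y b)) * taylorTerm y hV (k + 1) f +
        (y b - const (body (y b))) * taylorTerm y hV k f := by
  classical
  have hc' : ∀ b c g, (y c - const (body (y c))) * (const (body (y b)) * g) =
      const (body (y b)) * ((y c - const (body (y c))) * g) := fun b c g => by
    rw [← mul_assoc, ← const_comm, mul_assoc]
  have hcc : ∀ b c g, (y c - const (body (y c))) * ((y b - const (body (y b))) * g) =
      (y b - const (body (y b))) * ((y c - const (body (y c))) * g) := fun b c g => by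
    rw [← mul_assoc, ← mul_assoc, sub_mul (y c), hc, const_comm, ← mul_sub]
  have e : ∀ k f, ∑ c, (y c - const (body (y c))) * taylorTerm y hV k (Smooth.pderiv c f) =
      (k + 1 : ℝ) • taylorTerm y hV (k + 1) f := fun k f => by
    rw [taylorTerm_succ, smul_smul, mul_inv_cancel₀ (by positivity), one_smul]
  have hd : ∀ c, Smooth.pderiv c (Smooth.coord V b * f) =
      (if b = c then f else 0) + Smooth.coord V b * Smooth.pderiv c f := fun c => by
    rw [Smooth.pderiv_mul, Smooth.pderiv_coord, ite_mul, one_mul, zero_mul]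
  induction k generalizing f with
  | zero =>
    have h0 : ∀ g, taylorTerm y hV 0 (Smooth.coord V b * g) =
        const (body (y b)) * taylorTerm y hV 0 g := fun g => by
      have e : Smooth.pullback (fun b => body (y b)) hV (Smooth.coord V b) = body (y b) :=
        Smooth.eval_ext fun x => rfl
      simp [taylorTerm, constHom_apply, const_mul, e]
    have hterm : ∀ c, (y c - const (body (y c))) *
        taylorTerm y hV 0 (Smooth.pderiv c (Smooth.coord V b * f)) =
        (if b = c then (y b - const (body (y b))) * taylorTerm y hV 0 f else 0) +
        const (body (y b)) * ((y c - const (body (y c))) * taylorTerm y hV 0 (Smooth.pderiv c f)) := by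
      intro c
      rw [hd, map_add, mul_add, h0, hc']
      congr 1
      split_ifs with h
      · rw [h]
      · rw [map_zero, mul_zero]
    rw [taylorTerm_succ, Finset.sum_congr rfl fun c _ => hterm c, Finset.sum_add_distrib,
      ← Finset.mul_sum, e]
    simp only [Finset.sum_ite_eq, Finset.mem_univ, if_true, Nat.cast_zero, zero_add, inv_one,
      one_smul]
    exact add_comm _ _
  | succ k ih =>
    have hterm : ∀ c, (y c - const (body (y c))) *
        taylorTerm y hV (k + 1) (Smooth.pderiv c (Smooth.coord V b * f)) =
        (if b = c then (y b - const (body (y b))) * taylorTerm y hV (k + 1) f else 0) +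
        (const (body (y b)) *
          ((y c - const (body (y c))) * taylorTerm y hV (k + 1) (Smooth.pderiv c f)) +
        (y b - const (body (y b))) *
          ((y c - const (body (y c))) * taylorTerm y hV k (Smooth.pderiv c f))) := by
      intro c
      rw [hd, map_add, mul_add, ih, mul_add, hc', hcc]
      · congr 1
        split_ifs with h
        · rw [h]
        · rw [map_zero, mul_zero]
      · intro c
        rw [Smooth.pderiv_mul, Smooth.pderiv_coord, ite_mul, one_mul, zero_mul]
    rw [taylorTerm_succ, Finset.sum_congr rfl fun c _ => hterm c, Finset.sum_add_distrib,
      Finset.sum_add_distrib, ← Finset.mul_sum, ← Finset.mul_sum, e, e, mul_smul_comm,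
      mul_smul_comm]
    simp only [Finset.sum_ite_eq, Finset.mem_univ, if_true, Nat.cast_succ]
    generalize const (body (y b)) * taylorTerm y hV (k + 1 + 1) f = p
    generalize (y b - const (body (y b))) * taylorTerm y hV (k + 1) f = q
    have hk : (k : ℝ) + 1 + 1 ≠ 0 := by positivity
    match_scalars <;> field_simp
    ring

include hc in
theorem taylor_coord_mul (b : B') (f : Smooth V) :
    taylor y hV (Smooth.coord V b * f) = y b * taylor y hV f := by
  have h := hasPSum_taylor y hV f
  have e : y b = const (body (y b)) + (y b - const (body (y b))) := by abel
  have h2 : HasPSum (fun k => Nat.casesOn k 0 fun k =>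
      (y b - const (body (y b))) * taylorTerm y hV k f) ((y b - const (body (y b))) * taylor y hV f) :=
    h.shift (mem_Fil_one (by simp)) rfl fun k => rfl
  rw [e, add_mul]
  refine (hasPSum_taylor y hV _).unique ?_
  convert (h.mul_left (const (body (y b)))).add h2 using 1
  funext k
  cases k with
  | zero =>
    have e : Smooth.pullback (fun b => body (y b)) hV (Smooth.coord V b) = body (y b) :=
      Smooth.eval_ext fun x => rfl
    simp [taylorTerm, constHom_apply, const_mul, e]
  | succ k => exact taylorTerm_coord_mul y hV hc b f k

end Subst

end GSeries

namespace GSeries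

variable {n m : ℕ} {J J' : Type} [Fintype J] [LinearOrder J] [Fintype J'] [LinearOrder J']
  {deg : J → Deg n} {deg' : J' → Deg m} {B B' : Type} [Fintype B] [Fintype B']
  {W : Opens (B → ℝ)} {V : Opens (B' → ℝ)}

section Subst

variable (y : B' → GSeries deg (Smooth W)) (η : J' → GSeries deg (Smooth W))
  (hV : ∀ x : W, (fun b => value x (y b)) ∈ V)

/-- The part of `∑ α, η^α f_α(y)` of total order `k` in the `η_j`. -/
def substTerm (k : ℕ) : GSeries deg' (Smooth V) →ₗ[ℝ] GSeries deg (Smooth W) :=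
  ∑ α ∈ Finset.finsuppAntidiag Finset.univ k,
    LinearMap.mulLeft ℝ (mono η α) ∘ₗ taylor y hV ∘ₗ coeffL α

theorem substTerm_apply (k : ℕ) (f : GSeries deg' (Smooth V)) :
    substTerm y η hV k f = ∑ α ∈ Finset.finsuppAntidiag Finset.univ k,
      mono η α * taylor y hV (f.coeff α) := by
  simp [substTerm, LinearMap.sum_apply]
  rfl

theorem degree_of_mem_finsuppAntidiag {k : ℕ} {α : J' →₀ ℕ} :
    α ∈ Finset.finsuppAntidiag Finset.univ k ↔ α.degree = k := by
  simp [Finsupp.degree_eq_sum]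

variable (hη : ∀ j, body (η j) = 0)

include hη in
theorem substTerm_mem (k : ℕ) (f : GSeries deg' (Smooth V)) :
    substTerm y η hV k f ∈ Fil (⊥ : Ideal (Smooth W)) k := by
  rw [substTerm_apply]
  refine sum_mem fun α hα => mul_mem_Fil_right _ ?_
  rw [degree_of_mem_finsuppAntidiag] at hα
  rw [← hα]
  exact mono_mem_Fil hη α

/-- The substitution `∑ α, η^α f_α(y)`. -/
def substL : GSeries deg' (Smooth V) →ₗ[ℝ] GSeries deg (Smooth W) where
  toFun f := psum fun k => substTerm y η hV k f
  map_add' f g := (hasPSum_psum (substTerm_mem y η hV hη · (f + g))).unique (by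
    simpa using (hasPSum_psum (substTerm_mem y η hV hη · f)).add
      (hasPSum_psum (substTerm_mem y η hV hη · g)))
  map_smul' c f := (hasPSum_psum (substTerm_mem y η hV hη · (c • f))).unique (by
    simpa using (hasPSum_psum (substTerm_mem y η hV hη · f)).smul c)

theorem hasPSum_substL (f : GSeries deg' (Smooth V)) :
    HasPSum (fun k => substTerm y η hV k f) (substL y η hV hη f) :=
  hasPSum_psum (substTerm_mem y η hV hη · f)

theorem substL_one : substL y η hV hη (1 : GSeries deg' (Smooth V)) = 1 := by
  have h0 : ∀ k, substTerm y η hV k (1 : GSeries deg' (Smooth V)) = if k = 0 then 1 else 0 := by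
    intro k
    rw [substTerm_apply]
    split_ifs with hk
    · rw [Finset.sum_eq_single 0]
      · rw [mono_zero, coeff_one, if_pos rfl, taylor_one, mul_one]
      · intro α _ hα
        rw [coeff_one, if_neg hα, map_zero, mul_zero]
      · intro h
        exact absurd (degree_of_mem_finsuppAntidiag.2 (by simp [hk])) h
    · refine Finset.sum_eq_zero fun α hα => ?_
      rw [degree_of_mem_finsuppAntidiag] at hα
      rw [coeff_one, if_neg, map_zero, mul_zero]
      rintro rfl
      exact hk (by simpa using hα.symm)
  have h := hasPSum_substL y η hV hη (1 : GSeries deg' (Smooth V))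
  have h' := HasPSum.of_single (a := fun k => substTerm y η hV k (1 : GSeries deg' (Smooth V)))
    fun k => (h0 (k + 1)).trans (if_neg (Nat.succ_ne_zero k))
  exact (h.unique h').trans ((h0 0).trans (if_pos rfl))

theorem substL_coord_mul (hc : ∀ b g, y b * g = g * y b) (b : B')
    (f : GSeries deg' (Smooth V)) :
    substL y η hV hη (const (Smooth.coord V b) * f) = y b * substL y η hV hη f := by
  refine (hasPSum_substL y η hV hη _).unique ?_
  convert (hasPSum_substL y η hV hη f).mul_left (y b) using 1
  funext k
  rw [substTerm_apply, substTerm_apply, Finset.mul_sum]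
  refine Finset.sum_congr rfl fun α _ => ?_
  rw [const_mul_coeff, taylor_coord_mul y hV hc, ← mul_assoc, ← hc, mul_assoc]

theorem substL_var_mul
    (hcomm : ∀ i j, η i * η j = sgn (deg' i ⬝ᵥ deg' j) • (η j * η i)) (j : J')
    (f : GSeries deg' (Smooth V)) :
    substL y η hV hη (var j * f) = η j * substL y η hV hη f := by
  refine (hasPSum_substL y η hV hη _).unique ?_
  refine (hasPSum_substL y η hV hη f).shift (mem_Fil_one (by simp [hη])) ?_ fun k => ?_
  · rw [substTerm_apply]
    refine Finset.sum_eq_zero fun α hα => ?_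
    rw [degree_of_mem_finsuppAntidiag, Finsupp.degree_eq_zero_iff] at hα
    rw [hα, var_mul_coeff_eq_zero j f rfl, map_zero, mul_zero]
  · rw [substTerm_apply, substTerm_apply, Finset.mul_sum]
    symm
    refine Finset.sum_of_injOn (fun β => Finsupp.single j 1 + β) ?_ ?_ ?_ ?_
    · intro α _ β _ h
      exact add_left_cancel h
    · intro β hβ
      rw [Finset.mem_coe, degree_of_mem_finsuppAntidiag] at hβ ⊢
      rw [map_add, hβ, Finsupp.degree_single, add_comm]
    · intro α hα hn
      rw [degree_of_mem_finsuppAntidiag] at hα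
      by_cases h0 : α j = 0
      · rw [var_mul_coeff_eq_zero j f h0, map_zero, mul_zero]
      · obtain ⟨β, rfl⟩ := exists_single_add h0
        refine absurd ⟨β, ?_, rfl⟩ hn
        rw [Finset.mem_coe, degree_of_mem_finsuppAntidiag]
        rw [map_add, Finsupp.degree_single] at hα
        omega
    · intro β _
      rw [← mul_assoc, mul_mono hcomm]
      by_cases hA : Adm deg' (Finsupp.single j 1 + β)
      · rw [var_mul_coeff_single_add j f hA, smul_mul_assoc, map_zsmul, mul_smul_comm]
      · rw [mono_eq_zero hcomm hA, smul_zero, zero_mul, zero_mul]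

end Subst

/-- Existence of substitutions: coordinates may be replaced by arbitrary homogeneous series of the
same degrees whose constant terms take values in the domain. -/
theorem exists_subst {deg' : J' → Deg n} (hdeg : ∀ j, deg' j ≠ 0)
    (y : B' → GSeries deg (Smooth W)) (η : J' → GSeries deg (Smooth W))
    (hV : ∀ x : W, (fun b => value x (y b)) ∈ V)
    (hy : ∀ b, y b ∈ homog deg (Smooth W) 0) (hη : ∀ j, η j ∈ homog deg (Smooth W) (deg' j)) :
    ∃ Φ : GSeries deg' (Smooth V) →ₐ[ℝ] GSeries deg (Smooth W),
      (∀ b, Φ (const (Smooth.coord V b)) = y b) ∧ (∀ j, Φ (var j) = η j) ∧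
      ∀ δ, ∀ f ∈ homog deg' (Smooth V) δ, Φ f ∈ homog deg (Smooth W) δ := by
  have h0 : ∀ j, body (η j) = 0 := fun j => body_eq_zero_of_mem_homog (hη j) (hdeg j)
  have h0' : ∀ (x : W) j, value x (η j) = 0 := fun x j => by rw [value, h0, map_zero]
  have hb := substL_coord_mul (deg' := deg') y η hV h0 fun b g => comm_of_mem_homog_zero (hy b) g
  have hj := substL_var_mul (deg' := deg') y η hV h0 fun i j => mul_comm_of_mem_homog (hη i) (hη j)
  have h1 := substL_one (deg' := deg') y η hV h0
  set Φ : GSeries deg' (Smooth V) →ₐ[ℝ] GSeries deg (Smooth W) :=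
    AlgHom.ofLinearMap (substL y η hV h0) h1
      (map_mul_of_coordinates _ y η hV h0' h1 hb hj) with hΦ
  have e1 : ∀ b, Φ (const (Smooth.coord V b)) = y b := fun b => by
    have := hb b 1
    rwa [mul_one, h1, mul_one] at this
  have e2 : ∀ j, Φ (var j) = η j := fun j => by
    have := hj j 1
    rwa [mul_one, h1, mul_one] at this
  refine ⟨Φ, e1, e2, fun δ f hf => map_mem_homog Φ ?_ ?_ ?_ ?_ hf⟩
  · intro x; simpa [e1] using hV x
  · intro x j; rw [e2, h0']
  · intro b; rw [e1]; exact hy b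
  · intro j; rw [e2]; exact hη j

end GSeries

/-! ### Partial derivatives -/

namespace GSeries

section General

variable {n : ℕ} {J : Type} [Fintype J] [LinearOrder J] {deg : J → Deg n}
variable {R : Type*} [CommRing R] [Algebra ℝ R]

theorem coeff_pderiv (j : J) (f : GSeries deg R) {α : J →₀ ℕ} (hα : Adm deg α) :
    (pderiv j f).coeff α = sgn (reorder deg (Finsupp.single j 1) α) •
      (α j + 1) • f.coeff (Finsupp.single j 1 + α) := by
  rw [reorder_single_left]
  simp only [dotProduct_comm (deg j)]
  rw [add_comm (Finsupp.single j 1)]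
  exact coeff_mk _ hα

theorem pderiv_const_mul (j : J) (r : R) (f : GSeries deg R) :
    pderiv j (const r * f) = const r * pderiv j f := by
  refine ext fun α hα => ?_
  rw [const_mul_coeff, coeff_pderiv j _ hα, coeff_pderiv j _ hα, const_mul_coeff,
    mul_smul_comm, mul_smul_comm]

theorem pderiv_one (j : J) : pderiv j (1 : GSeries deg R) = 0 := by
  classical
  refine ext fun α hα => ?_
  rw [coeff_pderiv j _ hα, coeff_one, if_neg]
  · simp
  · intro h
    have := DFunLike.congr_fun h j
    simp at this

theorem dotProduct_self_of_ne {j : J} (h : deg j ⬝ᵥ deg j ≠ 0) : deg j ⬝ᵥ deg j = 1 := by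
  revert h; generalize deg j ⬝ᵥ deg j = z; revert z; decide

open Classical in
/-- The product rule for a variable and a series. -/
theorem pderiv_var_mul (j i : J) (f : GSeries deg R) :
    pderiv j (var i * f) =
      (if i = j then f else 0) + sgn (deg j ⬝ᵥ deg i) • (var i * pderiv j f) := by
  refine ext fun α hα => ?_
  rw [coeff_pderiv j _ hα, coeff_add, coeff_zsmul]
  by_cases hij : i = j
  · subst hij
    rw [if_pos rfl]
    have hA : ∀ h : α i ≠ 0, (var i * pderiv i f).coeff α = α i • f.coeff α := by
      intro h
      obtain ⟨β, rfl⟩ := exists_single_add h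
      rw [var_mul_coeff_single_add i _ hα, coeff_pderiv i _ (hα.of_le le_add_self),
        sgn_smul_self_smul]
      simp [add_comm]
    by_cases hadm : Adm deg (Finsupp.single i 1 + α)
    · rw [var_mul_coeff_single_add i _ hadm, smul_comm (sgn _), sgn_smul_self_smul, add_smul,
        one_smul, add_comm]
      congr 1
      by_cases h0 : α i = 0
      · rw [h0, zero_smul, var_mul_coeff_eq_zero i _ h0, smul_zero]
      · rw [hA h0]
        by_cases hd : deg i ⬝ᵥ deg i = 0
        · rw [hd, sgn_zero, one_smul]
        · have := hadm i hd
          simp at this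
          exact absurd this h0
    · have h1 : deg i ⬝ᵥ deg i ≠ 0 ∧ α i = 1 := by
        simp only [Adm, not_forall] at hadm
        obtain ⟨k, hk, hk2⟩ := hadm
        have := hα k hk
        rw [Finsupp.add_apply, Finsupp.single_apply] at hk2
        split_ifs at hk2 with h
        · subst h; exact ⟨hk, by omega⟩
        · omega
      rw [coeff_eq_zero _ hadm, hA (by omega), h1.2, dotProduct_self_of_ne h1.1]
      simp [sgn, ZMod.val_one]
  · rw [if_neg hij, coeff_zero, zero_add]
    by_cases h0 : α i = 0
    · rw [var_mul_coeff_eq_zero i _ h0, smul_zero,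
        var_mul_coeff_eq_zero i _ (by simp [h0, Ne.symm hij]), smul_zero, smul_zero]
    · obtain ⟨β, rfl⟩ := exists_single_add h0
      have hβ : Adm deg β := hα.of_le le_add_self
      rw [var_mul_coeff_single_add i _ hα, coeff_pderiv j _ hβ, add_left_comm]
      by_cases hadm : Adm deg (Finsupp.single i 1 + (Finsupp.single j 1 + β))
      · rw [var_mul_coeff_single_add i _ hadm, Finsupp.add_apply, Finsupp.single_apply,
          if_neg hij, zero_add, smul_comm (sgn _) (β j + 1), smul_comm (sgn _) (β j + 1),
          smul_comm (sgn _) (β j + 1), smul_comm (sgn _) (β j + 1), sgn_smul_sgn_smul,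
          sgn_smul_sgn_smul, sgn_smul_sgn_smul]
        congr 2
        have h1 : reorder deg (Finsupp.single j 1) (Finsupp.single i 1) +
            reorder deg (Finsupp.single i 1) (Finsupp.single j 1) = deg j ⬝ᵥ deg i := by
          rw [reorder_add_reorder, monoDeg_single, monoDeg_single]
          refine hadm.of_le ?_
          rw [add_left_comm, ← add_assoc]
          exact le_self_add
        rw [reorder_add_right, reorder_add_right, ← h1]
        congr 1
        ring
      · rw [coeff_eq_zero _ hadm, coeff_eq_zero f, smul_zero, smul_zero, smul_zero, smul_zero,
          smul_zero, smul_zero]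
        intro hc
        refine hadm fun k hk => ?_
        have h1 := hc k hk
        have h2 := hα k hk
        simp only [Finsupp.add_apply, Finsupp.single_apply] at h1 h2 ⊢
        by_cases hik : i = k
        · subst hik
          simp [Ne.symm hij] at h1 h2 ⊢
          exact h2
        · simp [hik] at h1 ⊢
          exact h1

theorem pderiv_mem_homog (j : J) {δ : Deg n} {f : GSeries deg R} (hf : f ∈ homog deg R δ) :
    pderiv j f ∈ homog deg R (deg j + δ) := by
  rw [mem_homog] at *
  intro α hα
  by_cases hA : Adm deg α
  · rw [coeff_pderiv j _ hA, hf, smul_zero, smul_zero]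
    rw [monoDeg_add, monoDeg_single]
    rintro rfl
    exact hα (by rw [← add_assoc, deg_add_self, zero_add])
  · exact coeff_eq_zero _ hA

theorem coeff_mapCoeff {S : Type*} [CommRing S] [Algebra ℝ S] (φ : R →ₗ[ℝ] S)
    (f : GSeries deg R) (α : J →₀ ℕ) : (mapCoeff φ f).coeff α = φ (f.coeff α) := rfl

theorem mapCoeff_mem_homog {S : Type*} [CommRing S] [Algebra ℝ S] (φ : R →ₗ[ℝ] S) {δ : Deg n}
    {f : GSeries deg R} (hf : f ∈ homog deg R δ) : mapCoeff φ f ∈ homog deg S δ := by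
  rw [mem_homog] at *
  intro α hα
  rw [coeff_mapCoeff, hf α hα, map_zero]

/-- A derivation of the coefficients acts as a derivation on series. -/
theorem mapCoeff_mul (φ : R →ₗ[ℝ] R) (hφ : ∀ a b, φ (a * b) = φ a * b + a * φ b)
    (f g : GSeries deg R) : mapCoeff φ (f * g) = mapCoeff φ f * g + f * mapCoeff φ g := by
  classical
  refine ext fun α hα => ?_
  rw [coeff_add, coeff_mapCoeff, coeff_mul _ _ hα, coeff_mul _ _ hα, coeff_mul _ _ hα, map_sum,
    ← Finset.sum_add_distrib]
  refine Finset.sum_congr rfl fun p _ => ?_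
  rw [map_zsmul, hφ, smul_add, coeff_mapCoeff, coeff_mapCoeff]

end General

variable {n : ℕ} {J : Type} [Fintype J] [LinearOrder J] {deg : J → Deg n}
  {B : Type} [Fintype B] {W : Opens (B → ℝ)}

/-- The derivative with respect to a coordinate of the domain. -/
def baseDeriv (b : B) : GSeries deg (Smooth W) →ₗ[ℝ] GSeries deg (Smooth W) :=
  mapCoeff (R := Smooth W) (S := Smooth W) (Smooth.pderiv b)

theorem coeff_baseDeriv (b : B) (f : GSeries deg (Smooth W)) (α : J →₀ ℕ) :
    (baseDeriv b f).coeff α = Smooth.pderiv b (f.coeff α) := rfl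

theorem baseDeriv_mul (b : B) (f g : GSeries deg (Smooth W)) :
    baseDeriv b (f * g) = baseDeriv b f * g + f * baseDeriv b g :=
  mapCoeff_mul (R := Smooth W) (Smooth.pderiv b) (Smooth.pderiv_mul b) f g

theorem baseDeriv_mem_homog (b : B) {δ : Deg n} {f : GSeries deg (Smooth W)}
    (hf : f ∈ homog deg (Smooth W) δ) : baseDeriv b f ∈ homog deg (Smooth W) δ :=
  mapCoeff_mem_homog (R := Smooth W) (S := Smooth W) (Smooth.pderiv b) hf

/-- The graded product rule for a derivative with respect to a formal variable. -/
theorem pderiv_mul (j : J) (f g : GSeries deg (Smooth W)) :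
    pderiv j (f * g) = pderiv j f * g + parity (deg j) f * pderiv j g := by
  classical
  have h := eq_zero_of_coordinates
    (pderiv j ∘ₗ LinearMap.mulRight ℝ g - LinearMap.mulRight ℝ g ∘ₗ pderiv j -
      LinearMap.mulRight ℝ (pderiv j g) ∘ₗ (parity (deg j)).toLinearMap :
        GSeries deg (Smooth W) →ₗ[ℝ] GSeries deg (Smooth W))
    (fun b => const (Smooth.coord W b)) (fun i => sgn (deg j ⬝ᵥ deg i) • var i)
    (fun x => by simp) (fun x i => by simp)
    (by simp [pderiv_one])
    (fun b f => by
      simp [mul_assoc, pderiv_const_mul, parity_of_mem_homog _ (const_mem_homog _), sgn_zero,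
        mul_sub])
    (fun i f => by
      have e : (if i = j then f else 0) * g = if i = j then f * g else 0 := by
        split_ifs <;> simp
      simp only [LinearMap.sub_apply, LinearMap.comp_apply, LinearMap.mulRight_apply,
        AlgHom.toLinearMap_apply, mul_assoc, pderiv_var_mul, map_mul,
        parity_of_mem_homog _ (var_mem_homog i), add_mul, e, smul_mul_assoc, mul_sub]
      abel)
  have := LinearMap.congr_fun h f
  simp only [LinearMap.sub_apply, LinearMap.comp_apply, LinearMap.mulRight_apply,
    LinearMap.zero_apply, sub_sub, sub_eq_zero] at this
  exact this

end GSeries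

/-! ### Functions on domains: morphisms and the chain rule -/

namespace Coords

variable {n : ℕ} {D D' D'' : Coords n} {W : Opens D.Space} {V : Opens D'.Space}

theorem coord_of_eq (W : Opens D.Space) {i : D.idx} (h : D.deg i = 0) :
    D.coord W i = const (Smooth.coord W ⟨i, h⟩) := dif_pos h

theorem coord_of_ne (W : Opens D.Space) {i : D.idx} (h : D.deg i ≠ 0) :
    D.coord W i = var ⟨i, h⟩ := dif_neg h

theorem partialD_of_eq (W : Opens D.Space) {i : D.idx} (h : D.deg i = 0) :
    D.partialD W i = baseDeriv ⟨i, h⟩ := dif_pos h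

theorem partialD_of_ne (W : Opens D.Space) {i : D.idx} (h : D.deg i ≠ 0) :
    D.partialD W i = GSeries.pderiv ⟨i, h⟩ := dif_neg h

theorem coord_mem_homog (W : Opens D.Space) (i : D.idx) :
    D.coord W i ∈ homog D.formalDeg (Smooth W) (D.deg i) := by
  by_cases h : D.deg i = 0
  · rw [coord_of_eq W h, h]; exact const_mem_homog _
  · rw [coord_of_ne W h]; exact var_mem_homog (deg := D.formalDeg) ⟨i, h⟩

/-- The family `z^I` of series can be substituted for the coordinates of the domain over `V`: the
constant terms of degree zero take values in `V`, the others vanish. -/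
structure MapsInto {m : ℕ} {J : Type} [Fintype J] [LinearOrder J] {deg : J → Deg m} {B : Type}
    [Fintype B] {W : Opens (B → ℝ)} (V : Opens D'.Space) (z : D'.idx → GSeries deg (Smooth W)) :
    Prop where
  mem : ∀ x : W, (fun b : D'.Base => value x (z b.1)) ∈ V
  value_eq_zero : ∀ (x : W) i, D'.deg i ≠ 0 → value x (z i) = 0

section Target

variable {m : ℕ} {J : Type} [Fintype J] [LinearOrder J] {deg : J → Deg m} {B : Type}
    [Fintype B] {X : Opens (B → ℝ)}

/-- The form of `eq_zero_of_coordinates` for the coordinates of a domain, of degree zero or not. It is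
applied to differences of morphisms and of derivations. -/
theorem eq_zero_of_coord (δ : D'.Fun V →ₗ[ℝ] GSeries deg (Smooth X))
    {z : D'.idx → GSeries deg (Smooth X)} (hz : MapsInto V z)
    (h1 : δ 1 = 0) (h : ∀ i f, δ (D'.coord V i * f) = z i * δ f) : δ = 0 :=
  eq_zero_of_coordinates δ (fun b => z b.1) (fun j => z j.1) hz.mem
    (fun x j => hz.value_eq_zero x j.1 j.2) h1
    (fun b f => by rw [← h, coord_of_eq V b.2])
    (fun j f => by rw [← h, coord_of_ne V j.2])

/-- A morphism of domains is determined by its values on the coordinates. -/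
theorem fun_hom_ext {Φ Ψ : D'.Fun V →ₐ[ℝ] GSeries deg (Smooth X)}
    (hz : MapsInto V fun i => Φ (D'.coord V i))
    (h : ∀ i, Φ (D'.coord V i) = Ψ (D'.coord V i)) : Φ = Ψ := by
  have := eq_zero_of_coord (Φ.toLinearMap - Ψ.toLinearMap) hz
    (by simp) (fun i f => by simp [← h, mul_sub])
  exact AlgHom.ext fun f => sub_eq_zero.1 (LinearMap.congr_fun this f)

end Target

/-- The second condition of `MapsInto` is automatic: a series of non-zero degree has no constant term. -/
theorem mapsInto_of_mem {J : Type} [Fintype J] [LinearOrder J] {deg : J → Deg n} {B : Type}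
    [Fintype B] {X : Opens (B → ℝ)} {z : D'.idx → GSeries deg (Smooth X)}
    (hd : ∀ i, z i ∈ homog deg (Smooth X) (D'.deg i))
    (hm : ∀ x : X, (fun b : D'.Base => value x (z b.1)) ∈ V) : MapsInto V z :=
  ⟨hm, fun x i hi => by rw [value, body_eq_zero_of_mem_homog (hd i) hi, map_zero]⟩

theorem mapsInto_coord {V V' : Opens D'.Space} (h : V' ≤ V) : MapsInto V (D'.coord V') := by
  refine ⟨fun x => ?_, fun x i hi => ?_⟩
  · have : (fun b : D'.Base => value x (D'.coord V' b.1)) = x.1 := by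
      funext b
      rw [coord_of_eq V' b.2, value_const, Smooth.eval_coord]
    rw [this]
    exact h x.2
  · rw [coord_of_ne V' hi, value_var]

/-- Existence of morphisms of domains with prescribed coordinate expressions. -/
theorem exists_fun_hom {z : D'.idx → D.Fun W} (hz : MapsInto V z)
    (hd : ∀ i, z i ∈ homog D.formalDeg (Smooth W) (D'.deg i)) :
    ∃ Φ : D'.Fun V →ₐ[ℝ] D.Fun W, (∀ i, Φ (D'.coord V i) = z i) ∧
      ∀ δ, ∀ f ∈ homog D'.formalDeg (Smooth V) δ, Φ f ∈ homog D.formalDeg (Smooth W) δ := by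
  obtain ⟨Φ, h1, h2, h3⟩ := exists_subst (V := V) (deg' := D'.formalDeg) (fun j => j.2)
    (fun b : D'.Base => z b.1) (fun j => z j.1) hz.mem
    (fun b => by have := hd b.1; rwa [b.2] at this) (fun j => hd j.1)
  refine ⟨Φ, fun i => ?_, h3⟩
  by_cases h : D'.deg i = 0
  · rw [coord_of_eq V h, h1]
  · rw [coord_of_ne V h, h2]

/-! #### The chain rule -/

open Classical in
theorem partialD_coord (W : Opens D.Space) (i k : D.idx) :
    D.partialD W i (D.coord W k) = if k = i then 1 else 0 := by
  by_cases hi : D.deg i = 0 <;> by_cases hk : D.deg k = 0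
  · rw [partialD_of_eq W hi, coord_of_eq W hk]
    refine coeff_ext fun α => ?_
    rw [coeff_baseDeriv, coeff_const, apply_ite (Smooth.pderiv _), Smooth.pderiv_coord, map_zero]
    simp only [Subtype.mk.injEq]
    by_cases hki : k = i
    · rw [if_pos hki, if_pos hki, coeff_one]
      congr
    · rw [if_neg hki, if_neg hki, ite_self, coeff_zero]
  · rw [if_neg (fun e : k = i => hk (e ▸ hi)), partialD_of_eq W hi, coord_of_ne W hk]
    refine coeff_ext fun α => ?_
    rw [coeff_baseDeriv, coeff_var, apply_ite (Smooth.pderiv _), map_zero, Smooth.pderiv_one,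
      ite_self, coeff_zero]
  · rw [if_neg (fun e : k = i => hi (e ▸ hk)), partialD_of_ne W hi, coord_of_eq W hk]
    rw [← mul_one (const _), pderiv_const_mul, GSeries.pderiv_one, mul_zero]
  · rw [partialD_of_ne W hi, coord_of_ne W hk, ← mul_one (var _), pderiv_var_mul,
      GSeries.pderiv_one, mul_zero, smul_zero, add_zero]
    simp only [Subtype.mk.injEq]

/-- The graded product rule. -/
theorem partialD_mul (i : D.idx) (f g : D.Fun W) :
    D.partialD W i (f * g) =
      D.partialD W i f * g + parity (D.deg i) f * D.partialD W i g := by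
  by_cases h : D.deg i = 0
  · rw [partialD_of_eq W h, h, parity_zero]
    exact baseDeriv_mul _ f g
  · rw [partialD_of_ne W h]
    exact GSeries.pderiv_mul (deg := D.formalDeg) ⟨i, h⟩ f g

theorem partialD_one (W : Opens D.Space) (i : D.idx) : D.partialD W i 1 = 0 := by
  have := partialD_mul i (1 : D.Fun W) 1
  rwa [mul_one, mul_one, map_one (parity _), one_mul, left_eq_add] at this

theorem partialD_mem_homog (i : D.idx) {δ : Deg n} {f : D.Fun W}
    (hf : f ∈ homog D.formalDeg (Smooth W) δ) :
    D.partialD W i f ∈ homog D.formalDeg (Smooth W) (D.deg i + δ) := by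
  by_cases h : D.deg i = 0
  · rw [partialD_of_eq W h, h, zero_add]; exact baseDeriv_mem_homog _ hf
  · rw [partialD_of_ne W h]; exact pderiv_mem_homog (deg := D.formalDeg) ⟨i, h⟩ hf

/-- The chain rule `∂_K(ψ f) = ∑_I ∂_K(ψ y^I) ψ(∂_I f)`. -/
theorem partialD_hom (ψ : D'.Fun V →ₐ[ℝ] D.Fun W)
    (hψ : ∀ i, ψ (D'.coord V i) ∈ homog D.formalDeg (Smooth W) (D'.deg i))
    (hz : MapsInto V fun i => ψ (D'.coord V i)) (k : D.idx) (f : D'.Fun V) :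
    D.partialD W k (ψ f) =
      ∑ i, D.partialD W k (ψ (D'.coord V i)) * ψ (D'.partialD V i f) := by
  classical
  have hp : ∀ i, parity (D.deg k) (ψ (D'.coord V i)) =
      sgn (D.deg k ⬝ᵥ D'.deg i) • ψ (D'.coord V i) := fun i => parity_of_mem_homog _ (hψ i)
  have h := eq_zero_of_coord (z := fun i => sgn (D.deg k ⬝ᵥ D'.deg i) • ψ (D'.coord V i))
    (D.partialD W k ∘ₗ ψ.toLinearMap -
      ∑ i, LinearMap.mulLeft ℝ (D.partialD W k (ψ (D'.coord V i))) ∘ₗ ψ.toLinearMap ∘ₗ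
        D'.partialD V i) ⟨fun x => ?_, fun x i hi => ?_⟩ ?_ ?_
  · have := LinearMap.congr_fun h f
    simpa [LinearMap.sum_apply, sub_eq_zero] using this
  · have e : (fun b : D'.Base => value x (sgn (D.deg k ⬝ᵥ D'.deg b.1) • ψ (D'.coord V b.1))) =
        fun b : D'.Base => value x (ψ (D'.coord V b.1)) := by
      funext b
      rw [b.2, dotProduct_zero, sgn_zero, one_smul]
    rw [e]
    exact hz.mem x
  · rw [value_zsmul, hz.value_eq_zero x i hi, smul_zero]
  · simp [LinearMap.sum_apply, partialD_one]
  · intro i g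
    simp only [LinearMap.sub_apply, LinearMap.comp_apply, AlgHom.toLinearMap_apply,
      LinearMap.sum_apply, LinearMap.mulLeft_apply, map_mul, partialD_mul, map_add, hp,
      partialD_coord, parity_of_mem_homog _ (coord_mem_homog V i), map_zsmul,
      Finset.sum_add_distrib]
    have e1 : ∑ j, D.partialD W k (ψ (D'.coord V j)) * (ψ (if i = j then 1 else 0) * ψ g) =
        D.partialD W k (ψ (D'.coord V i)) * ψ g := by
      rw [Finset.sum_eq_single i]
      · rw [if_pos rfl, map_one, one_mul]
      · intro j _ hj
        rw [if_neg hj.symm, map_zero, zero_mul, mul_zero]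
      · simp
    have e2 : ∀ j, D.partialD W k (ψ (D'.coord V j)) *
        ((sgn (D'.deg j ⬝ᵥ D'.deg i) • ψ (D'.coord V i)) * ψ (D'.partialD V j g)) =
        (sgn (D.deg k ⬝ᵥ D'.deg i) • ψ (D'.coord V i)) *
          (D.partialD W k (ψ (D'.coord V j)) * ψ (D'.partialD V j g)) := by
      intro j
      rw [← mul_assoc, ← mul_assoc, mul_smul_comm,
        mul_comm_of_mem_homog (partialD_mem_homog k (hψ j)) (hψ i), sgn_smul_sgn_smul,
        add_dotProduct, add_left_comm, CharTwo.add_self_eq_zero, add_zero, smul_mul_assoc,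
        smul_mul_assoc,
        smul_mul_assoc]
    rw [e1, Finset.sum_congr rfl fun j _ => e2 j, ← Finset.mul_sum, mul_sub]
    abel

end Coords

/-! ### Differential forms on domains -/

namespace Coords

variable {n : ℕ} {D D' : Coords n} {W : Opens D.Space} {V : Opens D'.Space}

theorem partialForm_of_eq (W : Opens D.Space) {i : D.idx} (h : D.deg i = 0) :
    D.partialForm W i = baseDeriv ⟨i, h⟩ := dif_pos h

theorem partialForm_of_ne (W : Opens D.Space) {i : D.idx} (h : D.deg i ≠ 0) :
    D.partialForm W i = GSeries.pderiv (toLex (Sum.inl ⟨i, h⟩)) := dif_neg h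

/-- The exponents of the formal coordinates in a monomial of a form. -/
def restr (α : D.FormVar →₀ ℕ) : D.Formal →₀ ℕ :=
  Finsupp.equivFunOnFinite.symm fun A => α (toLex (Sum.inl A))

theorem restr_apply (α : D.FormVar →₀ ℕ) (A : D.Formal) :
    restr α A = α (toLex (Sum.inl A)) := rfl

theorem cons_dotProduct_cons {n : ℕ} (a b : ZMod 2) (v w : Deg n) :
    (Fin.cons a v : Deg (n + 1)) ⬝ᵥ (Fin.cons b w : Deg (n + 1)) = a * b + v ⬝ᵥ w := by
  simp [dotProduct, Fin.sum_univ_succ]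

theorem formDeg_inl (A : D.Formal) :
    D.formDeg (toLex (Sum.inl A)) = Fin.cons 0 (D.deg A.1) := rfl

theorem formDeg_ne_zero (v : D.FormVar) : D.formDeg v ≠ 0 := by
  rcases v with A | i
  · intro h
    apply A.2
    have h2 : (Fin.cons 0 (D.deg A.1) : Deg (n + 1)) = 0 := h
    funext k
    simpa using congrFun h2 k.succ
  · intro h
    have h2 : (Fin.cons 1 (D.deg i) : Deg (n + 1)) = 0 := h
    simpa using congrFun h2 0

theorem adm_restr {α : D.FormVar →₀ ℕ} (h : Adm D.formDeg α) : Adm D.formalDeg (restr α) := by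
  intro A hA
  refine h (toLex (Sum.inl A)) ?_
  rw [formDeg_inl, cons_dotProduct_cons, mul_zero, zero_add]
  exact hA

theorem coeff_ofFun (f : D.Fun W) {α : D.FormVar →₀ ℕ}
    (h : Adm D.formDeg α) : (D.ofFun W f).coeff α =
      open Classical in if ∀ i, α (toLex (Sum.inr i)) = 0 then f.coeff (restr α) else 0 :=
  coeff_mk _ h

theorem sum_formVar {M : Type*} [AddCommMonoid M] (F : D.FormVar → M) :
    ∑ v, F v = ∑ A, F (toLex (Sum.inl A)) + ∑ i, F (toLex (Sum.inr i)) :=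
  Fintype.sum_sum_type (fun v => F (toLex v))

/-- The inclusion of functions into forms, as a linear map. -/
def ofFunL (W : Opens D.Space) : D.Fun W →ₗ[ℝ] D.Form W where
  toFun := D.ofFun W
  map_add' f g := GSeries.ext fun α hα => by
    rw [coeff_add, coeff_ofFun _ hα, coeff_ofFun _ hα, coeff_ofFun _ hα]
    split_ifs <;> simp
  map_smul' c f := GSeries.ext fun α hα => by
    rw [RingHom.id_apply, coeff_smul, coeff_ofFun _ hα, coeff_ofFun _ hα]
    split_ifs <;> simp

theorem ofFun_const_mul (r : Smooth W) (f : D.Fun W) :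
    D.ofFun W (const r * f) = const r * D.ofFun W f := by
  refine GSeries.ext fun α hα => ?_
  rw [const_mul_coeff, coeff_ofFun _ hα, coeff_ofFun _ hα, const_mul_coeff]
  split_ifs <;> simp

theorem ofFun_one (W : Opens D.Space) : D.ofFun W 1 = 1 := by
  classical
  refine GSeries.ext fun α hα => ?_
  rw [coeff_ofFun _ hα, coeff_one, coeff_one, ← ite_and]
  refine if_congr ⟨fun h => ?_, ?_⟩ rfl rfl
  · ext v
    rcases v with A | i
    · exact DFunLike.congr_fun h.2 A
    · exact h.1 i
  · rintro rfl
    exact ⟨fun _ => rfl, Finsupp.ext fun _ => rfl⟩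

theorem ofFun_var_mul (A : D.Formal) (f : D.Fun W) :
    D.ofFun W (var A * f) = var (toLex (Sum.inl A)) * D.ofFun W f := by
  classical
  refine GSeries.ext fun α hα => ?_
  rw [coeff_ofFun _ hα]
  by_cases h0 : α (toLex (Sum.inl A)) = 0
  · rw [var_mul_coeff_eq_zero (deg := D.formDeg) _ _ h0, var_mul_coeff_eq_zero A f h0, ite_self]
  · obtain ⟨β, rfl⟩ := exists_single_add h0
    have hβ : Adm D.formDeg β := hα.of_le le_add_self
    have er : restr (Finsupp.single (toLex (Sum.inl A)) 1 + β) = Finsupp.single A 1 + restr β := by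
      ext C
      rw [restr_apply, Finsupp.add_apply, Finsupp.add_apply, restr_apply, Finsupp.single_apply,
        Finsupp.single_apply]
      simp
    have hr := adm_restr hα
    rw [er] at hr
    rw [var_mul_coeff_single_add _ _ hα, coeff_ofFun _ hβ, er,
      var_mul_coeff_single_add A f hr]
    have ec : (∀ i, (Finsupp.single (toLex (Sum.inl A)) 1 + β : D.FormVar →₀ ℕ)
        (toLex (Sum.inr i)) = 0) ↔ ∀ i, β (toLex (Sum.inr i)) = 0 := by
      refine forall_congr' fun i => ?_
      rw [Finsupp.add_apply, Finsupp.single_apply, if_neg (by simp), zero_add]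
    rw [if_congr ec rfl rfl]
    split_ifs with h
    · congr 2
      rw [reorder_single_left, reorder_single_left, sum_formVar]
      have e2 : ∑ i, (if toLex (Sum.inr i) < (toLex (Sum.inl A) : D.FormVar) then
          (β (toLex (Sum.inr i)) : ZMod 2) * (D.formDeg (toLex (Sum.inl A)) ⬝ᵥ
            D.formDeg (toLex (Sum.inr i))) else 0) = 0 :=
        Finset.sum_eq_zero fun i _ => by rw [h i]; simp
      rw [e2, add_zero]
      refine Finset.sum_congr rfl fun C _ => ?_
      refine if_congr Sum.Lex.inl_lt_inl_iff.symm ?_ rfl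
      rw [formDeg_inl, formDeg_inl, cons_dotProduct_cons, mul_zero, zero_add]
      rfl
    · rw [smul_zero]

/-- The inclusion of functions into forms. -/
def ofFunHom (W : Opens D.Space) : D.Fun W →ₐ[ℝ] D.Form W :=
  AlgHom.ofLinearMap (ofFunL W) (ofFun_one W)
    (map_mul_of_coordinates (ofFunL W) (fun b => const (Smooth.coord W b))
      (fun A => var (toLex (Sum.inl A))) (fun x => by simp) (fun x A => by simp)
      (ofFun_one W) (fun _ f => ofFun_const_mul _ f) ofFun_var_mul)

theorem ofFun_const (r : Smooth W) : D.ofFun W (const r) = const r := by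
  have := ofFun_const_mul r (1 : D.Fun W)
  rwa [mul_one, ofFun_one, mul_one] at this

theorem ofFun_var (A : D.Formal) :
    D.ofFun W (var A) = var (toLex (Sum.inl A)) := by
  have := ofFun_var_mul A (1 : D.Fun W)
  rwa [mul_one, ofFun_one, mul_one] at this

theorem value_ofFun (x : W) (f : D.Fun W) : value x (D.ofFun W f) = value x f := by
  rw [value, value, body_apply, body_apply, coeff_ofFun _ adm_zero, if_pos (fun i => by rfl)]
  exact congrArg (fun α => Smooth.eval x (f.coeff α)) (Finsupp.ext fun _ => rfl)

theorem mapsInto_ofFun {z : D'.idx → D.Fun W} (h : MapsInto V z) :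
    MapsInto V fun i => D.ofFun W (z i) :=
  ⟨fun x => by simpa only [value_ofFun] using h.mem x,
    fun x i hi => by rw [value_ofFun, h.value_eq_zero x i hi]⟩

theorem ofFun_mem_homog {δ : Deg n} {f : D.Fun W} (hf : f ∈ homog D.formalDeg (Smooth W) δ) :
    D.ofFun W f ∈ homog D.formDeg (Smooth W) (Fin.cons 0 δ) := by
  intro α hα
  have hA : Adm D.formDeg α := by
    by_contra hc
    exact hα (coeff_eq_zero _ hc)
  rw [coeff_ofFun _ hA] at hα
  split_ifs at hα with h
  · have := hf _ hα
    rw [← this, monoDeg, sum_formVar, monoDeg, Finset.sum_eq_zero (s := Finset.univ (α := D.idx))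
      (fun i _ => by rw [h i, zero_smul]), add_zero]
    funext k
    refine Fin.cases ?_ (fun k => ?_) k
    · simp [Finset.sum_apply, formDeg_inl]
    · simp [Finset.sum_apply, formDeg_inl, restr_apply]
  · exact absurd rfl hα

theorem dx_mem_homog (W : Opens D.Space) (i : D.idx) :
    D.dx W i ∈ homog D.formDeg (Smooth W) (Fin.cons 1 (D.deg i)) :=
  var_mem_homog (deg := D.formDeg) (toLex (Sum.inr i))

/-- The graded product rule for partial derivatives of forms. -/
theorem partialForm_mul (i : D.idx) (ω η : D.Form W) :
    D.partialForm W i (ω * η) = D.partialForm W i ω * η +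
      parity (Fin.cons 0 (D.deg i)) ω * D.partialForm W i η := by
  by_cases h : D.deg i = 0
  · have h0 : (Fin.cons 0 (D.deg i) : Deg (n + 1)) = 0 := by
      rw [h]; funext k; refine Fin.cases rfl (fun _ => rfl) k
    rw [partialForm_of_eq W h, h0, parity_zero]
    exact baseDeriv_mul _ ω η
  · rw [partialForm_of_ne W h]
    exact GSeries.pderiv_mul (deg := D.formDeg) (toLex (Sum.inl ⟨i, h⟩)) ω η

theorem partialForm_dx (W : Opens D.Space) (i k : D.idx) :
    D.partialForm W i (D.dx W k) = 0 := by
  classical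
  by_cases h : D.deg i = 0
  · rw [partialForm_of_eq W h]
    refine coeff_ext fun α => ?_
    rw [coeff_baseDeriv, dx, coeff_var, apply_ite (Smooth.pderiv _), map_zero, Smooth.pderiv_one,
      ite_self, coeff_zero]
  · rw [partialForm_of_ne W h, dx, ← mul_one (var _), pderiv_var_mul, GSeries.pderiv_one,
      mul_zero, smul_zero, add_zero, if_neg (by simp)]

theorem partialForm_ofFun (i : D.idx) (f : D.Fun W) :
    D.partialForm W i (D.ofFun W f) = D.ofFun W (D.partialD W i f) := by
  classical
  by_cases h : D.deg i = 0
  · rw [partialForm_of_eq W h, partialD_of_eq W h]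
    refine GSeries.ext fun α hα => ?_
    rw [coeff_baseDeriv, coeff_ofFun _ hα, coeff_ofFun _ hα, apply_ite (Smooth.pderiv _), map_zero,
      coeff_baseDeriv]
  · rw [partialForm_of_ne W h, partialD_of_ne W h]
    have := eq_zero_of_coordinates
      (GSeries.pderiv (toLex (Sum.inl ⟨i, h⟩)) ∘ₗ ofFunL W -
        ofFunL W ∘ₗ GSeries.pderiv ⟨i, h⟩)
      (fun b => const (Smooth.coord W b))
      (fun A => sgn (D.deg i ⬝ᵥ D.deg A.1) • var (toLex (Sum.inl A)))
      (fun x => by simp) (fun x A => by simp)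
      (by
        change GSeries.pderiv _ (D.ofFun W 1) - D.ofFun W (GSeries.pderiv _ 1) = 0
        rw [ofFun_one, GSeries.pderiv_one, GSeries.pderiv_one]
        exact sub_eq_zero.2 (map_zero (ofFunL W)).symm)
      (fun b f => by
        change GSeries.pderiv _ (D.ofFun W _) - D.ofFun W (GSeries.pderiv _ _) =
          _ * (GSeries.pderiv _ (D.ofFun W f) - D.ofFun W (GSeries.pderiv _ f))
        rw [ofFun_const_mul, pderiv_const_mul, pderiv_const_mul, ofFun_const_mul, mul_sub])
      (fun A f => by
        change GSeries.pderiv _ (D.ofFun W _) - ofFunL W (GSeries.pderiv _ _) =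
          _ * (GSeries.pderiv _ (D.ofFun W f) - D.ofFun W (GSeries.pderiv _ f))
        rw [ofFun_var_mul, pderiv_var_mul, pderiv_var_mul, map_add, map_zsmul]
        change _ - (_ + _ • D.ofFun W _) = _
        rw [ofFun_var_mul, formDeg_inl, formDeg_inl, cons_dotProduct_cons, mul_zero, zero_add,
          smul_mul_assoc, mul_sub, smul_sub, apply_ite (ofFunL W), map_zero]
        simp only [EmbeddingLike.apply_eq_iff_eq, Sum.inl.injEq]
        exact add_sub_add_left_eq_sub _ _ _)
    exact sub_eq_zero.1 (LinearMap.congr_fun this f)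

end Coords

/-! ### Restriction and gluing of series with smooth coefficients -/

namespace GSeries

variable {n : ℕ} {J : Type} [Fintype J] [LinearOrder J] {deg : J → Deg n}
  {B : Type} [Fintype B] {W W' W'' : Opens (B → ℝ)}

/-- Restriction of series to a smaller domain. -/
def res (h : W' ≤ W) : GSeries deg (Smooth W) →ₐ[ℝ] GSeries deg (Smooth W') :=
  mapAlg (R := Smooth W) (S := Smooth W') (Smooth.res h)

theorem coeff_res (h : W' ≤ W) (f : GSeries deg (Smooth W)) (α : J →₀ ℕ) :
    (res h f).coeff α = Smooth.res h (f.coeff α) := rfl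

theorem res_refl (h : W ≤ W) (f : GSeries deg (Smooth W)) : res h f = f := rfl

theorem value_res (h : W' ≤ W) (f : GSeries deg (Smooth W)) (x : W') :
    value x (res h f) = value ⟨x.1, h x.2⟩ f := rfl

theorem res_mem_homog (h : W' ≤ W) {δ : Deg n} {f : GSeries deg (Smooth W)}
    (hf : f ∈ homog deg (Smooth W) δ) : res h f ∈ homog deg (Smooth W') δ :=
  mapCoeff_mem_homog (R := Smooth W) (S := Smooth W') (Smooth.res h).toLinearMap hf

theorem res_const (h : W' ≤ W) (r : Smooth W) :
    res h (const r : GSeries deg (Smooth W)) = const (Smooth.res h r) := by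
  classical
  refine coeff_ext fun α => ?_
  rw [coeff_res, coeff_const, coeff_const, apply_ite (Smooth.res h), map_zero]

theorem res_var (h : W' ≤ W) (j : J) :
    res h (var j : GSeries deg (Smooth W)) = var j := by
  classical
  refine coeff_ext fun α => ?_
  rw [coeff_res, coeff_var, coeff_var, apply_ite (Smooth.res h), map_zero, map_one]

theorem eq_of_res_eq {ι : Type*} {U : ι → Opens (B → ℝ)} (hU : ∀ i, U i ≤ W)
    (hcov : ∀ x ∈ W, ∃ i, x ∈ U i) {f g : GSeries deg (Smooth W)}
    (h : ∀ i, res (hU i) f = res (hU i) g) : f = g := by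
  refine coeff_ext fun α => Smooth.eval_ext fun x => ?_
  obtain ⟨i, hi⟩ := hcov x.1 x.2
  have := congrArg (fun k => Smooth.eval ⟨x.1, hi⟩ (k.coeff α)) (h i)
  exact this

theorem mem_homog_of_res {ι : Type*} {U : ι → Opens (B → ℝ)} (hU : ∀ i, U i ≤ W)
    (hcov : ∀ x ∈ W, ∃ i, x ∈ U i) {δ : Deg n} {f : GSeries deg (Smooth W)}
    (h : ∀ i, res (hU i) f ∈ homog deg (Smooth (U i)) δ) : f ∈ homog deg (Smooth W) δ := by
  rw [mem_homog]
  refine fun α hα => Smooth.eval_ext fun x => ?_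
  obtain ⟨i, hi⟩ := hcov x.1 x.2
  have := congrArg (Smooth.eval ⟨x.1, hi⟩) (mem_homog.1 (h i) α hα)
  exact this

theorem exists_glue {ι : Type*} (U : ι → Opens (B → ℝ)) (hU : ∀ i, U i ≤ W)
    (hcov : ∀ x ∈ W, ∃ i, x ∈ U i) (f : ∀ i, GSeries deg (Smooth (U i)))
    (hf : ∀ i j, res (inf_le_left : U i ⊓ U j ≤ U i) (f i) =
      res (inf_le_right : U i ⊓ U j ≤ U j) (f j)) :
    ∃ g : GSeries deg (Smooth W), ∀ i, res (hU i) g = f i := by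
  choose c hc using fun α => Smooth.exists_glue U hU hcov (fun i => (f i).coeff α)
    fun i j x hi hj =>
      congrArg (fun k => Smooth.eval (⟨x, hi, hj⟩ : ↥(U i ⊓ U j)) (coeff k α)) (hf i j)
  refine ⟨mk c, fun i => ext fun α hα => ?_⟩
  rw [coeff_res, coeff_mk _ hα, hc]

theorem isUnit_of_value_ne_zero {f : GSeries deg (Smooth W)} (h : ∀ x : W, value x f ≠ 0) :
    IsUnit f :=
  isUnit_of_isUnit_body (Smooth.isUnit_of_eval_ne_zero h)

/-- If the value at `x` of a series does not vanish, then it is invertible near `x`. -/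
theorem exists_isUnit_res {f : GSeries deg (Smooth W)} {x : W} (h : value x f ≠ 0) :
    ∃ (W' : Opens (B → ℝ)) (hW : W' ≤ W), x.1 ∈ W' ∧
      ∀ (W'' : Opens (B → ℝ)) (h'' : W'' ≤ W'), IsUnit (res (h''.trans hW) f) := by
  have hc : ContinuousAt (Smooth.extend (body f)) x.1 :=
    (Smooth.differentiableAt_extend (body f) x).continuousAt
  have h0 : Smooth.extend (body f) x.1 ≠ 0 := by
    rw [Smooth.extend_apply]; exact h
  obtain ⟨t, ht, hto, hxt⟩ := mem_nhds_iff.1 (Filter.inter_mem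
    (hc.eventually_ne h0) (W.isOpen.mem_nhds x.2))
  refine ⟨⟨t, hto⟩, fun y hy => (ht hy).2, hxt, fun W'' h'' => isUnit_of_value_ne_zero fun y => ?_⟩
  have := (ht (h'' y.2)).1
  have e := Smooth.extend_apply (body f) ⟨y.1, (ht (h'' y.2)).2⟩
  intro h1
  exact this (e.trans h1)

end GSeries

namespace Coords

variable {n : ℕ} {D D' : Coords n} {W W' : Opens D.Space} {V V' : Opens D'.Space}

theorem res_coord (h : W' ≤ W) (i : D.idx) :
    GSeries.res h (D.coord W i) = D.coord W' i := by
  by_cases hi : D.deg i = 0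
  · rw [coord_of_eq W hi, coord_of_eq W' hi, res_const]; rfl
  · rw [coord_of_ne W hi, coord_of_ne W' hi, res_var]

theorem res_dx (h : W' ≤ W) (i : D.idx) :
    GSeries.res h (D.dx W i) = D.dx W' i := res_var h _

theorem res_ofFun (h : W' ≤ W) (f : D.Fun W) :
    GSeries.res h (D.ofFun W f) = D.ofFun W' (GSeries.res h f) := by
  refine GSeries.ext fun α hα => ?_
  rw [coeff_res, coeff_ofFun _ hα, coeff_ofFun _ hα, apply_ite (Smooth.res h), map_zero, coeff_res]

theorem res_partialD (h : W' ≤ W) (i : D.idx) (f : D.Fun W) :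
    GSeries.res h (D.partialD W i f) = D.partialD W' i (GSeries.res h f) := by
  classical
  have e : ∀ k, D.partialD W' i (GSeries.res h (D.coord W k)) = if k = i then 1 else 0 :=
    fun k => by rw [res_coord, partialD_coord]
  rw [partialD_hom (GSeries.res h) (fun k => by rw [res_coord]; exact coord_mem_homog _ _)
    (by simp only [res_coord]; exact mapsInto_coord h), Finset.sum_eq_single i]
  · rw [e, if_pos rfl, one_mul]
  · intro k _ hk
    rw [e, if_neg hk, zero_mul]
  · simp

/-! ### The de Rham derivative -/

/-- The de Rham derivative as a linear map. -/
def extDL (W : Opens D.Space) : D.Form W →ₗ[ℝ] D.Form W :=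
  ∑ i, LinearMap.mulLeft ℝ (D.dx W i) ∘ₗ D.partialForm W i

theorem extDL_apply (ω : D.Form W) : extDL W ω = D.extD W ω := by
  simp [extDL, extD, LinearMap.sum_apply]

theorem extD_add (ω η : D.Form W) : D.extD W (ω + η) = D.extD W ω + D.extD W η := by
  simp only [← extDL_apply, map_add]

theorem extD_zsmul (z : ℤ) (ω : D.Form W) : D.extD W (z • ω) = z • D.extD W ω := by
  simp only [← extDL_apply, map_zsmul]

theorem extD_sum {ι : Type*} (s : Finset ι) (ω : ι → D.Form W) :
    D.extD W (∑ i ∈ s, ω i) = ∑ i ∈ s, D.extD W (ω i) := by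
  simp only [← extDL_apply, map_sum]

/-- The degree `(1, 0)` of the de Rham derivative. -/
def dDeg (n : ℕ) : Deg (n + 1) := Fin.cons 1 0

theorem cons_add_cons (a b : ZMod 2) (v w : Deg n) :
    (Fin.cons a v + Fin.cons b w : Deg (n + 1)) = Fin.cons (a + b) (v + w) := by
  funext k
  refine Fin.cases ?_ (fun k => ?_) k <;> simp

theorem dDeg_dotProduct (a : ZMod 2) (v : Deg n) :
    dDeg n ⬝ᵥ (Fin.cons a v : Deg (n + 1)) = a := by
  rw [dDeg, cons_dotProduct_cons, one_mul, zero_dotProduct, add_zero]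

/-- The de Rham derivative is a derivation of degree `(1, 0)`. -/
theorem extD_mul (ω η : D.Form W) :
    D.extD W (ω * η) = D.extD W ω * η + parity (dDeg n) ω * D.extD W η := by
  simp only [extD, partialForm_mul, mul_add, Finset.sum_add_distrib, Finset.sum_mul,
    Finset.mul_sum, mul_assoc]
  congr 1
  refine Finset.sum_congr rfl fun i _ => ?_
  rw [← mul_assoc, mul_eq_parity_mul (dx_mem_homog W i), parity_parity, cons_add_cons,
    deg_add_self, add_zero, mul_assoc]
  rfl

/-- Functions are even for the form degree. -/
theorem parity_dDeg_ofFun (f : D.Fun W) : parity (dDeg n) (D.ofFun W f) = D.ofFun W f := by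
  refine GSeries.ext fun α hα => ?_
  rw [coeff_parity, coeff_ofFun _ hα]
  split_ifs with h
  · have e : dDeg n ⬝ᵥ monoDeg D.formDeg α = 0 := by
      rw [monoDeg, sum_formVar, Finset.sum_eq_zero (s := Finset.univ (α := D.idx))
        (fun i _ => by rw [h i, zero_smul]), add_zero, dotProduct_sum]
      refine Finset.sum_eq_zero fun A _ => ?_
      rw [dotProduct_smul, formDeg_inl, dDeg_dotProduct, smul_zero]
    rw [e, sgn_zero, one_smul]
  · rw [smul_zero]

/-- The differential `df` of a function. -/
def differential (W : Opens D.Space) : D.Fun W →ₗ[ℝ] D.Form W := extDL W ∘ₗ ofFunL W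

theorem differential_apply (f : D.Fun W) : differential W f = D.extD W (D.ofFun W f) :=
  extDL_apply _

theorem differential_eq_sum (f : D.Fun W) :
    differential W f = ∑ i, D.dx W i * D.ofFun W (D.partialD W i f) := by
  rw [differential_apply, extD]
  exact Finset.sum_congr rfl fun i _ => by rw [partialForm_ofFun]

theorem ofFun_mul (f g : D.Fun W) : D.ofFun W (f * g) = D.ofFun W f * D.ofFun W g :=
  map_mul (ofFunHom W) f g

theorem ofFun_sum {ι : Type*} (s : Finset ι) (f : ι → D.Fun W) :
    D.ofFun W (∑ i ∈ s, f i) = ∑ i ∈ s, D.ofFun W (f i) :=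
  map_sum (ofFunHom W) f s

theorem ofFun_zsmul (z : ℤ) (f : D.Fun W) : D.ofFun W (z • f) = z • D.ofFun W f :=
  map_zsmul (ofFunHom W) z f

theorem differential_mul (f g : D.Fun W) : differential W (f * g) =
    differential W f * D.ofFun W g + D.ofFun W f * differential W g := by
  rw [differential_apply, ofFun_mul, extD_mul, parity_dDeg_ofFun, differential_apply,
    differential_apply]

theorem differential_coord (W : Opens D.Space) (i : D.idx) :
    differential W (D.coord W i) = D.dx W i := by
  classical
  rw [differential_eq_sum, Finset.sum_eq_single i]
  · rw [partialD_coord, if_pos rfl, ofFun_one, mul_one]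
  · intro k _ hk
    rw [partialD_coord, if_neg hk.symm]
    exact (congrArg _ (map_zero (ofFunHom W))).trans (mul_zero _)
  · simp

/-- Differentials of functions are odd for the form degree. -/
theorem parity_dDeg_differential (f : D.Fun W) :
    parity (dDeg n) (differential W f) = -differential W f := by
  rw [differential_eq_sum, map_sum, ← Finset.sum_neg_distrib]
  refine Finset.sum_congr rfl fun i _ => ?_
  rw [map_mul, parity_dDeg_ofFun, parity_of_mem_homog _ (dx_mem_homog W i), dDeg_dotProduct]
  simp [sgn, ZMod.val_one]

theorem extD_dx (W : Opens D.Space) (i : D.idx) : D.extD W (D.dx W i) = 0 := by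
  simp [extD, partialForm_dx]

/-- `d² = 0` on functions. Since `d²` is a derivation on functions, it is determined by its values on
the coordinates. -/
theorem extD_differential (f : D.Fun W) : D.extD W (differential W f) = 0 := by
  have h := eq_zero_of_coord (extDL W ∘ₗ differential W) (z := fun i => D.ofFun W (D.coord W i))
    (mapsInto_ofFun (mapsInto_coord le_rfl)) ?_ ?_
  · have := LinearMap.congr_fun h f
    rwa [LinearMap.comp_apply, extDL_apply] at this
  · rw [LinearMap.comp_apply, differential_eq_sum]
    simp only [partialD_one]
    rw [Finset.sum_eq_zero, map_zero]
    intro i _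
    exact (congrArg _ (map_zero (ofFunHom W))).trans (mul_zero _)
  · intro i f
    rw [LinearMap.comp_apply, LinearMap.comp_apply, extDL_apply, extDL_apply, differential_mul,
      extD_add, extD_mul, extD_mul, differential_coord, extD_dx, parity_dDeg_ofFun,
      ← differential_apply, ← differential_apply, differential_coord,
      ← differential_coord, parity_dDeg_differential]
    noncomm_ring

theorem extD_differential_mul_ofFun (f g : D.Fun W) :
    D.extD W (differential W f * D.ofFun W g) = -(differential W f * differential W g) := by
  rw [extD_mul, extD_differential, zero_mul, zero_add, parity_dDeg_differential,
    ← differential_apply, neg_mul]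

theorem extD_differential_mul_differential (f g : D.Fun W) :
    D.extD W (differential W f * differential W g) = 0 := by
  rw [extD_mul, extD_differential, extD_differential, zero_mul, mul_zero, add_zero]

theorem differential_mem_homog {δ : Deg n} {f : D.Fun W}
    (hf : f ∈ homog D.formalDeg (Smooth W) δ) :
    differential W f ∈ homog D.formDeg (Smooth W) (Fin.cons 1 δ) := by
  rw [differential_eq_sum]
  refine sum_mem fun i _ => ?_
  have := mul_mem_homog (dx_mem_homog W i) (ofFun_mem_homog (partialD_mem_homog i hf))
  rwa [cons_add_cons, add_zero, ← add_assoc, deg_add_self, zero_add] at this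

/-- The chain rule for differentials. -/
theorem differential_hom (ψ : D'.Fun V →ₐ[ℝ] D.Fun W)
    (hψ : ∀ i, ψ (D'.coord V i) ∈ homog D.formalDeg (Smooth W) (D'.deg i))
    (hz : MapsInto V fun i => ψ (D'.coord V i)) (f : D'.Fun V) :
    differential W (ψ f) =
      ∑ i, differential W (ψ (D'.coord V i)) * D.ofFun W (ψ (D'.partialD V i f)) := by
  rw [differential_eq_sum]
  have e : ∀ i, differential W (ψ (D'.coord V i)) * D.ofFun W (ψ (D'.partialD V i f)) =
      ∑ k, D.dx W k * (D.ofFun W (D.partialD W k (ψ (D'.coord V i))) *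
        D.ofFun W (ψ (D'.partialD V i f))) := fun i => by
    rw [differential_eq_sum, Finset.sum_mul]
    exact Finset.sum_congr rfl fun k _ => mul_assoc _ _ _
  rw [Finset.sum_congr rfl fun i _ => e i, Finset.sum_comm]
  refine Finset.sum_congr rfl fun k _ => ?_
  rw [partialD_hom ψ hψ hz, ofFun_sum, Finset.mul_sum]
  exact Finset.sum_congr rfl fun i _ => by rw [ofFun_mul]

theorem res_differential (h : W' ≤ W) (f : D.Fun W) :
    GSeries.res h (differential W f) = differential W' (GSeries.res h f) := by
  rw [differential_eq_sum, differential_eq_sum, map_sum]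
  refine Finset.sum_congr rfl fun i _ => ?_
  rw [map_mul, res_dx, res_ofFun, res_partialD]

theorem res_extD (h : W' ≤ W) (ω : D.Form W) :
    GSeries.res h (D.extD W ω) = D.extD W' (GSeries.res h ω) := by
  rw [extD, extD, map_sum]
  refine Finset.sum_congr rfl fun i _ => ?_
  rw [map_mul, res_dx]
  congr 1
  by_cases hi : D.deg i = 0
  · rw [partialForm_of_eq W hi, partialForm_of_eq W' hi]
    refine coeff_ext fun α => ?_
    have := congrArg body (res_partialD h i (const (ω.coeff α)))
    rw [partialD_of_eq W hi, partialD_of_eq W' hi, res_const] at this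
    rw [coeff_res, coeff_baseDeriv, coeff_baseDeriv, coeff_res]
    simpa only [body_apply, coeff_res, coeff_baseDeriv, coeff_const, if_true] using this
  · rw [partialForm_of_ne W hi, partialForm_of_ne W' hi]
    refine GSeries.ext fun α hα => ?_
    rw [coeff_res, coeff_pderiv _ _ hα, coeff_pderiv _ _ hα, coeff_res, map_zsmul, map_nsmul]

/-! ### The order of a form in the differentials -/

theorem IsPForm.add {p : ℕ} {ω η : D.Form W} (h : IsPForm p ω) (h' : IsPForm p η) :
    IsPForm p (ω + η) := by
  intro α hα
  by_cases h0 : ω.coeff α = 0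
  · exact h' α fun h1 => hα (by rw [coeff_add, h0, h1, add_zero])
  · exact h α h0

theorem isPForm_zero (p : ℕ) : IsPForm p (0 : D.Form W) := fun _ h => absurd rfl h

theorem IsPForm.sum {ι : Type*} {p : ℕ} {s : Finset ι} {ω : ι → D.Form W}
    (h : ∀ i ∈ s, IsPForm p (ω i)) : IsPForm p (∑ i ∈ s, ω i) :=
  Finset.sum_induction _ (IsPForm p) (fun _ _ => IsPForm.add) (isPForm_zero p) h

theorem IsPForm.zsmul {p : ℕ} {ω : D.Form W} (z : ℤ) (h : IsPForm p ω) : IsPForm p (z • ω) :=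
  fun α hα => h α fun h0 => hα (by rw [coeff_zsmul, h0, smul_zero])

theorem IsPForm.mul {p q : ℕ} {ω η : D.Form W} (h : IsPForm p ω) (h' : IsPForm q η) :
    IsPForm (p + q) (ω * η) := by
  classical
  intro α hα
  have hA : Adm D.formDeg α := by
    by_contra hc
    exact hα (coeff_eq_zero _ hc)
  rw [coeff_mul _ _ hA] at hα
  obtain ⟨⟨β, γ⟩, hm, hne⟩ := Finset.exists_ne_zero_of_sum_ne_zero hα
  rw [Finset.HasAntidiagonal.mem_antidiagonal] at hm
  have h1 := h β fun h0 => hne (by rw [h0, zero_mul, smul_zero])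
  have h2 := h' γ fun h0 => hne (by rw [h0, mul_zero, smul_zero])
  rw [← hm, ← h1, ← h2, ← Finset.sum_add_distrib]
  rfl

theorem isPForm_ofFun (f : D.Fun W) : IsPForm 0 (D.ofFun W f) := by
  intro α hα
  have hA : Adm D.formDeg α := by
    by_contra hc
    exact hα (coeff_eq_zero _ hc)
  rw [coeff_ofFun _ hA] at hα
  split_ifs at hα with h
  · exact Finset.sum_eq_zero fun i _ => h i
  · exact absurd rfl hα

theorem isPForm_dx (W : Opens D.Space) (i : D.idx) : IsPForm 1 (D.dx W i) := by
  classical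
  intro α hα
  rw [dx, coeff_var] at hα
  split_ifs at hα with h
  · rw [h, Finset.sum_eq_single i] <;> simp +contextual [eq_comm]
  · exact absurd rfl hα

theorem isPForm_differential (f : D.Fun W) : IsPForm 1 (differential W f) := by
  rw [differential_eq_sum]
  exact IsPForm.sum fun i _ => (isPForm_dx W i).mul (isPForm_ofFun _)

theorem isPForm_of_res {ι : Type*} {U : ι → Opens D.Space} (hU : ∀ i, U i ≤ W)
    (hcov : ∀ x ∈ W, ∃ i, x ∈ U i) {p : ℕ} {ω : D.Form W}
    (h : ∀ i, IsPForm p (GSeries.res (hU i) ω)) : IsPForm p ω := by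
  intro α hα
  by_contra hc
  refine hα (Smooth.eval_ext fun x => ?_)
  obtain ⟨i, hi⟩ := hcov x.1 x.2
  have h0 : (GSeries.res (hU i) ω).coeff α = 0 := by
    by_contra h1
    exact hc (h i α h1)
  exact congrArg (Smooth.eval ⟨x.1, hi⟩) h0

/-- A homogeneous form of degree `(a, δ)` has `ℤ₂ⁿ`-degree `δ`. -/
theorem hasDegree_of_mem_homog {a : ZMod 2} {δ : Deg n} {ω : D.Form W}
    (h : ω ∈ homog D.formDeg (Smooth W) (Fin.cons a δ)) : HasDegree δ ω :=
  fun α hα => by rw [h α hα, Fin.tail_cons]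

/-! ### Tangent lifts -/

section TangentLift

open RingedSpace.Chart

variable {V : Opens D.Space}

/-- Existence of the transformation of forms induced by a coordinate transformation. -/
theorem exists_isTangentLift (ψ : D.Fun V ≃ₐ[ℝ] D.Fun W)
    (hψ : ∀ i, ψ (D.coord V i) ∈ homog D.formalDeg (Smooth W) (D.deg i))
    (hz : MapsInto V fun i => ψ (D.coord V i)) : ∃ Ψ, IsTangentLift ψ Ψ := by
  obtain ⟨Ψ, h1, h2, h3⟩ := exists_subst (V := V) (W := W) (deg := D.formDeg) (deg' := D.formDeg)
    formDeg_ne_zero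
    (fun b => D.ofFun W (ψ (D.coord V b.1)))
    (fun v => Sum.elim (fun A => D.ofFun W (ψ (D.coord V A.1)))
      (fun i => differential W (ψ (D.coord V i))) (ofLex v))
    (mapsInto_ofFun hz).mem
    (fun b => by
      have := ofFun_mem_homog (hψ b.1)
      rw [b.2] at this
      convert this
      funext k; refine Fin.cases rfl (fun _ => rfl) k)
    (fun v => by
      rcases v with A | i
      · exact ofFun_mem_homog (hψ A.1)
      · exact differential_mem_homog (hψ i))
  have hc : ∀ i, Ψ (D.ofFun V (D.coord V i)) = D.ofFun W (ψ (D.coord V i)) := by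
    intro i
    by_cases h : D.deg i = 0
    · rw [coord_of_eq V h, ofFun_const, h1, coord_of_eq V h]
    · rw [coord_of_ne V h, ofFun_var, h2, ← coord_of_ne V h]; rfl
  refine ⟨Ψ, h3, fun f => ?_, fun i => ?_⟩
  · have e : Ψ.comp (ofFunHom V) = (ofFunHom W).comp (ψ : D.Fun V →ₐ[ℝ] D.Fun W) := by
      refine fun_hom_ext ?_ hc
      have := mapsInto_ofFun hz
      simp only [← hc] at this
      exact this
    exact DFunLike.congr_fun e f
  · rw [dx, h2, ← differential_apply]; rfl

/-- Tangent lifts are compatible with restrictions. -/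
theorem tangentLift_res_apply {V' : Opens D.Space} (hV : V' ≤ V) (hW : W' ≤ W)
    {ψ : D.Fun V ≃ₐ[ℝ] D.Fun W} {ψ' : D.Fun V' ≃ₐ[ℝ] D.Fun W'}
    (hψ : ∀ f, GSeries.res hW (ψ f) = ψ' (GSeries.res hV f))
    (hz : MapsInto V fun i => ψ (D.coord V i)) {Ψ : D.Form V →ₐ[ℝ] D.Form W}
    {Ψ' : D.Form V' →ₐ[ℝ] D.Form W'}
    (h : IsTangentLift ψ Ψ) (h' : IsTangentLift ψ' Ψ') (η : D.Form V) :
    GSeries.res hW (Ψ η) = Ψ' (GSeries.res hV η) := by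
  have e : ∀ f, GSeries.res hW (Ψ (D.ofFun V f)) = D.ofFun W' (GSeries.res hW (ψ f)) := fun f => by
    rw [h.map_ofFun, res_ofFun]
  have e' : ∀ f, Ψ' (GSeries.res hV (D.ofFun V f)) = D.ofFun W' (GSeries.res hW (ψ f)) := fun f => by
    rw [res_ofFun, h'.map_ofFun, hψ]
  have hz' : MapsInto V fun i => D.ofFun W' (GSeries.res hW (ψ (D.coord V i))) :=
    mapsInto_ofFun ⟨fun x => hz.mem ⟨x.1, hW x.2⟩, fun x => hz.value_eq_zero ⟨x.1, hW x.2⟩⟩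
  have key : (GSeries.res hW).comp Ψ = Ψ'.comp (GSeries.res hV) := by
    refine algHom_ext _ _ (fun x => ?_) (fun x v => ?_) (fun b => ?_) ?_
    · have e1 : ∀ b : D.Base, ((GSeries.res hW).comp Ψ) (const (Smooth.coord V b)) =
          D.ofFun W' (GSeries.res hW (ψ (D.coord V b.1))) := fun b => by
        rw [← e, coord_of_eq V b.2, ofFun_const]; rfl
      simp only [e1]
      exact hz'.mem x
    · have := res_mem_homog hW (h.map_mem _ _ (var_mem_homog (deg := D.formDeg) v))
      rw [AlgHom.comp_apply, value, body_eq_zero_of_mem_homog this (formDeg_ne_zero v), map_zero]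
    · have := (e (D.coord V b.1)).trans (e' _).symm
      rwa [coord_of_eq V b.2, ofFun_const] at this
    · intro v
      rcases v with A | i
      · have := (e (D.coord V A.1)).trans (e' _).symm
        rwa [coord_of_ne V A.2, ofFun_var] at this
      · change GSeries.res hW (Ψ (D.dx V i)) = Ψ' (GSeries.res hV (D.dx V i))
        rw [h.map_dx, res_dx, h'.map_dx, ← differential_apply, ← differential_apply,
          res_differential, hψ, res_coord]
  exact DFunLike.congr_fun key η

theorem tangentLift_unique {ψ : D.Fun V ≃ₐ[ℝ] D.Fun W}
    (hz : MapsInto V fun i => ψ (D.coord V i)) {Ψ Ψ' : D.Form V →ₐ[ℝ] D.Form W}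
    (h : IsTangentLift ψ Ψ) (h' : IsTangentLift ψ Ψ') : Ψ = Ψ' :=
  AlgHom.ext fun η => tangentLift_res_apply le_rfl le_rfl (fun _ => rfl) hz h h' η

/-- Tangent lifts commute with the differential, by the chain rule. -/
theorem tangentLift_map_differential {ψ : D.Fun V ≃ₐ[ℝ] D.Fun W}
    (hψ : ∀ i, ψ (D.coord V i) ∈ homog D.formalDeg (Smooth W) (D.deg i))
    (hz : MapsInto V fun i => ψ (D.coord V i)) {Ψ : D.Form V →ₐ[ℝ] D.Form W}
    (h : IsTangentLift ψ Ψ) (f : D.Fun V) :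
    Ψ (differential V f) = differential W (ψ f) := by
  rw [differential_eq_sum, map_sum]
  refine Eq.trans ?_ (differential_hom (ψ : D.Fun V →ₐ[ℝ] D.Fun W) hψ hz f).symm
  refine Finset.sum_congr rfl fun i _ => ?_
  rw [map_mul, h.map_dx, h.map_ofFun, ← differential_apply]
  rfl

end TangentLift

end Coords

/-! ### Charts and coordinate expressions of morphisms -/

namespace RingedSpace

variable {n : ℕ} {X Y : RingedSpace.{u} n}

theorem res_res {U V W : Opens X.space} (h : V ≤ U) (h' : W ≤ V) (s : X.Sec U) :
    X.res h' (X.res h s) = X.res (h'.trans h) s := by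
  have e : X.sheaf.presheaf.map (homOfLE (h'.trans h)).op =
      X.sheaf.presheaf.map (homOfLE h).op ≫ X.sheaf.presheaf.map (homOfLE h').op := by
    rw [← X.sheaf.presheaf.map_comp, ← op_comp]; rfl
  have e2 := congrArg (fun φ => φ.hom s) e
  exact e2.symm

theorem res_refl {U : Opens X.space} (s : X.Sec U) : X.res (le_refl U) s = s := by
  have e : X.sheaf.presheaf.map (homOfLE (le_refl U)).op = 𝟙 _ := X.sheaf.presheaf.map_id _
  exact congrArg (fun φ => φ.hom s) e

theorem res_mem {U V : Opens X.space} (h : U ≤ V) {δ : Deg n} {s : X.Sec V}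
    (hs : s ∈ X.grading V δ) : X.res h s ∈ X.grading U δ := X.map_mem h δ s hs

/-- The identity morphism. -/
def Hom.id (X : RingedSpace.{u} n) : Hom X X where
  base := ContinuousMap.id _
  pull V := AlgHom.id ℝ (X.Sec V)
  pull_mem _ _ _ h := h
  pull_res _ _ := rfl

namespace Chart

variable {D D' : Coords n} (c : X.Chart D)

theorem read_res {U V : Opens X.space} (hV : V ≤ c.source) (h : U ≤ V) (s : X.Sec V) :
    c.read U (h.trans hV) (X.res h s) = GSeries.res (c.img_mono h) (c.read V hV s) :=
  c.readAux_res U V hV h s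

theorem read_mem {U : Opens X.space} (hU : U ≤ c.source) {δ : Deg n} {s : X.Sec U}
    (hs : s ∈ X.grading U δ) : c.read U hU s ∈ homog D.formalDeg (Smooth (c.img U)) δ :=
  (c.readAux_mem U hU δ s).1 hs

theorem read_symm_mem {U : Opens X.space} (hU : U ≤ c.source) {δ : Deg n} {f : D.Fun (c.img U)}
    (hf : f ∈ homog D.formalDeg (Smooth (c.img U)) δ) : (c.read U hU).symm f ∈ X.grading U δ :=
  (c.readAux_mem U hU δ _).2 (by
    change c.read U hU ((c.read U hU).symm f) ∈ _
    rwa [AlgEquiv.apply_symm_apply])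

theorem read_coord {U : Opens X.space} (hU : U ≤ c.source) (i : D.idx) :
    c.read U hU (c.coord U hU i) = D.coord _ i := AlgEquiv.apply_symm_apply _ _

theorem coord_mem {U : Opens X.space} (hU : U ≤ c.source) (i : D.idx) :
    c.coord U hU i ∈ X.grading U (D.deg i) :=
  c.read_symm_mem hU (Coords.coord_mem_homog _ i)

theorem res_coord {U V : Opens X.space} (hV : V ≤ c.source) (h : U ≤ V) (i : D.idx) :
    X.res h (c.coord V hV i) = c.coord U (h.trans hV) i := by
  apply (c.read U (h.trans hV)).injective
  rw [c.read_res hV h, read_coord, read_coord, Coords.res_coord]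

/-- The coordinates of a point. -/
def point {U : Opens X.space} (hU : U ≤ c.source) {x : X.space} (hx : x ∈ U) : c.img U :=
  ⟨c.homeo x, c.homeo.map_source (hU hx), by
    rw [Set.mem_preimage, c.homeo.left_inv (hU hx)]; exact hx⟩

theorem symm_mem {U : Opens X.space} (y : c.img U) : c.homeo.symm y.1 ∈ U := y.2.2

theorem point_symm {U : Opens X.space} (hU : U ≤ c.source) (y : c.img U) :
    c.point hU (c.symm_mem y) = y := Subtype.ext (c.homeo.right_inv y.2.1)

theorem img_inf (U V : Opens X.space) : c.img U ⊓ c.img V ≤ c.img (U ⊓ V) :=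
  fun _ hy => ⟨hy.1.1, hy.1.2, hy.2.2⟩

/-- The constant terms of coordinate expressions of functions are compatible with morphisms: a
function is invertible near a point if and only if its constant term does not vanish there. -/
theorem value_pull (f : Hom X Y) (c : X.Chart D) (c' : Y.Chart D') {V : Opens Y.space}
    (hV : V ≤ c'.source) {U : Opens X.space} (hU : U ≤ c.source) (hUV : U ≤ Opens.comap f.base V)
    (s : Y.Sec V) {x : X.space} (hx : x ∈ U) :
    value (c.point hU hx) (c.read U hU (X.res hUV (f.pull V s))) =
      value (c'.point hV (hUV hx)) (c'.read V hV s) := by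
  by_contra hne
  set a := value (c.point hU hx) (c.read U hU (X.res hUV (f.pull V s))) with ha
  set u : Y.Sec V := s - algebraMap ℝ _ a with hu
  have h1 : value (c'.point hV (hUV hx)) (c'.read V hV u) ≠ 0 := by
    rw [hu, map_sub, AlgEquiv.commutes, value_sub, value_algebraMap, sub_ne_zero]
    exact Ne.symm hne
  obtain ⟨W', hW', hxW, hun⟩ := exists_isUnit_res h1
  set V' : Opens Y.space := ⟨(V : Set Y.space) ∩ (c'.homeo.source ∩ c'.homeo ⁻¹' W'),
    V.isOpen.inter (c'.homeo.isOpen_inter_preimage W'.isOpen)⟩ with hV'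
  have hV'V : V' ≤ V := fun y hy => hy.1
  have himg : c'.img V' ≤ W' := by
    intro y hy
    have := hy.2.2.2
    rwa [Set.mem_preimage, c'.homeo.right_inv hy.1] at this
  have h2 : IsUnit (Y.res hV'V u) := by
    have := hun _ himg
    have e : GSeries.res (himg.trans hW') (c'.read V hV u) =
      c'.read V' (hV'V.trans hV) (Y.res hV'V u) := (c'.read_res hV hV'V u).symm
    rw [e] at this
    exact (MulEquiv.isUnit_map (c'.read V' (hV'V.trans hV))).1 this
  have h3 : IsUnit (f.pull V' (Y.res hV'V u)) := h2.map _
  rw [f.pull_res] at h3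
  have hxV' : x ∈ Opens.comap f.base V' := ⟨hUV hx, hV (hUV hx), hxW⟩
  set U' : Opens X.space := U ⊓ Opens.comap f.base V'
  have hxU' : x ∈ U' := ⟨hx, hxV'⟩
  have h4 : IsUnit (X.res (inf_le_right : U' ≤ _) (X.res (OrderHomClass.mono
    (Opens.comap f.base) hV'V) (f.pull V u))) := h3.map _
  have hU'U : U' ≤ U := inf_le_left
  have e5 : X.res (inf_le_right : U' ≤ _) (X.res (OrderHomClass.mono
      (Opens.comap f.base) hV'V) (f.pull V u)) = X.res hU'U (X.res hUV (f.pull V u)) := by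
    rw [res_res, res_res]
  rw [e5] at h4
  have h6 := (h4.map (c.read U' (hU'U.trans hU))).map (valueHom (c.point (hU'U.trans hU) hxU'))
  rw [c.read_res hU hU'U] at h6
  have h7 := h6.ne_zero
  apply h7
  change value (c.point hU hx) (c.read U hU (X.res hUV (f.pull V u))) = 0
  rw [hu, map_sub, map_sub, map_sub, AlgHom.commutes, AlgHom.commutes, AlgEquiv.commutes,
    value_sub, value_algebraMap, ← ha, sub_self]

/-- The coordinate expression of a morphism. -/
def localHom (f : Hom X Y) (c : X.Chart D) (c' : Y.Chart D') {V : Opens Y.space}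
    (hV : V ≤ c'.source) {U : Opens X.space} (hU : U ≤ c.source)
    (hUV : U ≤ Opens.comap f.base V) : D'.Fun (c'.img V) →ₐ[ℝ] D.Fun (c.img U) :=
  (c.read U hU : X.Sec U →ₐ[ℝ] D.Fun (c.img U)).comp ((X.res hUV).comp ((f.pull V).comp
    ((c'.read V hV).symm : D'.Fun (c'.img V) →ₐ[ℝ] Y.Sec V)))

section LocalHom

variable (f : Hom X Y) (c : X.Chart D) (c' : Y.Chart D') {V : Opens Y.space}
    (hV : V ≤ c'.source) {U : Opens X.space} (hU : U ≤ c.source) (hUV : U ≤ Opens.comap f.base V)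

theorem localHom_apply (g : D'.Fun (c'.img V)) : localHom f c c' hV hU hUV g =
    c.read U hU (X.res hUV (f.pull V ((c'.read V hV).symm g))) := rfl

theorem localHom_read (s : Y.Sec V) : localHom f c c' hV hU hUV (c'.read V hV s) =
    c.read U hU (X.res hUV (f.pull V s)) := by
  rw [localHom_apply, AlgEquiv.symm_apply_apply]

theorem localHom_mem {δ : Deg n} {g : D'.Fun (c'.img V)}
    (hg : g ∈ homog D'.formalDeg (Smooth (c'.img V)) δ) :
    localHom f c c' hV hU hUV g ∈ homog D.formalDeg (Smooth (c.img U)) δ :=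
  c.read_mem hU (res_mem _ (f.pull_mem _ _ _ (c'.read_symm_mem hV hg)))

theorem value_localHom (g : D'.Fun (c'.img V)) (y : c.img U) :
    value y (localHom f c c' hV hU hUV g) =
      value (c'.point hV (hUV (c.symm_mem y))) g := by
  have h := value_pull f c c' hV hU hUV ((c'.read V hV).symm g) (c.symm_mem y)
  rwa [point_symm, AlgEquiv.apply_symm_apply] at h

theorem mapsInto_localHom :
    Coords.MapsInto (c'.img V) fun i => localHom f c c' hV hU hUV (D'.coord _ i) := by
  refine Coords.mapsInto_of_mem
    (fun i => localHom_mem f c c' hV hU hUV (Coords.coord_mem_homog _ i)) fun y => ?_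
  simp only [value_localHom]
  exact (Coords.mapsInto_coord le_rfl).mem _

end LocalHom

section Trans

variable (c c' : X.Chart D) {U V : Opens X.space} (h : U ≤ c.source) (h' : U ≤ c'.source)

theorem trans_eq_localHom (f : D.Fun (c'.img U)) :
    c.trans c' U h h' f = localHom (Hom.id X) c c' h' h le_rfl f :=
  congrArg (c.read U h) (res_refl _).symm

theorem trans_read (s : X.Sec U) : c.trans c' U h h' (c'.read U h' s) = c.read U h s := by
  change c.read U h ((c'.read U h').symm _) = _
  rw [AlgEquiv.symm_apply_apply]

theorem trans_coord_mem (i : D.idx) : c.trans c' U h h' (D.coord _ i) ∈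
    homog D.formalDeg (Smooth (c.img U)) (D.deg i) :=
  c.read_mem h (c'.read_symm_mem h' (Coords.coord_mem_homog _ i))

theorem mapsInto_trans :
    Coords.MapsInto (c'.img U) fun i => c.trans c' U h h' (D.coord _ i) := by
  simp only [trans_eq_localHom]
  exact mapsInto_localHom _ _ _ _ _ _

theorem res_trans (hVU : V ≤ U) (f : D.Fun (c'.img U)) :
    GSeries.res (c.img_mono hVU) (c.trans c' U h h' f) =
      c.trans c' V (hVU.trans h) (hVU.trans h') (GSeries.res (c'.img_mono hVU) f) := by
  obtain ⟨s, rfl⟩ := (c'.read U h').surjective f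
  rw [trans_read, ← c.read_res h hVU, ← c'.read_res h' hVU, trans_read]

end Trans

end Chart

end RingedSpace

/-! ### The canonical symplectic form -/

namespace Coords

variable {n : ℕ} {D : Coords n} {γ : Deg n}

theorem cot_deg_xIdx (i : D.idx) : (D.cot γ).deg (D.xIdx γ i) = D.deg i := rfl

theorem cot_deg_pIdx (i : D.idx) : (D.cot γ).deg (D.pIdx γ i) = D.deg i + γ := rfl

theorem sum_cot_idx {M : Type*} [AddCommMonoid M] (F : (D.cot γ).idx → M) :
    ∑ v, F v = ∑ i, F (D.xIdx γ i) + ∑ i, F (D.pIdx γ i) :=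
  Fintype.sum_sum_type (fun v => F (toLex v))

theorem dx_mul_dx (W : Opens D.Space) (i j : D.idx) :
    D.dx W i * D.dx W j = -(sgn (D.deg i ⬝ᵥ D.deg j) • (D.dx W j * D.dx W i)) := by
  rw [mul_comm_of_mem_homog (dx_mem_homog W i) (dx_mem_homog W j), cons_dotProduct_cons, mul_one,
    sgn_add, mul_smul]
  simp [sgn, ZMod.val_one]

/-- The canonical form is nondegenerate: its matrix is monomial. -/
theorem isNondegenerate_canonicalForm (W : Opens (D.cot γ).Space) :
    IsNondegenerate (D.canonicalForm γ W) := by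
  classical
  set s : D.idx → ℤ := fun i => sgn (D.deg i ⬝ᵥ γ) with hs
  set t : D.idx → ℤ := fun i => -(sgn (D.deg i ⬝ᵥ (D.deg i + γ)) * s i) with ht
  have hss : ∀ i, s i * s i = 1 := fun i => sgn_mul_self _
  have htt : ∀ i, t i * t i = 1 := fun i => by
    have h1 := sgn_mul_self (D.deg i ⬝ᵥ (D.deg i + γ))
    have h2 := hss i
    simp only [ht]
    linear_combination (s i * s i) * h1 + h2
  -- The matrix with block anti-diagonal form, and its inverse.
  set c : Matrix (D.cot γ).idx (D.cot γ).idx ((D.cot γ).Fun W) := fun v w =>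
    Sum.elim (fun i => Sum.elim (fun _ => 0) (fun j => if i = j then ((t i : ℤ) : (D.cot γ).Fun W) else 0))
      (fun i => Sum.elim (fun j => if i = j then ((s i : ℤ) : (D.cot γ).Fun W) else 0) (fun _ => 0))
      (ofLex v) (ofLex w) with hc
  set b : Matrix (D.cot γ).idx (D.cot γ).idx ((D.cot γ).Fun W) := fun v w =>
    Sum.elim (fun i => Sum.elim (fun _ => 0) (fun j => if i = j then ((s i : ℤ) : (D.cot γ).Fun W) else 0))
      (fun i => Sum.elim (fun j => if i = j then ((t i : ℤ) : (D.cot γ).Fun W) else 0) (fun _ => 0))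
      (ofLex v) (ofLex w) with hb
  have cxx : ∀ i j, c (D.xIdx γ i) (D.xIdx γ j) = 0 := fun _ _ => rfl
  have cpp : ∀ i j, c (D.pIdx γ i) (D.pIdx γ j) = 0 := fun _ _ => rfl
  have cxp : ∀ i j, c (D.xIdx γ i) (D.pIdx γ j) = if i = j then ((t i : ℤ) : (D.cot γ).Fun W) else 0 :=
    fun _ _ => rfl
  have cpx : ∀ i j, c (D.pIdx γ i) (D.xIdx γ j) = if i = j then ((s i : ℤ) : (D.cot γ).Fun W) else 0 :=
    fun _ _ => rfl
  have bxx : ∀ i j, b (D.xIdx γ i) (D.xIdx γ j) = 0 := fun _ _ => rfl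
  have bpp : ∀ i j, b (D.pIdx γ i) (D.pIdx γ j) = 0 := fun _ _ => rfl
  have bxp : ∀ i j, b (D.xIdx γ i) (D.pIdx γ j) = if i = j then ((s i : ℤ) : (D.cot γ).Fun W) else 0 :=
    fun _ _ => rfl
  have bpx : ∀ i j, b (D.pIdx γ i) (D.xIdx γ j) = if i = j then ((t i : ℤ) : (D.cot γ).Fun W) else 0 :=
    fun _ _ => rfl
  have hx : ∀ i j, D.xIdx γ i = D.xIdx γ j ↔ i = j := fun i j =>
    ⟨fun h => Sum.inl_injective h, fun h => h ▸ rfl⟩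
  have hp : ∀ i j, D.pIdx γ i = D.pIdx γ j ↔ i = j := fun i j =>
    ⟨fun h => Sum.inr_injective h, fun h => h ▸ rfl⟩
  have hxp : ∀ i j, D.xIdx γ i ≠ D.pIdx γ j := fun i j h =>
    Sum.inl_ne_inr (a := i) (b := j) h
  have hpx : ∀ i j, D.pIdx γ i ≠ D.xIdx γ j := fun i j h =>
    Sum.inr_ne_inl (b := i) (a := j) h
  have ind : ∀ {P : (D.cot γ).idx → Prop}, (∀ i, P (D.xIdx γ i)) → (∀ i, P (D.pIdx γ i)) →
      ∀ v, P v := fun h1 h2 v => by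
    rcases v with i | i
    · exact h1 i
    · exact h2 i
  refine ⟨c, ?_, ?_, b, ?_, ?_⟩
  · refine ind (fun i => ind (fun j => ?_) fun j => ?_) fun i => ind (fun j => ?_) fun j => ?_
    · rw [cxx, cxx, smul_zero, neg_zero]
    · rw [cxp, cpx, cot_deg_xIdx, cot_deg_pIdx]
      by_cases h : i = j
      · subst h
        rw [if_pos rfl, if_pos rfl]
        simp only [ht, zsmul_eq_mul, dotProduct_comm (D.deg i + γ)]
        push_cast
        rw [mul_neg, neg_neg, ← mul_assoc, ← Int.cast_mul, sgn_mul_self, Int.cast_one, one_mul]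
      · rw [if_neg h, if_neg (Ne.symm h), smul_zero, neg_zero]
    · rw [cxp, cpx, cot_deg_xIdx, cot_deg_pIdx]
      by_cases h : i = j
      · subst h
        rw [if_pos rfl, if_pos rfl]
        simp only [ht, zsmul_eq_mul]
        push_cast
        rfl
      · rw [if_neg h, if_neg (Ne.symm h), smul_zero, neg_zero]
    · rw [cpp, cpp, smul_zero, neg_zero]
  · have hz : ∀ z : ℤ, (D.cot γ).ofFun W ((z : ℤ) : (D.cot γ).Fun W) = ((z : ℤ) : _) := fun z =>
      map_intCast (ofFunHom W) z
    have h0 : (D.cot γ).ofFun W 0 = 0 := map_zero (ofFunHom W)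
    simp only [sum_cot_idx, cxx, cpp, cxp, cpx, h0, mul_zero, Finset.sum_const_zero, zero_add,
      add_zero, apply_ite ((D.cot γ).ofFun W), hz, mul_ite, Finset.sum_ite_eq',
      Finset.mem_univ, if_true]
    have e : ∀ i, (D.cot γ).dx W (D.pIdx γ i) * (D.cot γ).dx W (D.xIdx γ i) *
        ((t i : ℤ) : (D.cot γ).Form W) =
        s i • ((D.cot γ).dx W (D.xIdx γ i) * (D.cot γ).dx W (D.pIdx γ i)) := fun i => by
      rw [dx_mul_dx W (D.pIdx γ i), cot_deg_xIdx, cot_deg_pIdx, dotProduct_comm,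
        ← (Int.cast_commute (t i) _).eq, ← zsmul_eq_mul, smul_neg, smul_smul, ← neg_smul]
      congr 1
      simp only [ht]
      have := sgn_mul_self (D.deg i ⬝ᵥ (D.deg i + γ))
      linear_combination (s i) * this
    have e' : ∀ i, (D.cot γ).dx W (D.xIdx γ i) * (D.cot γ).dx W (D.pIdx γ i) *
        ((s i : ℤ) : (D.cot γ).Form W) =
        s i • ((D.cot γ).dx W (D.xIdx γ i) * (D.cot γ).dx W (D.pIdx γ i)) := fun i => by
      rw [← (Int.cast_commute (s i) _).eq, ← zsmul_eq_mul]
    simp only [e, e', ← two_smul ℝ, smul_smul]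
    norm_num [canonicalForm, hs]
  · ext1 v w
    rw [Matrix.mul_apply, sum_cot_idx, Matrix.one_apply]
    revert v w
    refine ind (fun i => ind (fun j => ?_) fun j => ?_) fun i => ind (fun j => ?_) fun j => ?_
    · simp [bxx, bxp, cpx, hx, ← Int.cast_mul]
      split_ifs with h
      · rw [h, hss, Int.cast_one]
      · rfl
    · simp [bxx, cpp, hxp]
    · simp [bpp, cxx, hpx]
    · simp [bpp, bpx, cxp, hp, ← Int.cast_mul]
      split_ifs with h
      · rw [h, htt, Int.cast_one]
      · rfl
  · ext1 v w
    rw [Matrix.mul_apply, sum_cot_idx, Matrix.one_apply]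
    revert v w
    refine ind (fun i => ind (fun j => ?_) fun j => ?_) fun i => ind (fun j => ?_) fun j => ?_
    · simp [cxx, cxp, bpx, hx, ← Int.cast_mul]
      split_ifs with h
      · rw [h, htt, Int.cast_one]
      · rfl
    · simp [cxx, bpp, hxp]
    · simp [cpp, bxx, hpx]
    · simp [cpp, cpx, bxp, hp, ← Int.cast_mul]
      split_ifs with h
      · rw [h, hss, Int.cast_one]
      · rfl

end Coords

namespace ShiftedCotangentBundle

open RingedSpace RingedSpace.Chart Coords

variable {n : ℕ} {D : Coords n} {M : Manifold.{u} D} {γ : Deg n}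
  (E : ShiftedCotangentBundle.{u} M γ)

section Local

variable (c : E.total.Chart) {U : Opens E.total.space} (hc : U ≤ c.source) (a : M.Chart)
  (ha : U ≤ (E.adapted a).source)

/-- The tautological one-form `∑ (-1)^⟨deg I, γ⟩ dx^I p_I` of a chart of the base, expressed in
a chart of the bundle. -/
def tautForm : (D.cot γ).Form (c.img U) :=
  ∑ i, sgn (D.deg i ⬝ᵥ γ) •
    (differential _ (c.read U hc ((E.adapted a).coord U ha (D.xIdx γ i))) *
      (D.cot γ).ofFun _ (c.read U hc ((E.adapted a).coord U ha (D.pIdx γ i))))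

/-- The form `∑ (-1)^⟨deg I, γ⟩ dx^I dp_I` of a chart of the base, expressed in a chart of the
bundle. -/
def canForm : (D.cot γ).Form (c.img U) :=
  ∑ i, sgn (D.deg i ⬝ᵥ γ) •
    (differential _ (c.read U hc ((E.adapted a).coord U ha (D.xIdx γ i))) *
      differential _ (c.read U hc ((E.adapted a).coord U ha (D.pIdx γ i))))

/-- The canonical form is exact, with the tautological form as potential. -/
theorem canForm_eq_neg_extD : E.canForm c hc a ha = -(D.cot γ).extD _ (E.tautForm c hc a ha) := by
  rw [tautForm, extD_sum, canForm, ← Finset.sum_neg_distrib]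
  refine Finset.sum_congr rfl fun i _ => ?_
  rw [extD_zsmul, extD_differential_mul_ofFun, smul_neg, neg_neg]

/-- The tautological one-form does not depend on the chart of the base. -/
theorem tautForm_eq (a' : M.Chart) (ha' : U ≤ (E.adapted a').source) :
    E.tautForm c hc a ha = E.tautForm c hc a' ha' := by
  set V : Opens M.space := a.source ⊓ a'.source with hV
  have hVa : V ≤ a.source := inf_le_left
  have hVa' : V ≤ a'.source := inf_le_right
  have hUV : U ≤ Opens.comap E.proj.base V := fun x hx =>
    ⟨(E.source_eq a).le (ha hx), (E.source_eq a').le (ha' hx)⟩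
  set φ := localHom E.proj c a' hVa' hc hUV with hφ
  have hx : ∀ (b : M.Chart) (hb : U ≤ (E.adapted b).source) (hVb : V ≤ b.source) i,
      (E.adapted b).coord U hb (D.xIdx γ i) =
        E.total.res hUV (E.proj.pull V (b.coord V hVb i)) := by
    intro b hb hVb i
    rw [← E.coord_x b V hVb i, Chart.res_coord]
  have h1 : ∀ i, differential _ (c.read U hc ((E.adapted a).coord U ha (D.xIdx γ i))) =
      ∑ j, differential _ (c.read U hc ((E.adapted a').coord U ha' (D.xIdx γ j))) *
        (D.cot γ).ofFun _ (φ (D.partialD _ j (a'.read V hVa' (a.coord V hVa i)))) := by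
    intro i
    rw [hx a ha hVa, ← localHom_read E.proj c a' hVa', differential_hom _
      (fun i => localHom_mem _ _ _ _ _ _ (coord_mem_homog _ i)) (mapsInto_localHom _ _ _ _ _ _)]
    refine Finset.sum_congr rfl fun j _ => ?_
    rw [hx a' ha' hVa']
    rfl
  have h2 : ∀ j, c.read U hc ((E.adapted a').coord U ha' (D.pIdx γ j)) =
      ∑ i, sgn ((D.deg i + D.deg j) ⬝ᵥ γ) •
        (φ (D.partialD _ j (a'.read V hVa' (a.coord V hVa i))) *
          c.read U hc ((E.adapted a).coord U ha (D.pIdx γ i))) := by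
    intro j
    have := congrArg (fun s => c.read U hc (E.total.res hUV s)) (E.coord_p a a' V hVa hVa' j)
    simp only [Chart.res_coord, map_sum, map_zsmul, map_mul] at this
    exact this
  simp only [tautForm, h1, h2, ofFun_sum, ofFun_zsmul, ofFun_mul, Finset.sum_mul, Finset.mul_sum,
    Finset.smul_sum, mul_smul_comm]
  rw [Finset.sum_comm]
  refine Finset.sum_congr rfl fun j _ => Finset.sum_congr rfl fun i _ => ?_
  rw [sgn_smul_sgn_smul, add_dotProduct, add_left_comm, CharTwo.add_self_eq_zero, add_zero,
    mul_assoc]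

/-- The form `∑ (-1)^⟨deg I, γ⟩ dx^I dp_I` does not depend on the chart of the base. -/
theorem canForm_eq (a' : M.Chart) (ha' : U ≤ (E.adapted a').source) :
    E.canForm c hc a ha = E.canForm c hc a' ha' := by
  rw [canForm_eq_neg_extD, canForm_eq_neg_extD, E.tautForm_eq c hc a ha a' ha']

theorem res_canForm {U' : Opens E.total.space} (h : U' ≤ U) :
    GSeries.res (c.img_mono h) (E.canForm c hc a ha) =
      E.canForm c (h.trans hc) a (h.trans ha) := by
  rw [canForm, canForm, map_sum]
  refine Finset.sum_congr rfl fun i _ => ?_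
  rw [map_zsmul, map_mul, res_differential, res_differential, ← c.read_res hc h,
    ← c.read_res hc h, Chart.res_coord, Chart.res_coord]

theorem isPForm_canForm : IsPForm 2 (E.canForm c hc a ha) :=
  IsPForm.sum fun _ _ => ((isPForm_differential _).mul (isPForm_differential _)).zsmul _

theorem canForm_mem_homog :
    E.canForm c hc a ha ∈ homog (D.cot γ).formDeg (Smooth (c.img U)) (Fin.cons 0 γ) := by
  refine sum_mem fun i _ => zsmul_mem ?_ _
  have h1 := differential_mem_homog (c.read_mem hc ((E.adapted a).coord_mem ha (D.xIdx γ i)))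
  have h2 := differential_mem_homog (c.read_mem hc ((E.adapted a).coord_mem ha (D.pIdx γ i)))
  have := mul_mem_homog h1 h2
  rwa [cons_add_cons, cot_deg_xIdx, cot_deg_pIdx, ← add_assoc, deg_add_self, zero_add,
    CharTwo.add_self_eq_zero] at this

theorem extD_canForm : (D.cot γ).extD _ (E.canForm c hc a ha) = 0 := by
  rw [canForm, extD_sum]
  refine Finset.sum_eq_zero fun i _ => ?_
  rw [extD_zsmul, extD_differential_mul_differential, smul_zero]

theorem canForm_adapted : E.canForm (E.adapted a) ha a ha = D.canonicalForm γ _ := by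
  rw [canForm, canonicalForm]
  refine Finset.sum_congr rfl fun i _ => ?_
  rw [Chart.read_coord, Chart.read_coord, differential_coord, differential_coord]

/-- The tangent lift of a change of charts of the bundle preserves the canonical form. The chart of
the base stays the same, so only the chain rule is used. -/
theorem map_canForm (c' : E.total.Chart) (hc' : U ≤ c'.source)
    {Ψ : (D.cot γ).Form (c'.img U) →ₐ[ℝ] (D.cot γ).Form (c.img U)}
    (hΨ : IsTangentLift (c.trans c' U hc hc') Ψ) :
    Ψ (E.canForm c' hc' a ha) = E.canForm c hc a ha := by
  rw [canForm, canForm, map_sum]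
  refine Finset.sum_congr rfl fun i _ => ?_
  have h := fun f => tangentLift_map_differential (trans_coord_mem c c' hc hc')
    (mapsInto_trans c c' hc hc') hΨ f
  rw [map_zsmul, map_mul, h, h, trans_read, trans_read]

end Local

theorem exists_mem_adapted (x : E.total.space) : ∃ a : M.Chart, x ∈ (E.adapted a).source := by
  obtain ⟨a, ha⟩ := M.exists_chart (E.proj.base x)
  exact ⟨a, (E.source_eq a).ge ha⟩

/-- On a chart of the bundle the canonical forms of the charts of the base glue, as they agree on
overlaps by `canForm_eq`. -/
theorem exists_loc (c : E.total.Chart) : ∃ ω : (D.cot γ).Form (c.img c.source),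
    ∀ (U : Opens E.total.space) (hc : U ≤ c.source) (a : M.Chart)
      (ha : U ≤ (E.adapted a).source),
      GSeries.res (c.img_mono hc) ω = E.canForm c hc a ha := by
  obtain ⟨ω, hω⟩ := GSeries.exists_glue (W := c.img c.source)
    (fun a : M.Chart => c.img (c.source ⊓ (E.adapted a).source))
    (fun a => c.img_mono inf_le_left)
    (fun y hy => by
      obtain ⟨a, ha⟩ := E.exists_mem_adapted (c.homeo.symm y)
      exact ⟨a, hy.1, hy.2, ha⟩)
    (fun a => E.canForm c inf_le_left a inf_le_right)
    (fun a a' => by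
      set U := (c.source ⊓ (E.adapted a).source) ⊓ (c.source ⊓ (E.adapted a').source)
      have h1 : U ≤ c.source ⊓ (E.adapted a).source := inf_le_left
      have h2 : U ≤ c.source ⊓ (E.adapted a').source := inf_le_right
      have e := E.canForm_eq c (h1.trans inf_le_left) a (h1.trans inf_le_right) a'
        (h2.trans inf_le_right)
      rw [← E.res_canForm c inf_le_left a inf_le_right h1,
        ← E.res_canForm c inf_le_left a' inf_le_right h2] at e
      exact congrArg (GSeries.res (c.img_inf _ _)) e)
  refine ⟨ω, fun U hc a ha => ?_⟩
  have h := congrArg (GSeries.res (c.img_mono (le_inf hc ha))) (hω a)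
  rw [E.res_canForm c inf_le_left a inf_le_right (le_inf hc ha)] at h
  exact h

/-- The canonical symplectic form of degree `γ`. -/
def canonical : E.total.DiffForm 2 where
  loc c := (E.exists_loc c).choose
  isPForm c := by
    refine isPForm_of_res (U := fun a : M.Chart => c.img (c.source ⊓ (E.adapted a).source))
      (fun a => c.img_mono inf_le_left) (fun y hy => ?_) (fun a => ?_)
    · obtain ⟨a, ha⟩ := E.exists_mem_adapted (c.homeo.symm y)
      exact ⟨a, hy.1, hy.2, ha⟩
    · rw [(E.exists_loc c).choose_spec _ inf_le_left a inf_le_right]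
      exact E.isPForm_canForm _ _ _ _
  compat c c' := by
    set U := c.source ⊓ c'.source with hU
    have h : U ≤ c.source := inf_le_left
    have h' : U ≤ c'.source := inf_le_right
    obtain ⟨Ψ, hΨ⟩ := exists_isTangentLift (c.trans c' U h h') (trans_coord_mem c c' h h')
      (mapsInto_trans c c' h h')
    refine ⟨Ψ, hΨ, ?_⟩
    refine eq_of_res_eq (U := fun a : M.Chart => c.img (U ⊓ (E.adapted a).source))
      (fun a => c.img_mono inf_le_left) (fun y hy => ?_) (fun a => ?_)
    · obtain ⟨a, ha⟩ := E.exists_mem_adapted (c.homeo.symm y)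
      exact ⟨a, hy.1, hy.2, ha⟩
    · have hUa : U ⊓ (E.adapted a).source ≤ U := inf_le_left
      have ha : U ⊓ (E.adapted a).source ≤ (E.adapted a).source := inf_le_right
      obtain ⟨Ψ', hΨ'⟩ := exists_isTangentLift (c.trans c' _ (hUa.trans h) (hUa.trans h'))
        (trans_coord_mem c c' _ _) (mapsInto_trans c c' _ _)
      rw [tangentLift_res_apply (c'.img_mono hUa) (c.img_mono hUa)
        (res_trans c c' h h' hUa) (mapsInto_trans c c' h h') hΨ hΨ']
      have e := (E.exists_loc c).choose_spec _ (hUa.trans h) a ha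
      have e' := (E.exists_loc c').choose_spec _ (hUa.trans h') a ha
      refine Eq.trans ?_ ((E.map_canForm c (hUa.trans h) a ha c' (hUa.trans h') hΨ').trans e.symm)
      exact congrArg Ψ' e'

theorem res_canonical (c : E.total.Chart) {U : Opens E.total.space} (hc : U ≤ c.source)
    (a : M.Chart) (ha : U ≤ (E.adapted a).source) :
    GSeries.res (c.img_mono hc) (E.canonical.loc c) = E.canForm c hc a ha :=
  (E.exists_loc c).choose_spec U hc a ha

theorem canonical_adapted (a : M.Chart) :
    E.canonical.loc (E.adapted a) = D.canonicalForm γ _ := by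
  have := E.res_canonical (E.adapted a) le_rfl a le_rfl
  rwa [canForm_adapted] at this

theorem isSymplectic_canonical : Manifold.IsSymplectic γ E.canonical where
  hasDegree c := by
    refine hasDegree_of_mem_homog (a := 0) ?_
    refine mem_homog_of_res (U := fun a : M.Chart => c.img (c.source ⊓ (E.adapted a).source))
      (fun a => c.img_mono inf_le_left) (fun y hy => ?_) (fun a => ?_)
    · obtain ⟨a, ha⟩ := E.exists_mem_adapted (c.homeo.symm y)
      exact ⟨a, hy.1, hy.2, ha⟩
    · rw [E.res_canonical c inf_le_left a inf_le_right]
      exact E.canForm_mem_homog _ _ _ _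
  closed c := by
    refine eq_of_res_eq (U := fun a : M.Chart => c.img (c.source ⊓ (E.adapted a).source))
      (fun a => c.img_mono inf_le_left) (fun y hy => ?_) (fun a => ?_)
    · obtain ⟨a, ha⟩ := E.exists_mem_adapted (c.homeo.symm y)
      exact ⟨a, hy.1, hy.2, ha⟩
    · rw [res_extD, E.res_canonical c inf_le_left a inf_le_right, extD_canForm, map_zero]
  nondegenerate x := by
    obtain ⟨a, ha⟩ := E.exists_mem_adapted x
    refine ⟨E.adapted a, ha, ?_⟩
    rw [canonical_adapted]
    exact isNondegenerate_canonicalForm _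

end ShiftedCotangentBundle

theorem Manifold.DiffForm.eq_of_loc {n : ℕ} {D : Coords n} {M : Manifold.{u} D} {p : ℕ}
    {ω ω' : M.DiffForm p} (h : ∀ c, ω.loc c = ω'.loc c) : ω = ω' := by
  cases ω
  cases ω'
  congr
  exact funext h

/-- A differential form is determined by its expressions in charts that cover the manifold. -/
theorem Manifold.DiffForm.eq_of_cover {n : ℕ} {D : Coords n} {M : Manifold.{u} D} {p : ℕ}
    {ω ω' : M.DiffForm p} {ι : Type*} (a : ι → M.Chart) (ha : ∀ x, ∃ i, x ∈ (a i).source)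
    (h : ∀ i, ω.loc (a i) = ω'.loc (a i)) : ω = ω' := by
  refine eq_of_loc fun c => ?_
  refine eq_of_res_eq (U := fun i => c.img (c.source ⊓ (a i).source))
    (fun i => c.img_mono inf_le_left) (fun y hy => ?_) (fun i => ?_)
  · obtain ⟨i, hi⟩ := ha (c.homeo.symm y)
    exact ⟨i, hy.1, hy.2, hi⟩
  · obtain ⟨Ψ, hΨ, e⟩ := ω.compat c (a i)
    obtain ⟨Ψ', hΨ', e'⟩ := ω'.compat c (a i)
    rw [Coords.tangentLift_unique (RingedSpace.Chart.mapsInto_trans _ _ _ _) hΨ hΨ', h i] at e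
    exact e.symm.trans e'

/-! ### Homogeneous components -/

namespace GSeries

variable {n : ℕ} {J : Type} [Fintype J] [LinearOrder J] {deg : J → Deg n}
  {R : Type*} [CommRing R] [Algebra ℝ R]

open Classical in
/-- The homogeneous component of degree `δ` of a series. -/
def comp (δ : Deg n) : GSeries deg R →ₗ[ℝ] GSeries deg R where
  toFun f := ⟨fun α => if monoDeg deg α = δ then f.coeff α else 0, fun α h => by
    change (if _ then f.coeff α else 0) = 0
    rw [coeff_eq_zero f h, ite_self]⟩
  map_add' f g := Subtype.ext (funext fun α => by
    change (if _ then f.coeff α + g.coeff α else 0) =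
      (if _ then f.coeff α else 0) + (if _ then g.coeff α else 0)
    split_ifs
    · rfl
    · rw [add_zero])
  map_smul' c f := Subtype.ext (funext fun α => by
    change (if _ then c • f.coeff α else 0) = c • (if _ then f.coeff α else 0)
    split_ifs
    · rfl
    · rw [smul_zero])

open Classical in
theorem coeff_comp (δ : Deg n) (f : GSeries deg R) (α : J →₀ ℕ) :
    (comp δ f).coeff α = if monoDeg deg α = δ then f.coeff α else 0 := rfl

theorem comp_mem_homog (δ : Deg n) (f : GSeries deg R) : comp δ f ∈ homog deg R δ := by
  intro α h
  by_contra h'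
  exact h (by rw [coeff_comp, if_neg h'])

theorem comp_of_mem {δ : Deg n} {f : GSeries deg R} (h : f ∈ homog deg R δ) : comp δ f = f := by
  refine ext fun α _ => ?_
  rw [coeff_comp]
  split_ifs with h'
  · rfl
  · by_contra h0
    exact h' (h α (Ne.symm h0))

theorem comp_of_mem_ne {δ ε : Deg n} {f : GSeries deg R} (h : f ∈ homog deg R δ) (hne : δ ≠ ε) :
    comp ε f = 0 := by
  refine ext fun α _ => ?_
  rw [coeff_comp]
  split_ifs with h'
  · by_contra h0
    exact hne ((h α h0).symm.trans h')
  · rfl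

theorem sum_comp (f : GSeries deg R) : ∑ δ, comp δ f = f := by
  refine ext fun α _ => ?_
  rw [coeff_sum]
  simp only [coeff_comp]
  rw [Finset.sum_ite_eq, if_pos (Finset.mem_univ _)]

/-- A linear map that preserves degrees commutes with taking homogeneous components. -/
theorem map_comp_of_mem {J' : Type} [Fintype J'] [LinearOrder J'] {deg' : J' → Deg n}
    {S : Type*} [CommRing S] [Algebra ℝ S] (φ : GSeries deg R →ₗ[ℝ] GSeries deg' S)
    (hφ : ∀ δ, ∀ f ∈ homog deg R δ, φ f ∈ homog deg' S δ) (δ : Deg n) (f : GSeries deg R) :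
    φ (comp δ f) = comp δ (φ f) := by
  conv_rhs => rw [← sum_comp f]
  rw [map_sum, map_sum, Finset.sum_eq_single δ]
  · exact (comp_of_mem (hφ _ _ (comp_mem_homog δ f))).symm
  · exact fun ε _ hne => comp_of_mem_ne (hφ _ _ (comp_mem_homog ε f)) hne
  · simp

end GSeries

/-- A family of submodules with complementary projections is an internal direct sum decomposition. -/
theorem isInternal_of_proj {ι M : Type*} [Fintype ι] [DecidableEq ι] [AddCommGroup M] [Module ℝ M]
    (ℳ : ι → Submodule ℝ M) (p : ι → M →ₗ[ℝ] M) (hp : ∀ i x, p i x ∈ ℳ i)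
    (h : ∀ i, ∀ x ∈ ℳ i, p i x = x) (h' : ∀ i j, ∀ x ∈ ℳ i, i ≠ j → p j x = 0)
    (hs : ∀ x, ∑ i, p i x = x) : DirectSum.IsInternal ℳ := by
  refine @DirectSum.Decomposition.isInternal _ _ _ _ _ _ _ _
    (DirectSum.Decomposition.ofLinearMap ℳ
      (∑ i, DirectSum.lof ℝ ι (fun i => ℳ i) i ∘ₗ (p i).codRestrict (ℳ i) (hp i)) ?_ ?_)
  · refine LinearMap.ext fun x => ?_
    simp only [LinearMap.comp_apply, LinearMap.sum_apply, map_sum, DirectSum.coeLinearMap_lof]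
    exact hs x
  · refine DirectSum.linearMap_ext ℝ fun i => LinearMap.ext fun x => ?_
    simp only [LinearMap.comp_apply, LinearMap.sum_apply, DirectSum.coeLinearMap_lof,
      LinearMap.id_apply]
    rw [Finset.sum_eq_single i]
    · congr 1
      exact Subtype.ext (h i x.1 x.2)
    · intro j _ hne
      have : (p j).codRestrict (ℳ j) (hp j) x.1 = 0 := Subtype.ext (h' i j x.1 x.2 hne.symm)
      rw [this, map_zero]
    · simp

/-! ### Gluing of domains -/

/-- The image in `ℝᵖ` of an open set under a local homeomorphism. -/
def imgOf {X : Type*} [TopologicalSpace X] {B : Type} (e : OpenPartialHomeomorph X (B → ℝ))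
    (U : Opens X) : Opens (B → ℝ) :=
  ⟨e.target ∩ e.symm ⁻¹' U, e.symm.isOpen_inter_preimage U.isOpen⟩

theorem imgOf_mono {X : Type*} [TopologicalSpace X] {B : Type}
    (e : OpenPartialHomeomorph X (B → ℝ)) {U V : Opens X} (h : U ≤ V) :
    imgOf e U ≤ imgOf e V := fun _ hy => ⟨hy.1, h hy.2⟩

/-- Gluing data for a `ℤ₂ⁿ`-manifold: an atlas of a topological space and, for any two charts,
transformations of the functions on domains that satisfy the cocycle condition. -/
structure GluingData {n : ℕ} (D : Coords n) where
  space : TopCat.{u}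
  [t2 : T2Space space]
  [secondCountable : SecondCountableTopology space]
  ι : Type u
  atlas : ι → OpenPartialHomeomorph space D.Space
  exists_mem : ∀ x : space, ∃ i, x ∈ (atlas i).source
  hom : ∀ (i j : ι) (U : Opens space), (U : Set space) ⊆ (atlas i).source →
    (U : Set space) ⊆ (atlas j).source → (D.Fun (imgOf (atlas j) U) →ₐ[ℝ] D.Fun (imgOf (atlas i) U))
  hom_mem : ∀ i j U hi hj δ, ∀ f ∈ homog D.formalDeg (Smooth (imgOf (atlas j) U)) δ,
    hom i j U hi hj f ∈ homog D.formalDeg (Smooth (imgOf (atlas i) U)) δ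
  res_hom : ∀ i j U hi hj V (h : V ≤ U) f,
    GSeries.res (deg := D.formalDeg) (imgOf_mono (atlas i) h) (hom i j U hi hj f) =
    hom i j V (fun _ hx => hi (h hx)) (fun _ hx => hj (h hx))
      (GSeries.res (deg := D.formalDeg) (imgOf_mono (atlas j) h) f)
  hom_self : ∀ i U hi f, hom i i U hi hi f = f
  hom_comp : ∀ i j k U hi hj hk f, hom i j U hi hj (hom j k U hj hk f) = hom i k U hi hk f

namespace GluingData

variable {n : ℕ} {D : Coords n} (G : GluingData.{u} D)

attribute [instance] GluingData.t2 GluingData.secondCountable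

/-- The chart domains. -/
def dom (i : G.ι) : Opens G.space := ⟨(G.atlas i).source, (G.atlas i).open_source⟩

theorem imgOf_inf (i : G.ι) (U : Opens G.space) :
    imgOf (G.atlas i) U ≤ imgOf (G.atlas i) (U ⊓ G.dom i) :=
  fun _ hy => ⟨hy.1, hy.2, (G.atlas i).map_target hy.1⟩

/-- The algebra of families of functions on the images of `U` that are related by the
transformations. -/
def secAlg (U : Opens G.space) : Subalgebra ℝ (∀ i, D.Fun (imgOf (G.atlas i) U)) where
  carrier := {s | ∀ i j (V : Opens G.space) (h : V ≤ U) hi hj,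
    G.hom i j V hi hj (GSeries.res (deg := D.formalDeg) (imgOf_mono (G.atlas j) h) (s j)) =
      GSeries.res (deg := D.formalDeg) (imgOf_mono (G.atlas i) h) (s i)}
  mul_mem' := by
    intro s t hs ht i j V h hi hj
    rw [Pi.mul_apply, Pi.mul_apply, map_mul, map_mul, map_mul, hs i j V h hi hj, ht i j V h hi hj]
  add_mem' := by
    intro s t hs ht i j V h hi hj
    rw [Pi.add_apply, Pi.add_apply, map_add, map_add, map_add, hs i j V h hi hj, ht i j V h hi hj]
  algebraMap_mem' := by
    intro r i j V h hi hj
    rw [Pi.algebraMap_apply, Pi.algebraMap_apply, AlgHom.commutes, AlgHom.commutes,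
      AlgHom.commutes]

/-- The sections over `U`. -/
def Sec (U : Opens G.space) : Type u := ↥(G.secAlg U)

instance (U : Opens G.space) : Ring (G.Sec U) := inferInstanceAs (Ring ↥(G.secAlg U))

instance (U : Opens G.space) : Algebra ℝ (G.Sec U) := inferInstanceAs (Algebra ℝ ↥(G.secAlg U))

variable {G}

theorem compat {U : Opens G.space} (s : G.Sec U) (i j : G.ι) {V : Opens G.space} (h : V ≤ U)
    (hi : (V : Set G.space) ⊆ (G.atlas i).source) (hj : (V : Set G.space) ⊆ (G.atlas j).source) :
    G.hom i j V hi hj (GSeries.res (deg := D.formalDeg) (imgOf_mono (G.atlas j) h) (s.1 j)) =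
      GSeries.res (deg := D.formalDeg) (imgOf_mono (G.atlas i) h) (s.1 i) := s.2 i j V h hi hj

variable (G)

/-- Restriction of sections. -/
def res {U V : Opens G.space} (h : U ≤ V) : G.Sec V →ₐ[ℝ] G.Sec U where
  toFun s := ⟨fun i => GSeries.res (deg := D.formalDeg) (imgOf_mono (G.atlas i) h) (s.1 i),
    fun i j _ h' hi hj => compat s i j (h'.trans h) hi hj⟩
  map_one' := Subtype.ext (funext fun i =>
    map_one (GSeries.res (deg := D.formalDeg) (imgOf_mono (G.atlas i) h)))
  map_mul' s t := Subtype.ext (funext fun i =>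
    map_mul (GSeries.res (deg := D.formalDeg) (imgOf_mono (G.atlas i) h)) (s.1 i) (t.1 i))
  map_zero' := Subtype.ext (funext fun i =>
    map_zero (GSeries.res (deg := D.formalDeg) (imgOf_mono (G.atlas i) h)))
  map_add' s t := Subtype.ext (funext fun i =>
    map_add (GSeries.res (deg := D.formalDeg) (imgOf_mono (G.atlas i) h)) (s.1 i) (t.1 i))
  commutes' r := Subtype.ext (funext fun i =>
    AlgHom.commutes (GSeries.res (deg := D.formalDeg) (imgOf_mono (G.atlas i) h)) r)

/-- The component of a section in a chart. -/
def component (U : Opens G.space) (i : G.ι) : G.Sec U →ₐ[ℝ] D.Fun (imgOf (G.atlas i) U) :=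
  (Pi.evalAlgHom ℝ (fun i => D.Fun (imgOf (G.atlas i) U)) i).comp (G.secAlg U).val

/-- The presheaf of sections. -/
def presheaf : TopCat.Presheaf (AlgCat.{u} ℝ) G.space where
  obj U := AlgCat.of ℝ (G.Sec U.unop)
  map h := AlgCat.ofHom (G.res h.unop.le)

variable {G}

theorem isSheaf_presheaf : G.presheaf.IsSheaf := by
  rw [TopCat.Presheaf.isSheaf_iff_isSheaf_comp (forget (AlgCat.{u} ℝ))]
  refine TopCat.Presheaf.isSheaf_of_isSheafUniqueGluing_types _ ?_
  intro ι U sf hsf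
  have hc : ∀ k l (V : Opens G.space) (hk : V ≤ U k) (hl : V ≤ U l),
      G.res hk (sf k) = G.res hl (sf l) := by
    intro k l V hk hl
    have := congrArg (G.res (le_inf hk hl)) (hsf k l)
    exact this
  have hcov : ∀ i, ∀ y ∈ imgOf (G.atlas i) (iSup U), ∃ k, y ∈ imgOf (G.atlas i) (U k) := by
    intro i y hy
    obtain ⟨k, hk⟩ := Opens.mem_iSup.1 hy.2
    exact ⟨k, hy.1, hk⟩
  choose g hg using fun i => GSeries.exists_glue (W := imgOf (G.atlas i) (iSup U))
    (fun k => imgOf (G.atlas i) (U k)) (fun k => imgOf_mono _ (le_iSup U k)) (hcov i)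
    (fun k => (sf k : G.Sec (U k)).1 i) (fun k l => by
      have h := congrArg (fun s : G.Sec _ => s.1 i)
        (hc k l (U k ⊓ U l) inf_le_left inf_le_right)
      have h' : imgOf (G.atlas i) (U k) ⊓ imgOf (G.atlas i) (U l) ≤
        imgOf (G.atlas i) (U k ⊓ U l) := fun y hy => ⟨hy.1.1, hy.1.2, hy.2.2⟩
      exact congrArg (GSeries.res h') h)
  refine ⟨(⟨g, fun i j V h hi hj => ?_⟩ : G.Sec (iSup U)), fun k => ?_, fun t ht => ?_⟩
  · refine eq_of_res_eq (U := fun k => imgOf (G.atlas i) (V ⊓ U k))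
      (fun k => imgOf_mono _ inf_le_left) (fun y hy => ?_) (fun k => ?_)
    · obtain ⟨k, hk⟩ := Opens.mem_iSup.1 (h hy.2)
      exact ⟨k, hy.1, hy.2, hk⟩
    · rw [G.res_hom i j V hi hj (V ⊓ U k) inf_le_left]
      have e1 := congrArg (GSeries.res (deg := D.formalDeg)
        (imgOf_mono (G.atlas j) (inf_le_right : V ⊓ U k ≤ U k))) (hg j k)
      have e2 := congrArg (GSeries.res (deg := D.formalDeg)
        (imgOf_mono (G.atlas i) (inf_le_right : V ⊓ U k ≤ U k))) (hg i k)
      have e3 := compat (sf k : G.Sec (U k)) i j (inf_le_right : V ⊓ U k ≤ U k)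
        (fun x hx => hi hx.1) (fun x hx => hj hx.1)
      refine Eq.trans (congrArg _ e1) (e3.trans e2.symm)
  · exact Subtype.ext (funext fun i => hg i k)
  · refine Subtype.ext (funext fun i => ?_)
    refine eq_of_res_eq (U := fun k => imgOf (G.atlas i) (U k))
      (fun k => imgOf_mono _ (le_iSup U k)) (hcov i) (fun k => ?_)
    have := congrArg (fun s : G.Sec _ => s.1 i) (ht k)
    exact Eq.trans this (hg i k).symm

variable (G) in
/-- The homogeneous sections. -/
def grading (U : Opens G.space) (δ : Deg n) : Submodule ℝ (G.Sec U) where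
  carrier := {s | ∀ i, s.1 i ∈ homog D.formalDeg (Smooth (imgOf (G.atlas i) U)) δ}
  add_mem' hs ht i := add_mem (hs i) (ht i)
  zero_mem' _ := zero_mem _
  smul_mem' c _ hs i := Submodule.smul_mem _ c (hs i)

/-- The homogeneous component of degree `δ` of a section. -/
def comp (U : Opens G.space) (δ : Deg n) : G.Sec U →ₗ[ℝ] G.Sec U where
  toFun s := ⟨fun i => GSeries.comp δ (s.1 i), fun i j V h hi hj => by
    have e := compat s i j h hi hj
    have r : ∀ k, GSeries.res (deg := D.formalDeg) (imgOf_mono (G.atlas k) h)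
        (GSeries.comp δ (s.1 k)) = GSeries.comp δ (GSeries.res (deg := D.formalDeg)
          (imgOf_mono (G.atlas k) h) (s.1 k)) := fun k =>
      map_comp_of_mem (GSeries.res (deg := D.formalDeg) (imgOf_mono (G.atlas k) h)).toLinearMap
        (fun _ _ hf => res_mem_homog _ hf) δ (s.1 k)
    change G.hom i j V hi hj (GSeries.res (deg := D.formalDeg) (imgOf_mono (G.atlas j) h)
      (GSeries.comp δ (s.1 j))) = _
    refine Eq.trans ?_ (r i).symm
    rw [r, ← e]
    exact map_comp_of_mem (G.hom i j V hi hj).toLinearMap (G.hom_mem i j V hi hj) δ _⟩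
  map_add' s t := Subtype.ext (funext fun i => map_add (GSeries.comp δ) (s.1 i) (t.1 i))
  map_smul' c s := Subtype.ext (funext fun i => map_smul (GSeries.comp δ) c (s.1 i))

theorem comp_mem (U : Opens G.space) (δ : Deg n) (s : G.Sec U) : comp U δ s ∈ G.grading U δ :=
  fun i => comp_mem_homog δ (s.1 i)

theorem isInternal_grading (U : Opens G.space) : DirectSum.IsInternal (G.grading U) :=
  isInternal_of_proj (G.grading U) (comp U) (comp_mem U)
    (fun _ _ hs => Subtype.ext (funext fun i => comp_of_mem (hs i)))
    (fun _ _ _ hs hne => Subtype.ext (funext fun i => comp_of_mem_ne (hs i) hne))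
    (fun s => Subtype.ext (funext fun i =>
      (map_sum (G.component U i) (fun δ => comp U δ s) _).trans (sum_comp (s.1 i))))

variable (G) in
/-- The transformation to the chart with index `j` of a function given in the chart with index `i`,
over a part of the domain of the latter. -/
def transform (i j : G.ι) (U : Opens G.space) (hU : (U : Set G.space) ⊆ (G.atlas i).source)
    (f : D.Fun (imgOf (G.atlas i) U)) : D.Fun (imgOf (G.atlas j) U) :=
  GSeries.res (deg := D.formalDeg) (G.imgOf_inf j U)
    (G.hom j i (U ⊓ G.dom j) (fun _ hx => hx.2) (fun _ hx => hU hx.1)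
      (GSeries.res (deg := D.formalDeg) (imgOf_mono (G.atlas i) inf_le_left) f))

theorem res_transform (i j : G.ι) {U V : Opens G.space}
    (hU : (U : Set G.space) ⊆ (G.atlas i).source) (f : D.Fun (imgOf (G.atlas i) U)) (h : V ≤ U)
    (hj : (V : Set G.space) ⊆ (G.atlas j).source) :
    GSeries.res (deg := D.formalDeg) (imgOf_mono (G.atlas j) h) (G.transform i j U hU f) =
      G.hom j i V hj (fun _ hx => hU (h hx))
        (GSeries.res (deg := D.formalDeg) (imgOf_mono (G.atlas i) h) f) :=
  G.res_hom j i (U ⊓ G.dom j) (fun _ hx => hx.2) (fun _ hx => hU hx.1) V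
    (fun _ hx => ⟨h hx, hj hx⟩)
    (GSeries.res (deg := D.formalDeg) (imgOf_mono (G.atlas i) inf_le_left) f)

theorem transform_self (i : G.ι) {U : Opens G.space}
    (hU : (U : Set G.space) ⊆ (G.atlas i).source) (f : D.Fun (imgOf (G.atlas i) U)) :
    G.transform i i U hU f = f :=
  congrArg (GSeries.res (deg := D.formalDeg) (G.imgOf_inf i U))
    (G.hom_self i (U ⊓ G.dom i) (fun _ hx => hx.2) _)

theorem transform_component (i j : G.ι) {U : Opens G.space}
    (hU : (U : Set G.space) ⊆ (G.atlas i).source) (s : G.Sec U) :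
    G.transform i j U hU (s.1 i) = s.1 j :=
  congrArg (GSeries.res (deg := D.formalDeg) (G.imgOf_inf j U))
    (compat s j i (inf_le_left : U ⊓ G.dom j ≤ U) (fun _ hx => hx.2) fun _ hx => hU hx.1)

theorem transform_mem (i j : G.ι) {U : Opens G.space}
    (hU : (U : Set G.space) ⊆ (G.atlas i).source) {δ : Deg n} {f : D.Fun (imgOf (G.atlas i) U)}
    (hf : f ∈ homog D.formalDeg (Smooth (imgOf (G.atlas i) U)) δ) :
    G.transform i j U hU f ∈ homog D.formalDeg (Smooth (imgOf (G.atlas j) U)) δ :=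
  res_mem_homog _ (G.hom_mem j i (U ⊓ G.dom j) (fun _ hx => hx.2) (fun _ hx => hU hx.1) δ _
    (res_mem_homog _ hf))

variable (G) in
/-- The section over a part of a chart domain with given component in this chart. -/
def extendFrom (i : G.ι) (U : Opens G.space) (hU : (U : Set G.space) ⊆ (G.atlas i).source)
    (f : D.Fun (imgOf (G.atlas i) U)) : G.Sec U :=
  ⟨fun j => G.transform i j U hU f, by
    intro j k V h hj hk
    refine Eq.trans ?_ (res_transform i j hU f h hj).symm
    refine Eq.trans (congrArg (G.hom j k V hj hk) (res_transform i k hU f h hk)) ?_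
    exact G.hom_comp j k i V hj hk _ _⟩

variable (G) in
/-- The sections over a part of a chart domain are the functions on its image. -/
def readEquiv (i : G.ι) (U : Opens G.space) (hU : (U : Set G.space) ⊆ (G.atlas i).source) :
    G.Sec U ≃ₐ[ℝ] D.Fun (imgOf (G.atlas i) U) :=
  AlgEquiv.ofBijective (G.component U i) (by
    refine ⟨fun s t hst => Subtype.ext (funext fun j => ?_),
      fun f => ⟨G.extendFrom i U hU f, transform_self i hU f⟩⟩
    exact (transform_component i j hU s).symm.trans
      ((congrArg (G.transform i j U hU) hst).trans (transform_component i j hU t)))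

theorem readEquiv_apply (i : G.ι) (U : Opens G.space)
    (hU : (U : Set G.space) ⊆ (G.atlas i).source) (s : G.Sec U) :
    G.readEquiv i U hU s = s.1 i := rfl

theorem component_readEquiv_symm (i j : G.ι) (U : Opens G.space)
    (hi : (U : Set G.space) ⊆ (G.atlas i).source) (hj : (U : Set G.space) ⊆ (G.atlas j).source)
    (f : D.Fun (imgOf (G.atlas i) U)) :
    ((G.readEquiv i U hi).symm f).1 j = G.hom j i U hj hi f := by
  have := compat ((G.readEquiv i U hi).symm f) j i le_rfl hj hi
  rw [GSeries.res_refl, GSeries.res_refl, ← readEquiv_apply i U hi, AlgEquiv.apply_symm_apply]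
    at this
  exact this.symm

theorem mem_grading_iff (i : G.ι) (U : Opens G.space)
    (hU : (U : Set G.space) ⊆ (G.atlas i).source) (δ : Deg n) (s : G.Sec U) :
    s ∈ G.grading U δ ↔ s.1 i ∈ homog D.formalDeg (Smooth (imgOf (G.atlas i) U)) δ := by
  refine ⟨fun h => h i, fun h j => ?_⟩
  rw [← transform_component i j hU s]
  exact transform_mem i j hU h

/-- A section whose value at `x` does not vanish is invertible near `x`. -/
theorem exists_isUnit_res (i : G.ι) {U : Opens G.space} {x : G.space} (hx : x ∈ U)
    (hi : x ∈ (G.atlas i).source) (y : imgOf (G.atlas i) U) (hy : y.1 = G.atlas i x) (s : G.Sec U)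
    (h : value y (s.1 i) ≠ 0) :
    ∃ (V : Opens G.space) (hV : V ≤ U), x ∈ V ∧ IsUnit (G.res hV s) := by
  obtain ⟨W, hW, hyW, hun⟩ := GSeries.exists_isUnit_res h
  set V : Opens G.space := ⟨(U : Set G.space) ∩ ((G.atlas i).source ∩ G.atlas i ⁻¹' W),
    U.isOpen.inter ((G.atlas i).isOpen_inter_preimage W.isOpen)⟩
  have hV : V ≤ U := fun _ h => h.1
  refine ⟨V, hV, ⟨hx, hi, by rwa [Set.mem_preimage, ← hy]⟩, ?_⟩
  have himg : imgOf (G.atlas i) V ≤ W := by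
    intro z hz
    have := hz.2.2.2
    rwa [Set.mem_preimage, (G.atlas i).right_inv hz.1] at this
  exact (MulEquiv.isUnit_map (G.readEquiv i V fun _ h => h.2.1)).1 (hun _ himg)

/-- The stalk at `x` is local: in a chart around `x`, a section whose value at `x` is not zero is
invertible near `x`, and of two sections with invertible sum one has non-zero value. -/
theorem isLocalRing_stalk (x : G.space) : IsLocalRing
    (TopCat.Presheaf.stalk (C := RingCat.{u}) (X := G.space)
      (G.presheaf ⋙ forget₂ (AlgCat.{u} ℝ) RingCat.{u}) x) := by
  obtain ⟨i, hi⟩ := G.exists_mem x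
  set F : TopCat.Presheaf RingCat.{u} G.space :=
    G.presheaf ⋙ forget₂ (AlgCat.{u} ℝ) RingCat.{u} with hF
  let germ : ∀ U : Opens G.space, x ∈ U → G.Sec U →+* F.stalk x := fun U hU => (F.germ U x hU).hom
  have germ_res : ∀ (U V : Opens G.space) (hU : x ∈ U) (hV : V ≤ U) (hxV : x ∈ V) (s : G.Sec U),
      germ V hxV (G.res hV s) = germ U hU s := fun U V hU hV hxV s =>
    TopCat.Presheaf.germ_res_apply F (homOfLE hV) x hxV s
  -- The point of the domain that corresponds to `x`.
  let pt : ∀ U : Opens G.space, x ∈ U → imgOf (G.atlas i) U := fun U hU =>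
    ⟨G.atlas i x, (G.atlas i).map_source hi, by
      rw [Set.mem_preimage, (G.atlas i).left_inv hi]; exact hU⟩
  have key : ∀ (U : Opens G.space) (hU : x ∈ U) (s t : G.Sec U),
      germ U hU s = germ U hU t → value (pt U hU) (s.1 i) = value (pt U hU) (t.1 i) := by
    intro U hU s t hst
    obtain ⟨W, hxW, i₁, i₂, e⟩ := TopCat.Presheaf.germ_eq F x hU hU s t hst
    exact congrArg (fun r : G.Sec W => value (pt W hxW) (r.1 i)) e
  have hunit : ∀ (U : Opens G.space) (hU : x ∈ U) (s : G.Sec U),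
      value (pt U hU) (s.1 i) ≠ 0 → IsUnit (germ U hU s) := by
    intro U hU s hs
    obtain ⟨V, hV, hxV, hun⟩ := exists_isUnit_res i hU hi (pt U hU) rfl s hs
    rw [← germ_res U V hU hV hxV]
    exact hun.map _
  have hnt : Nontrivial (TopCat.Presheaf.stalk (C := RingCat.{u}) F x) := by
    refine ⟨0, 1, fun h01 => ?_⟩
    have h : value (pt ⊤ trivial) (0 : D.Fun (imgOf (G.atlas i) ⊤)) = value (pt ⊤ trivial) 1 :=
      key ⊤ trivial 0 1 ((map_zero (germ ⊤ trivial)).trans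
        (h01.trans (map_one (germ ⊤ trivial)).symm))
    rw [value_zero, value_one] at h
    exact zero_ne_one h
  refine ⟨fun {a b} hab => ?_⟩
  obtain ⟨U, hU, s, hs⟩ : ∃ (U : Opens G.space) (hU : x ∈ U) (s : G.Sec U), germ U hU s = a :=
    TopCat.Presheaf.exists_germ_eq F a
  obtain ⟨U', hU', t, ht⟩ : ∃ (U : Opens G.space) (hU : x ∈ U) (s : G.Sec U), germ U hU s = b :=
    TopCat.Presheaf.exists_germ_eq F b
  have hV : x ∈ U ⊓ U' := ⟨hU, hU'⟩
  rw [← hs, ← ht, ← germ_res U _ hU inf_le_left hV, ← germ_res U' _ hU' inf_le_right hV] at hab ⊢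
  set s' : G.Sec (U ⊓ U') := G.res inf_le_left s
  set t' : G.Sec (U ⊓ U') := G.res inf_le_right t
  have e : value (pt _ hV) (s'.1 i) + value (pt _ hV) (t'.1 i) = 1 :=
    (value_add _ _ _).symm.trans ((key _ hV (s' + t') 1 ((map_add (germ _ hV) s' t').trans
      (hab.trans (map_one (germ _ hV)).symm))).trans (value_one _))
  by_cases h : value (pt _ hV) (s'.1 i) = 0
  · refine Or.inr (hunit _ hV t' ?_)
    rw [h, zero_add] at e
    rw [e]
    exact one_ne_zero
  · exact Or.inl (hunit _ hV s' h)

variable (G) in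
/-- The `ℤ₂ⁿ`-ringed space obtained by gluing. -/
def ringedSpace : RingedSpace.{u} n where
  space := G.space
  sheaf := ⟨G.presheaf, isSheaf_presheaf⟩
  grading := G.grading
  graded _ :=
    { one_mem := fun _ => one_mem_homog
      mul_mem := fun _ _ _ _ hs ht i => mul_mem_homog (hs i) (ht i) }
  isInternal := isInternal_grading
  map_mem h _ _ hs i := res_mem_homog (imgOf_mono _ h) (hs i)
  graded_comm _ a b s t hs ht := Subtype.ext (funext fun i =>
    (mul_comm_of_mem_homog (hs i) (ht i)).trans
      (map_zsmul (G.component _ i) (sgn (a ⬝ᵥ b)) (t * s : G.Sec _)).symm)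
  isLocal_stalk x := isLocalRing_stalk x

variable (G) in
/-- The charts of the ringed space obtained by gluing. -/
def chart (i : G.ι) : G.ringedSpace.Chart D where
  homeo := G.atlas i
  readAux := G.readEquiv i
  readAux_mem := mem_grading_iff i
  readAux_res _ _ _ _ _ := rfl

variable (G) in
/-- The `ℤ₂ⁿ`-manifold obtained by gluing. -/
def manifold : Manifold.{u} D where
  toRingedSpace := G.ringedSpace
  exists_chart x := (G.exists_mem x).imp' G.chart fun _ h => h

end GluingData

/-! ### Base functions and momenta in coordinates -/

namespace Coords

variable {n : ℕ} {D D' : Coords n} {γ : Deg n}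

theorem value_coord_of_eq {W : Opens D.Space} (z : W) {i : D.idx} (h : D.deg i = 0) :
    value z (D.coord W i) = z.1 ⟨i, h⟩ := by
  rw [coord_of_eq W h, value_const, Smooth.eval_coord]

theorem value_coord_of_ne {W : Opens D.Space} (z : W) {i : D.idx} (h : D.deg i ≠ 0) :
    value z (D.coord W i) = 0 := by
  rw [coord_of_ne W h, value_var]

/-- The constant term of the image of a series under a morphism depends only on its constant term.
-/
theorem value_hom {V : Opens D'.Space} {W : Opens D.Space} (Φ : D'.Fun V →ₐ[ℝ] D.Fun W) (x : W)
    (hz : MapsInto V fun i => Φ (D'.coord V i)) (y : V)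
    (hy : ∀ b : D'.Base, value x (Φ (D'.coord V b.1)) = y.1 b) (f : D'.Fun V) :
    value x (Φ f) = value y f := by
  have hb : ∀ b, value x (Φ (const (Smooth.coord V b))) = y.1 b := fun b => by
    rw [← coord_of_eq V b.2]; exact hy b
  have hj : ∀ j, value x (Φ (var j)) = 0 := fun j => by
    rw [← coord_of_ne V j.2]; exact hz.value_eq_zero x j.1 j.2
  obtain ⟨g, h, e⟩ := GSeries.exists_hadamard f y
  have h1 : ∀ b, value x (Φ (const (Smooth.coord V b) * g b - y.1 b • g b)) = 0 := fun b => by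
    have e : value x (y.1 b • Φ (g b)) = y.1 b * value x (Φ (g b)) := map_smul (valueHom x) _ _
    rw [map_sub, value_sub, map_mul, value_mul, map_smul, e, hb, sub_self]
  have h2 : ∀ j, value x (Φ (var j * h j)) = 0 := fun j => by
    rw [map_mul, value_mul, hj, zero_mul]
  have e' := congrArg (fun k => value x (Φ k)) e
  refine e'.trans ?_
  rw [map_add, map_add, map_sum, map_sum, value_add, value_add, value_sum, value_sum,
    Finset.sum_eq_zero fun b _ => h1 b, Finset.sum_eq_zero fun j _ => h2 j, add_zero, add_zero,
    AlgHom.commutes, value_algebraMap]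

section BaseHom

variable {V V' : Opens D.Space} {W W' : Opens (D.cot γ).Space}

theorem mapsInto_coord_xIdx (h : ∀ z ∈ W, D.baseProj γ z ∈ V) :
    MapsInto V fun i => (D.cot γ).coord W (D.xIdx γ i) := by
  refine mapsInto_of_mem (fun i => coord_mem_homog W (D.xIdx γ i)) fun z => ?_
  have : (fun b : D.Base => value z ((D.cot γ).coord W (D.xIdx γ b.1))) = D.baseProj γ z.1 :=
    funext fun b => value_coord_of_eq (D := D.cot γ) (i := D.xIdx γ b.1) z b.2
  rw [this]
  exact h z.1 z.2

/-- The pullback of functions on the base. -/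
def baseHom (h : ∀ z ∈ W, D.baseProj γ z ∈ V) : D.Fun V →ₐ[ℝ] (D.cot γ).Fun W :=
  (exists_fun_hom (mapsInto_coord_xIdx h) fun i => coord_mem_homog W (D.xIdx γ i)).choose

theorem baseHom_coord (h : ∀ z ∈ W, D.baseProj γ z ∈ V) (i : D.idx) :
    baseHom h (D.coord V i) = (D.cot γ).coord W (D.xIdx γ i) :=
  (exists_fun_hom (mapsInto_coord_xIdx h)
    fun i => coord_mem_homog W (D.xIdx γ i)).choose_spec.1 i

theorem baseHom_mem (h : ∀ z ∈ W, D.baseProj γ z ∈ V) {δ : Deg n} {f : D.Fun V}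
    (hf : f ∈ homog D.formalDeg (Smooth V) δ) :
    baseHom h f ∈ homog (D.cot γ).formalDeg (Smooth W) δ :=
  (exists_fun_hom (mapsInto_coord_xIdx h)
    fun i => coord_mem_homog W (D.xIdx γ i)).choose_spec.2 δ f hf

theorem mapsInto_baseHom (h : ∀ z ∈ W, D.baseProj γ z ∈ V) :
    MapsInto V fun i => baseHom h (D.coord V i) := by
  simp only [baseHom_coord]
  exact mapsInto_coord_xIdx h

theorem value_baseHom (h : ∀ z ∈ W, D.baseProj γ z ∈ V) (z : W) (f : D.Fun V) :
    value z (baseHom h f) = value ⟨D.baseProj γ z.1, h z.1 z.2⟩ f := by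
  refine value_hom (baseHom h) z (mapsInto_baseHom h) _ (fun b => ?_) f
  rw [baseHom_coord]
  exact value_coord_of_eq (D := D.cot γ) (i := D.xIdx γ b.1) z b.2

theorem res_baseHom (hV : V' ≤ V) (hW : W' ≤ W) (h : ∀ z ∈ W, D.baseProj γ z ∈ V)
    (h' : ∀ z ∈ W', D.baseProj γ z ∈ V') (f : D.Fun V) :
    GSeries.res hW (baseHom h f) = baseHom h' (GSeries.res hV f) := by
  have e : (GSeries.res hW).comp (baseHom h) = (baseHom h').comp (GSeries.res hV) := by
    have hc : ∀ i, (GSeries.res hW).comp (baseHom h) (D.coord V i) =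
        (D.cot γ).coord W' (D.xIdx γ i) := fun i => by
      rw [AlgHom.comp_apply, baseHom_coord, Coords.res_coord]
    refine fun_hom_ext ?_ fun i => ?_
    · simp only [hc]
      exact mapsInto_coord_xIdx fun z hz => h z (hW hz)
    · rw [hc, AlgHom.comp_apply, Coords.res_coord, baseHom_coord]
  exact DFunLike.congr_fun e f

end BaseHom

end Coords

namespace RingedSpace.Chart

open Coords

variable {n : ℕ} {D : Coords n} {X : RingedSpace.{u} n} {γ : Deg n}

/-! #### Jacobian matrices -/

theorem res_partialD (c : X.Chart D) {U V : Opens X.space} (hV : V ≤ c.source) (h : U ≤ V)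
    (i : D.idx) (s : X.Sec V) :
    X.res h (c.partialD V hV i s) = c.partialD U (h.trans hV) i (X.res h s) := by
  apply (c.read U (h.trans hV)).injective
  rw [c.read_res hV h, partialD, partialD, AlgEquiv.apply_symm_apply, AlgEquiv.apply_symm_apply,
    c.read_res hV h, Coords.res_partialD]

theorem read_partialD (c : X.Chart D) {V : Opens X.space} (hV : V ≤ c.source)
    (i : D.idx) (s : X.Sec V) :
    c.read V hV (c.partialD V hV i s) = D.partialD _ i (c.read V hV s) :=
  AlgEquiv.apply_symm_apply _ _

section Jacobian

variable (c c' c'' : X.Chart D) {U V : Opens X.space} (h : V ≤ c.source) (h' : V ≤ c'.source)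
  (h'' : V ≤ c''.source)

/-- The entry `∂x^I/∂x^{J'}` of the Jacobian matrix of a change of coordinates. -/
def jac (j i : D.idx) : X.Sec V := c'.partialD V h' j (c.coord V h i)

theorem res_jac (hU : U ≤ V) (j i : D.idx) :
    X.res hU (jac c c' h h' j i) = jac c c' (hU.trans h) (hU.trans h') j i := by
  rw [jac, res_partialD, res_coord, jac]

theorem jac_mem (j i : D.idx) : jac c c' h h' j i ∈ X.grading V (D.deg j + D.deg i) :=
  c'.read_symm_mem h' (partialD_mem_homog j (c'.read_mem h' (c.coord_mem h i)))

open Classical in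
theorem jac_self (j i : D.idx) : jac c c h h j i = if i = j then 1 else 0 := by
  apply (c.read V h).injective
  rw [jac, read_partialD, read_coord, partialD_coord, apply_ite (c.read V h), map_one, map_zero]

/-- The chain rule for Jacobian matrices. -/
theorem jac_comp (k i : D.idx) :
    ∑ j, jac c' c'' h' h'' k j * jac c c' h h' j i = jac c c'' h h'' k i := by
  apply (c''.read V h'').injective
  rw [map_sum, jac, read_partialD, ← trans_read c'' c' h'' h' (c.coord V h i)]
  have hψ := partialD_hom (c''.trans c' V h'' h' : D.Fun (c'.img V) →ₐ[ℝ] D.Fun (c''.img V))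
    (trans_coord_mem c'' c' h'' h') (mapsInto_trans c'' c' h'' h') k (c'.read V h' (c.coord V h i))
  refine Eq.trans ?_ hψ.symm
  refine Finset.sum_congr rfl fun j _ => ?_
  rw [map_mul, jac, read_partialD, ← trans_read c'' c' h'' h' (c'.coord V h' j), read_coord,
    ← trans_read c'' c' h'' h' (jac c c' h h' j i), jac, read_partialD]
  rfl

end Jacobian

section Val

variable (c c' : X.Chart D) {U V : Opens X.space} (h : V ≤ c.source) (h' : V ≤ c'.source)
  {x : X.space}

/-- The value of a section at a point. -/
def val (hx : x ∈ V) (s : X.Sec V) : ℝ := value (c.point h hx) (c.read V h s)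

/-- Values of sections do not depend on the chart in which they are taken. -/
theorem val_eq (hx : x ∈ V) (s : X.Sec V) : val c h hx s = val c' h' hx s := by
  have := value_pull (Hom.id X) c c' h' h le_rfl s hx
  have e : X.res (le_refl V) ((Hom.id X).pull V s) = s := res_refl s
  exact (congrArg (val c h hx) e).symm.trans this

theorem val_res (hU : U ≤ V) (hx : x ∈ U) (s : X.Sec V) :
    val c (hU.trans h) hx (X.res hU s) = val c h (hU hx) s := by
  rw [val, c.read_res h hU, value_res]
  rfl

theorem val_coord (hx : x ∈ V) (b : D.Base) :
    val c h hx (c.coord V h b.1) = c.homeo x b := by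
  rw [val, read_coord, value_coord_of_eq _ b.2]
  rfl

theorem val_eq_zero {δ : Deg n} (hδ : δ ≠ 0) (hx : x ∈ V) {s : X.Sec V}
    (hs : s ∈ X.grading V δ) : val c h hx s = 0 := by
  rw [val, value, body_eq_zero_of_mem_homog (c.read_mem h hs) hδ, map_zero]

end Val

/-! #### Change of coordinates of the shifted cotangent bundle -/

section PullSec

variable (c c' : X.Chart D) {V V' : Opens X.space} (hV : V ≤ c.source)
  {W W' : Opens (D.cot γ).Space} (h : ∀ z ∈ W, D.baseProj γ z ∈ c.img V)

/-- The coordinate expression of the pullback of a section of the base. -/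
def pullSec : X.Sec V →ₐ[ℝ] (D.cot γ).Fun W :=
  (baseHom h).comp (c.read V hV : X.Sec V →ₐ[ℝ] D.Fun (c.img V))

theorem pullSec_apply (s : X.Sec V) : pullSec c hV h s = baseHom h (c.read V hV s) := rfl

theorem pullSec_coord (i : D.idx) :
    pullSec c hV h (c.coord V hV i) = (D.cot γ).coord W (D.xIdx γ i) := by
  rw [pullSec_apply, read_coord, baseHom_coord]

theorem pullSec_mem {δ : Deg n} {s : X.Sec V} (hs : s ∈ X.grading V δ) :
    pullSec c hV h s ∈ homog (D.cot γ).formalDeg (Smooth W) δ :=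
  baseHom_mem h (c.read_mem hV hs)

theorem res_pullSec (hV' : V' ≤ V) (hW : W' ≤ W) (h' : ∀ z ∈ W', D.baseProj γ z ∈ c.img V')
    (s : X.Sec V) :
    GSeries.res hW (pullSec c hV h s) = pullSec c (hV'.trans hV) h' (X.res hV' s) := by
  rw [pullSec_apply, pullSec_apply, c.read_res hV hV']
  exact res_baseHom (c.img_mono hV') hW h h' _

theorem pullSec_res (hV' : V' ≤ V) (h' : ∀ z ∈ W, D.baseProj γ z ∈ c.img V') (s : X.Sec V) :
    pullSec c (hV'.trans hV) h' (X.res hV' s) = pullSec c hV h s :=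
  (res_pullSec c hV h hV' le_rfl h' s).symm

theorem value_pullSec (z : W) (s : X.Sec V) : value z (pullSec c hV h s) =
    val c hV (c.symm_mem ⟨D.baseProj γ z.1, h z.1 z.2⟩) s := by
  rw [pullSec_apply, value_baseHom, val, point_symm]

end PullSec

section Transition

variable (c c' : X.Chart D) {W W' : Opens (D.cot γ).Space}

/-- The coordinates over the chart `c'`, expressed in the coordinates over the chart `c`. -/
def transCoord (h : ∀ z ∈ W, D.baseProj γ z ∈ c.img (c.source ⊓ c'.source)) (v : (D.cot γ).idx) :
    (D.cot γ).Fun W :=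
  Sum.elim (fun i => pullSec c inf_le_left h (c'.coord (c.source ⊓ c'.source) inf_le_right i))
    (fun j => ∑ i, sgn ((D.deg i + D.deg j) ⬝ᵥ γ) •
      (pullSec c inf_le_left h (jac c c' (V := c.source ⊓ c'.source) inf_le_left inf_le_right j i) *
        (D.cot γ).coord W (D.pIdx γ i))) (ofLex v)

theorem transCoord_xIdx (h : ∀ z ∈ W, D.baseProj γ z ∈ c.img (c.source ⊓ c'.source))
    {V : Opens X.space} (hV : V ≤ c.source) (hV' : V ≤ c'.source)
    (hz : ∀ z ∈ W, D.baseProj γ z ∈ c.img V) (i : D.idx) :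
    transCoord c c' h (D.xIdx γ i) = pullSec c hV hz (c'.coord V hV' i) := by
  rw [← c'.res_coord (V := c.source ⊓ c'.source) inf_le_right (le_inf hV hV') i,
    pullSec_res c inf_le_left h (le_inf hV hV')]
  rfl

theorem transCoord_pIdx (h : ∀ z ∈ W, D.baseProj γ z ∈ c.img (c.source ⊓ c'.source))
    {V : Opens X.space} (hV : V ≤ c.source) (hV' : V ≤ c'.source)
    (hz : ∀ z ∈ W, D.baseProj γ z ∈ c.img V) (j : D.idx) :
    transCoord c c' h (D.pIdx γ j) = ∑ i, sgn ((D.deg i + D.deg j) ⬝ᵥ γ) •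
      (pullSec c hV hz (jac c c' hV hV' j i) * (D.cot γ).coord W (D.pIdx γ i)) := by
  refine Finset.sum_congr rfl fun i _ => ?_
  rw [← res_jac c c' (V := c.source ⊓ c'.source) inf_le_left inf_le_right (le_inf hV hV') j i,
    pullSec_res c inf_le_left h (le_inf hV hV')]

theorem transCoord_mem (h : ∀ z ∈ W, D.baseProj γ z ∈ c.img (c.source ⊓ c'.source))
    (v : (D.cot γ).idx) :
    transCoord c c' h v ∈ homog (D.cot γ).formalDeg (Smooth W) ((D.cot γ).deg v) := by
  rcases v with i | j
  · exact pullSec_mem c _ h (c'.coord_mem _ i)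
  · refine sum_mem fun i _ => zsmul_mem ?_ _
    have := mul_mem_homog (pullSec_mem c inf_le_left h (jac_mem c c' inf_le_left inf_le_right j i))
      (coord_mem_homog W (D.pIdx γ i))
    have e : D.deg j + D.deg i + (D.cot γ).deg (D.pIdx γ i) = (D.cot γ).deg (D.pIdx γ j) := by
      rw [cot_deg_pIdx, cot_deg_pIdx, add_assoc, ← add_assoc (D.deg i), deg_add_self, zero_add]
    rwa [e] at this

theorem res_transCoord (hW : W' ≤ W)
    (h : ∀ z ∈ W, D.baseProj γ z ∈ c.img (c.source ⊓ c'.source))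
    (h' : ∀ z ∈ W', D.baseProj γ z ∈ c.img (c.source ⊓ c'.source)) (v : (D.cot γ).idx) :
    GSeries.res hW (transCoord c c' h v) = transCoord c c' h' v := by
  have e : ∀ s : X.Sec (c.source ⊓ c'.source),
      GSeries.res hW (pullSec c inf_le_left h s) = pullSec c inf_le_left h' s := fun s => by
    rw [res_pullSec c inf_le_left h le_rfl hW h', X.res_refl]
  rcases v with i | j
  · exact e _
  · refine (map_sum _ _ _).trans (Finset.sum_congr rfl fun i _ => ?_)
    rw [map_zsmul, map_mul, e, Coords.res_coord]

theorem transCoord_self (h : ∀ z ∈ W, D.baseProj γ z ∈ c.img (c.source ⊓ c.source))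
    (v : (D.cot γ).idx) : transCoord c c h v = (D.cot γ).coord W v := by
  classical
  rcases v with i | j
  · exact pullSec_coord c _ h i
  · refine (Finset.sum_eq_single j ?_ ?_).trans ?_
    · intro i _ hi
      rw [jac_self, if_neg hi, map_zero, zero_mul, smul_zero]
    · simp
    · rw [jac_self, if_pos rfl, map_one, one_mul, deg_add_self, zero_dotProduct, sgn_zero, one_smul]
      rfl

end Transition

end RingedSpace.Chart

/-! ### The total space of the shifted cotangent bundle -/

namespace Coords

variable {n : ℕ} (D : Coords n) (γ : Deg n)

/-- The values of the momenta of degree zero. -/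
abbrev Momenta : Type := {j : D.idx // D.deg j + γ = 0} → ℝ

variable {D γ} in
open Classical in
/-- The value of a momentum; it vanishes if the degree is not zero. -/
def momentum (p : D.Momenta γ) (i : D.idx) : ℝ := if h : D.deg i + γ = 0 then p ⟨i, h⟩ else 0

/-- The decomposition of the coordinate space of a shifted cotangent bundle. -/
def cotSplit : D.Space × D.Momenta γ ≃ₜ (D.cot γ).Space where
  toFun q v := Sum.rec (motive := fun s => (D.cot γ).deg (toLex s) = 0 → ℝ)
    (fun i h => q.1 ⟨i, h⟩) (fun j h => q.2 ⟨j, h⟩) (ofLex v.1) v.2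
  invFun z := (D.baseProj γ z, fun j => z ⟨D.pIdx γ j.1, j.2⟩)
  left_inv _ := rfl
  right_inv z := by
    funext v
    rcases v with ⟨i | j, h⟩ <;> rfl
  continuous_toFun := by
    refine continuous_pi fun v => ?_
    rcases v with ⟨i | j, h⟩
    · exact (continuous_apply (⟨i, h⟩ : D.Base)).comp continuous_fst
    · exact (continuous_apply (⟨j, h⟩ : {j : D.idx // D.deg j + γ = 0})).comp continuous_snd
  continuous_invFun := by
    refine Continuous.prodMk ?_ ?_
    · exact continuous_pi fun b => continuous_apply _
    · exact continuous_pi fun b => continuous_apply _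

theorem value_coord_pIdx {W : Opens (D.cot γ).Space} (z : W) (i : D.idx) :
    value z ((D.cot γ).coord W (D.pIdx γ i)) = momentum ((D.cotSplit γ).symm z.1).2 i := by
  by_cases h : D.deg i + γ = 0
  · rw [value_coord_of_eq (D := D.cot γ) (i := D.pIdx γ i) z h, momentum, dif_pos h]
    rfl
  · rw [value_coord_of_ne (D := D.cot γ) (i := D.pIdx γ i) z h, momentum, dif_neg h]

end Coords

namespace Manifold

open RingedSpace RingedSpace.Chart Coords

variable {n : ℕ} {D : Coords n} (M : Manifold.{u} D) (γ : Deg n)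

section Core

variable {M}

open Classical in
/-- The value of an entry of the Jacobian matrix at a point, and zero outside of the common domain
of the charts. -/
def jacVal (c c' : M.Chart) (x : M.space) (j i : D.idx) : ℝ :=
  if h : x ∈ c.source ⊓ c'.source then
    val c (V := c.source ⊓ c'.source) inf_le_left h (jac c c' inf_le_left inf_le_right j i) else 0

theorem jacVal_eq (c c' c'' : M.Chart) {V : Opens M.space} (h : V ≤ c.source) (h' : V ≤ c'.source)
    (h'' : V ≤ c''.source) {x : M.space} (hx : x ∈ V) (j i : D.idx) :
    jacVal c c' x j i = val c'' h'' hx (jac c c' h h' j i) := by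
  have hx' : x ∈ c.source ⊓ c'.source := ⟨h hx, h' hx⟩
  rw [jacVal, dif_pos hx',
    ← val_res c inf_le_left (le_inf h h') hx, res_jac]
  exact val_eq c c'' h h'' hx _

theorem jacVal_eq_zero (c c' : M.Chart) {x : M.space} {j i : D.idx} (h : D.deg j ≠ D.deg i) :
    jacVal c c' x j i = 0 := by
  rw [jacVal]
  split_ifs with hx
  · refine val_eq_zero c inf_le_left (fun h0 => h ?_) hx (jac_mem c c' inf_le_left inf_le_right j i)
    have := congrArg (· + D.deg i) h0
    simpa only [add_assoc, deg_add_self, add_zero, zero_add] using this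
  · rfl

theorem continuousOn_jacVal (c c' : M.Chart) (j i : D.idx) :
    ContinuousOn (fun x => jacVal c c' x j i) (c.source ⊓ c'.source : Opens M.space) := by
  set V : Opens M.space := c.source ⊓ c'.source
  have hV : V ≤ c.source := inf_le_left
  set f : Smooth (c.img V) := body (c.read V hV (jac c c' hV inf_le_right j i))
  have h1 : ContinuousOn (fun x => Smooth.extend f (c.homeo x)) (V : Set M.space) :=
    (Smooth.contDiffOn_extend f).continuousOn.comp (c.homeo.continuousOn.mono hV)
      fun x hx => (c.point hV hx).2
  refine h1.congr fun x hx => ?_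
  rw [jacVal_eq c c' c hV inf_le_right hV hx]
  exact (Smooth.extend_apply f (c.point hV hx)).symm

variable {γ}

/-- The change of the momenta of degree zero. -/
def momentaChange (c c' : M.Chart) (x : M.space) (p : D.Momenta γ) : D.Momenta γ := fun j =>
  ∑ i, sgn ((D.deg i + D.deg j.1) ⬝ᵥ γ) • (jacVal c c' x j.1 i * momentum p i)

theorem momentum_momentaChange (c c' : M.Chart) (x : M.space) (p : D.Momenta γ) (j : D.idx) :
    momentum (momentaChange c c' x p) j =
      ∑ i, sgn ((D.deg i + D.deg j) ⬝ᵥ γ) • (jacVal c c' x j i * momentum p i) := by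
  by_cases h : D.deg j + γ = 0
  · rw [momentum, dif_pos h]
    rfl
  · rw [momentum, dif_neg h]
    refine (Finset.sum_eq_zero fun i _ => ?_).symm
    by_cases hi : D.deg i + γ = 0
    · rw [jacVal_eq_zero c c' (fun e : D.deg j = D.deg i => h (e ▸ hi)), zero_mul, smul_zero]
    · rw [momentum, dif_neg hi, mul_zero, smul_zero]

theorem momentaChange_self (c : M.Chart) {x : M.space} (hx : x ∈ c.source) (p : D.Momenta γ) :
    momentaChange c c x p = p := by
  classical
  funext j
  have e : ∀ i, jacVal c c x j.1 i = if i = j.1 then 1 else 0 := fun i => by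
    rw [jacVal_eq c c c le_rfl le_rfl le_rfl hx, jac_self, val]
    split_ifs
    · rw [map_one, value_one]
    · rw [map_zero, value_zero]
  refine (Finset.sum_eq_single j.1 ?_ ?_).trans ?_
  · intro i _ hi
    rw [e, if_neg hi, zero_mul, smul_zero]
  · simp
  · rw [e, if_pos rfl, one_mul, deg_add_self, zero_dotProduct, sgn_zero, one_smul, momentum,
      dif_pos j.2]

/-- The cocycle condition, from the chain rule for Jacobian matrices. -/
theorem momentaChange_comp (c c' c'' : M.Chart) {x : M.space} (hx : x ∈ c.source)
    (hx' : x ∈ c'.source) (hx'' : x ∈ c''.source) (p : D.Momenta γ) :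
    momentaChange c' c'' x (momentaChange c c' x p) = momentaChange c c'' x p := by
  funext k
  set V : Opens M.space := c.source ⊓ c'.source ⊓ c''.source
  have h : V ≤ c.source := inf_le_left.trans inf_le_left
  have h' : V ≤ c'.source := inf_le_left.trans inf_le_right
  have h'' : V ≤ c''.source := inf_le_right
  have hV : x ∈ V := ⟨⟨hx, hx'⟩, hx''⟩
  have e : ∀ i, jacVal c c'' x k.1 i = ∑ j, jacVal c' c'' x k.1 j * jacVal c c' x j i := fun i => by
    rw [jacVal_eq c c'' c h h'' h hV, ← jac_comp c c' c'' h h' h'' k.1 i, val, map_sum, value_sum]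
    refine Finset.sum_congr rfl fun j _ => ?_
    rw [map_mul, value_mul, jacVal_eq c' c'' c h' h'' h hV, jacVal_eq c c' c h h' h hV]
    rfl
  simp only [momentaChange, momentum_momentaChange, e, Finset.mul_sum, Finset.sum_mul,
    Finset.smul_sum, mul_smul_comm]
  rw [Finset.sum_comm]
  refine Finset.sum_congr rfl fun i _ => Finset.sum_congr rfl fun j _ => ?_
  rw [sgn_smul_sgn_smul, ← add_dotProduct, mul_assoc]
  congr 3
  rw [add_comm (D.deg j), add_add_add_comm, deg_add_self, add_zero, add_comm]

theorem continuousOn_momentaChange (c c' : M.Chart) :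
    ContinuousOn (fun q : M.space × D.Momenta γ => momentaChange c c' q.1 q.2)
      ((c.source ⊓ c'.source : Opens M.space) ×ˢ Set.univ) := by
  refine continuousOn_pi.2 fun j => continuousOn_finsetSum _ fun i _ => ?_
  have h : Continuous fun q : M.space × D.Momenta γ => momentum q.2 i := by
    by_cases hi : D.deg i + γ = 0
    · simp only [momentum, dif_pos hi]
      exact (continuous_apply (⟨i, hi⟩ : {j : D.idx // D.deg j + γ = 0})).comp continuous_snd
    · simp only [momentum, dif_neg hi]
      exact continuous_const
  have h' : ContinuousOn (fun q : M.space × D.Momenta γ => jacVal c c' q.1 j.1 i)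
      ((c.source ⊓ c'.source : Opens M.space) ×ˢ Set.univ) :=
    (continuousOn_jacVal c c' j.1 i).comp continuousOn_fst fun q hq => hq.1
  exact (h'.mul h.continuousOn).const_smul (sgn ((D.deg i + D.deg j.1) ⬝ᵥ γ))

end Core

/-- The bundle of momenta of degree zero. -/
def cotCore : FiberBundleCore M.Chart M.space (D.Momenta γ) where
  baseSet c := c.source
  isOpen_baseSet c := c.source.isOpen
  indexAt x := (M.exists_chart x).choose
  mem_baseSet_at x := (M.exists_chart x).choose_spec
  coordChange := momentaChange
  coordChange_self c _ hx p := momentaChange_self c hx p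
  continuousOn_coordChange := continuousOn_momentaChange
  coordChange_comp c c' c'' _ hx p := momentaChange_comp c c' c'' hx.1.1 hx.1.2 hx.2 p

/-- The topological space underlying the shifted cotangent bundle. -/
abbrev CotTotal : Type u := (M.cotCore γ).TotalSpace

variable {M} in
/-- The charts of the total space. -/
def cotAtlas (c : M.Chart) : OpenPartialHomeomorph (M.CotTotal γ) (D.cot γ).Space :=
  (((M.cotCore γ).localTriv c).toOpenPartialHomeomorph.trans
    (c.homeo.prod (OpenPartialHomeomorph.refl (D.Momenta γ)))).trans
      (D.cotSplit γ).toOpenPartialHomeomorph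

variable {M γ}

theorem mem_cotAtlas_source (c : M.Chart) (t : M.CotTotal γ) :
    t ∈ (cotAtlas γ c).source ↔ t.proj ∈ c.source := by
  simp only [cotAtlas, mfld_simps]
  exact and_self_iff

theorem cotAtlas_target (c : M.Chart) :
    (cotAtlas γ c).target = D.baseProj γ ⁻¹' c.homeo.target := by
  ext z
  simp only [cotAtlas, mfld_simps]
  exact ⟨fun h => h.1, fun h => ⟨h, c.homeo.map_target h⟩⟩

theorem localTriv_cotAtlas_symm (c c' : M.Chart) (z : (D.cot γ).Space)
    (h : c.homeo.symm (D.baseProj γ z) ∈ c.source)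
    (h' : c.homeo.symm (D.baseProj γ z) ∈ c'.source) :
    ((M.cotCore γ).localTriv c' ((cotAtlas γ c).symm z)).2 =
      momentaChange c c' (c.homeo.symm (D.baseProj γ z)) ((D.cotSplit γ).symm z).2 :=
  momentaChange_comp c _ c' h ((M.cotCore γ).mem_baseSet_at _) h' _

theorem continuous_cotProj : Continuous (fun t : M.CotTotal γ => t.proj) :=
  (M.cotCore γ).continuous_proj

theorem exists_mem_cotAtlas (t : M.CotTotal γ) : ∃ c : M.Chart, t ∈ (cotAtlas γ c).source :=
  (M.exists_chart t.proj).imp fun c h => (mem_cotAtlas_source c t).2 h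

/-- Points over different points of the base are separated there, points of one fibre in a chart. -/
instance t2Space_cotTotal : T2Space (M.CotTotal γ) := by
  have := M.t2
  refine ⟨fun s t hst => ?_⟩
  by_cases h : s.proj = t.proj
  · obtain ⟨c, hc⟩ := exists_mem_cotAtlas s
    have hc' : t ∈ (cotAtlas γ c).source := by
      rw [mem_cotAtlas_source] at hc ⊢
      rwa [← h]
    obtain ⟨u, v, hu, hv, hsu, htv, huv⟩ := t2_separation
      (fun e => hst ((cotAtlas γ c).injOn hc hc' e))
    refine ⟨_, _, (cotAtlas γ c).isOpen_inter_preimage hu,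
      (cotAtlas γ c).isOpen_inter_preimage hv, ⟨hc, hsu⟩, ⟨hc', htv⟩, ?_⟩
    exact (huv.preimage _).mono Set.inter_subset_right Set.inter_subset_right
  · exact separated_by_continuous continuous_cotProj h

/-- By the Lindelöf property of the base, countably many charts cover the total space. -/
instance secondCountable_cotTotal : SecondCountableTopology (M.CotTotal γ) := by
  have := M.secondCountable
  obtain ⟨T, hT, hTU⟩ := TopologicalSpace.isOpen_iUnion_countable
    (fun c : M.Chart => (c.source : Set M.space)) fun c => c.source.isOpen
  have : Countable T := hT.to_subtype
  have : ∀ c : T, SecondCountableTopology (cotAtlas γ c.1).source := fun c =>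
    (cotAtlas γ c.1).toHomeomorphSourceTarget.secondCountableTopology
  refine secondCountableTopology_of_countable_cover (U := fun c : T => (cotAtlas γ c.1).source)
    (fun c => (cotAtlas γ c.1).open_source) (Set.eq_univ_of_forall fun t => ?_)
  obtain ⟨c, hc⟩ := M.exists_chart t.proj
  have : t.proj ∈ ⋃ i ∈ T, ((i : M.Chart).source : Set M.space) := by
    rw [hTU]; exact Set.mem_iUnion.2 ⟨c, hc⟩
  obtain ⟨i, hi, hti⟩ := Set.mem_iUnion₂.1 this
  exact Set.mem_iUnion.2 ⟨⟨i, hi⟩, (mem_cotAtlas_source i t).2 hti⟩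

end Manifold

/-! ### Existence of shifted cotangent bundles -/

namespace Manifold

open RingedSpace RingedSpace.Chart Coords

variable {n : ℕ} {D : Coords n} {M : Manifold.{u} D} {γ : Deg n}

theorem baseProj_mem_img (c : M.Chart) {U : Opens (M.CotTotal γ)} {V : Opens M.space}
    (hUV : ∀ t ∈ U, t.proj ∈ V) :
    ∀ z ∈ imgOf (cotAtlas γ c) U, D.baseProj γ z ∈ c.img V := by
  intro z hz
  refine ⟨?_, hUV _ hz.2⟩
  have := hz.1
  rwa [cotAtlas_target] at this

section Hom

variable (c c' c'' : M.Chart) {U : Opens (M.CotTotal γ)}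

theorem proj_mem_inf (h : (U : Set (M.CotTotal γ)) ⊆ (cotAtlas γ c).source)
    (h' : (U : Set (M.CotTotal γ)) ⊆ (cotAtlas γ c').source) :
    ∀ t ∈ U, t.proj ∈ c.source ⊓ c'.source := fun t ht =>
  ⟨(mem_cotAtlas_source c t).1 (h ht), (mem_cotAtlas_source c' t).1 (h' ht)⟩

variable (h : (U : Set (M.CotTotal γ)) ⊆ (cotAtlas γ c).source)
  (h' : (U : Set (M.CotTotal γ)) ⊆ (cotAtlas γ c').source)
  (h'' : (U : Set (M.CotTotal γ)) ⊆ (cotAtlas γ c'').source)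

/-- The constant terms of the transformed coordinates are the coordinates of the underlying point.
-/
theorem value_transCoord (hz : ∀ z ∈ imgOf (cotAtlas γ c) U,
      D.baseProj γ z ∈ c.img (c.source ⊓ c'.source))
    (z : imgOf (cotAtlas γ c) U) (b : (D.cot γ).Base) :
    value z (transCoord c c' hz b.1) = cotAtlas γ c' ((cotAtlas γ c).symm z.1) b := by
  have hx : c.homeo.symm (D.baseProj γ z.1) ∈ c.source ⊓ c'.source := (hz z.1 z.2).2
  rcases b with ⟨i | j, hb⟩
  · refine (value_pullSec c _ hz z _).trans ?_
    rw [val_eq c c' inf_le_left inf_le_right]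
    exact val_coord c' inf_le_right hx ⟨i, hb⟩
  · refine Eq.trans ?_ (congrFun (localTriv_cotAtlas_symm c c' z.1 hx.1 hx.2) ⟨j, hb⟩).symm
    refine (value_sum _ _ _).trans (Finset.sum_congr rfl fun i _ => ?_)
    rw [value_zsmul, value_mul, value_pullSec, value_coord_pIdx,
      jacVal_eq c c' c inf_le_left inf_le_right inf_le_left hx]

theorem mapsInto_transCoord (hz : ∀ z ∈ imgOf (cotAtlas γ c) U,
      D.baseProj γ z ∈ c.img (c.source ⊓ c'.source)) :
    MapsInto (imgOf (cotAtlas γ c') U) (transCoord c c' hz) := by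
  refine mapsInto_of_mem (transCoord_mem c c' hz) fun z => ?_
  simp only [value_transCoord]
  have ht : (cotAtlas γ c).symm z.1 ∈ U := z.2.2
  have hs : (cotAtlas γ c).symm z.1 ∈ (cotAtlas γ c').source :=
    (mem_cotAtlas_source c' _).2 (hz z.1 z.2).2.2
  refine ⟨(cotAtlas γ c').map_source hs, ?_⟩
  rw [Set.mem_preimage]
  erw [(cotAtlas γ c').left_inv hs]
  exact ht

/-- The transformed coordinates define a morphism of domains. -/
theorem exists_cotHom : ∃ Φ : (D.cot γ).Fun (imgOf (cotAtlas γ c') U) →ₐ[ℝ]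
      (D.cot γ).Fun (imgOf (cotAtlas γ c) U),
    (∀ v, Φ ((D.cot γ).coord _ v) =
      transCoord c c' (baseProj_mem_img c (proj_mem_inf c c' h h')) v) ∧
    ∀ δ, ∀ f ∈ homog (D.cot γ).formalDeg (Smooth (imgOf (cotAtlas γ c') U)) δ,
      Φ f ∈ homog (D.cot γ).formalDeg (Smooth (imgOf (cotAtlas γ c) U)) δ :=
  exists_fun_hom (mapsInto_transCoord c c' (baseProj_mem_img c (proj_mem_inf c c' h h')))
    (transCoord_mem c c' _)

/-- The transformation from the coordinates over `c'` to those over `c`. -/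
def cotHom : (D.cot γ).Fun (imgOf (cotAtlas γ c') U) →ₐ[ℝ]
    (D.cot γ).Fun (imgOf (cotAtlas γ c) U) := (exists_cotHom c c' h h').choose

theorem cotHom_coord (v : (D.cot γ).idx) : cotHom c c' h h' ((D.cot γ).coord _ v) =
    transCoord c c' (baseProj_mem_img c (proj_mem_inf c c' h h')) v :=
  (exists_cotHom c c' h h').choose_spec.1 v

theorem cotHom_mem {δ : Deg n} {f : (D.cot γ).Fun (imgOf (cotAtlas γ c') U)}
    (hf : f ∈ homog (D.cot γ).formalDeg (Smooth (imgOf (cotAtlas γ c') U)) δ) :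
    cotHom c c' h h' f ∈ homog (D.cot γ).formalDeg (Smooth (imgOf (cotAtlas γ c) U)) δ :=
  (exists_cotHom c c' h h').choose_spec.2 δ f hf

theorem mapsInto_cotHom : MapsInto (imgOf (cotAtlas γ c') U)
    fun v => cotHom c c' h h' ((D.cot γ).coord _ v) := by
  simp only [cotHom_coord]
  exact mapsInto_transCoord c c' _

theorem res_cotHom {U' : Opens (M.CotTotal γ)} (hU : U' ≤ U)
    (f : (D.cot γ).Fun (imgOf (cotAtlas γ c') U)) :
    GSeries.res (imgOf_mono (cotAtlas γ c) hU) (cotHom c c' h h' f) =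
      cotHom c c' (fun _ hx => h (hU hx)) (fun _ hx => h' (hU hx))
        (GSeries.res (imgOf_mono (cotAtlas γ c') hU) f) := by
  have hU1 : (U' : Set (M.CotTotal γ)) ⊆ (cotAtlas γ c).source := fun _ hx => h (hU hx)
  have hU2 : (U' : Set (M.CotTotal γ)) ⊆ (cotAtlas γ c').source := fun _ hx => h' (hU hx)
  have hm := mapsInto_cotHom c c' h h'
  have e : (GSeries.res (imgOf_mono (cotAtlas γ c) hU)).comp (cotHom c c' h h') =
      (cotHom c c' hU1 hU2).comp (GSeries.res (imgOf_mono (cotAtlas γ c') hU)) := by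
    refine fun_hom_ext ⟨fun x => hm.mem ⟨x.1, imgOf_mono _ hU x.2⟩,
      fun x => hm.value_eq_zero ⟨x.1, imgOf_mono _ hU x.2⟩⟩ fun v => ?_
    rw [AlgHom.comp_apply, AlgHom.comp_apply, Coords.res_coord, cotHom_coord, cotHom_coord]
    exact res_transCoord c c' _ _ _ v
  exact DFunLike.congr_fun e f

theorem cotHom_self (f : (D.cot γ).Fun (imgOf (cotAtlas γ c) U)) : cotHom c c h h f = f := by
  have e : cotHom c c h h = AlgHom.id ℝ _ := by
    refine fun_hom_ext (mapsInto_cotHom c c h h) fun v => ?_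
    rw [cotHom_coord, transCoord_self]
    rfl
  exact DFunLike.congr_fun e f

/-- The transformations are compatible with the pullback of sections of the base. -/
theorem cotHom_pullSec {V : Opens M.space} (hV : V ≤ c.source) (hV' : V ≤ c'.source)
    (hUV : ∀ t ∈ U, t.proj ∈ V) (s : M.Sec V) :
    cotHom c c' h h' (pullSec c' hV' (baseProj_mem_img c' hUV) s) =
      pullSec c hV (baseProj_mem_img c hUV) s := by
  have e : (cotHom c c' h h').comp (baseHom (baseProj_mem_img c' hUV)) =
      (baseHom (baseProj_mem_img c hUV)).comp
        (c.trans c' V hV hV' : D.Fun (c'.img V) →ₐ[ℝ] D.Fun (c.img V)) := by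
    have hc : ∀ i, (baseHom (baseProj_mem_img (γ := γ) c hUV)).comp
        (c.trans c' V hV hV' : D.Fun (c'.img V) →ₐ[ℝ] D.Fun (c.img V)) (D.coord _ i) =
        pullSec c hV (baseProj_mem_img c hUV) (c'.coord V hV' i) := fun i => rfl
    refine (fun_hom_ext (mapsInto_of_mem (fun i => ?_) fun z => ?_) fun i => ?_).symm
    · rw [hc]
      exact pullSec_mem c hV _ (c'.coord_mem hV' i)
    · simp only [hc, value_pullSec]
      have hx : c.homeo.symm (D.baseProj γ z.1) ∈ V := (baseProj_mem_img c hUV z.1 z.2).2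
      simp only [val_eq c c' hV hV']
      have : (fun b : D.Base => val c' hV' hx (c'.coord V hV' b.1)) =
          (c'.point hV' hx).1 := funext fun b => val_coord c' hV' hx b
      rw [this]
      exact (c'.point hV' hx).2
    · rw [hc, AlgHom.comp_apply, baseHom_coord, cotHom_coord]
      exact (transCoord_xIdx c c' _ hV hV' _ i).symm
  refine (DFunLike.congr_fun e (c'.read V hV' s)).trans ?_
  exact congrArg (baseHom (baseProj_mem_img c hUV)) (trans_read c c' hV hV' s)

/-- The cocycle condition. -/
theorem cotHom_comp (f : (D.cot γ).Fun (imgOf (cotAtlas γ c'') U)) :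
    cotHom c c' h h' (cotHom c' c'' h' h'' f) = cotHom c c'' h h'' f := by
  set V : Opens M.space := c.source ⊓ c'.source ⊓ c''.source
  have hV : V ≤ c.source := inf_le_left.trans inf_le_left
  have hV' : V ≤ c'.source := inf_le_left.trans inf_le_right
  have hV'' : V ≤ c''.source := inf_le_right
  have hUV : ∀ t ∈ U, t.proj ∈ V := fun t ht =>
    ⟨proj_mem_inf c c' h h' t ht, (mem_cotAtlas_source c'' t).1 (h'' ht)⟩
  have e : cotHom c c'' h h'' = (cotHom c c' h h').comp (cotHom c' c'' h' h'') := by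
    refine fun_hom_ext (mapsInto_cotHom c c'' h h'') fun v => ?_
    rw [AlgHom.comp_apply, cotHom_coord, cotHom_coord]
    rcases v with i | k
    · refine (transCoord_xIdx c c'' _ hV hV'' (baseProj_mem_img c hUV) i).trans ?_
      refine Eq.trans ?_ (congrArg (cotHom c c' h h')
        (transCoord_xIdx c' c'' _ hV' hV'' (baseProj_mem_img c' hUV) i)).symm
      rw [cotHom_pullSec c c' h h' hV hV' hUV]
    · refine (transCoord_pIdx c c'' _ hV hV'' (baseProj_mem_img c hUV) k).trans ?_
      refine Eq.trans ?_ (congrArg (cotHom c c' h h')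
        (transCoord_pIdx c' c'' _ hV' hV'' (baseProj_mem_img c' hUV) k)).symm
      have hp : ∀ j, cotHom c c' h h' ((D.cot γ).coord _ (D.pIdx γ j)) =
          ∑ i, sgn ((D.deg i + D.deg j) ⬝ᵥ γ) •
            (pullSec c hV (baseProj_mem_img c hUV) (jac c c' hV hV' j i) *
              (D.cot γ).coord _ (D.pIdx γ i)) := fun j =>
        (cotHom_coord c c' h h' (D.pIdx γ j)).trans
          (transCoord_pIdx c c' _ hV hV' (baseProj_mem_img c hUV) j)
      simp only [map_sum, map_zsmul, map_mul, cotHom_pullSec c c' h h' hV hV' hUV, hp,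
        ← jac_comp c c' c'' hV hV' hV'' k, Finset.sum_mul, Finset.mul_sum, Finset.smul_sum,
        mul_smul_comm]
      rw [Finset.sum_comm]
      refine Finset.sum_congr rfl fun j _ => Finset.sum_congr rfl fun i _ => ?_
      rw [sgn_smul_sgn_smul, ← add_dotProduct, mul_assoc]
      congr 3
      rw [add_comm (D.deg j), add_add_add_comm, deg_add_self, add_zero, add_comm]
  exact (DFunLike.congr_fun e f).symm

end Hom

variable (M γ)

/-- The gluing data of the shifted cotangent bundle. -/
abbrev cotGluing : GluingData.{u} (D.cot γ) where
  space := TopCat.of (M.CotTotal γ)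
  t2 := t2Space_cotTotal
  secondCountable := secondCountable_cotTotal
  ι := M.Chart
  atlas := cotAtlas γ
  exists_mem := exists_mem_cotAtlas
  hom c c' _ h h' := cotHom c c' h h'
  hom_mem c c' _ h h' _ _ hf := cotHom_mem c c' h h' hf
  res_hom c c' _ h h' _ hU f := res_cotHom c c' h h' hU f
  hom_self c _ h f := cotHom_self c h f
  hom_comp c c' c'' _ h h' h'' f := cotHom_comp c c' c'' h h' h'' f

variable {M γ}

theorem baseProj_mem_img_inf (c : M.Chart) {U : Opens (M.CotTotal γ)} {V : Opens M.space}
    (hUV : ∀ t ∈ U, t.proj ∈ V) :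
    ∀ z ∈ imgOf (cotAtlas γ c) U, D.baseProj γ z ∈ c.img (V ⊓ c.source) := by
  intro z hz
  have h1 := baseProj_mem_img c hUV z hz
  exact ⟨h1.1, h1.2, c.homeo.map_target h1.1⟩

/-- The pullback of a section of the base to the shifted cotangent bundle. -/
def cotPull (V : Opens M.space) (U : Opens (M.CotTotal γ)) (hUV : ∀ t ∈ U, t.proj ∈ V) :
    M.Sec V →ₐ[ℝ] (M.cotGluing γ).Sec U :=
  AlgHom.codRestrict (AlgHom.pi fun c : M.Chart =>
    (pullSec c inf_le_right (baseProj_mem_img_inf c hUV)).comp (M.res inf_le_left))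
    ((M.cotGluing γ).secAlg U) (by
      intro s c c' U' hU h h'
      set V' : Opens M.space := V ⊓ c.source ⊓ c'.source
      have hV' : ∀ t ∈ U', t.proj ∈ V' := fun t ht =>
        ⟨⟨hUV t (hU ht), (mem_cotAtlas_source c t).1 (h ht)⟩, (mem_cotAtlas_source c' t).1 (h' ht)⟩
      have hV : V' ≤ V := inf_le_left.trans inf_le_left
      have hc : V' ≤ c.source := inf_le_left.trans inf_le_right
      have hc' : V' ≤ c'.source := inf_le_right
      have e1 := res_pullSec c inf_le_right (baseProj_mem_img_inf c hUV) (le_inf hV hc)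
        (imgOf_mono (cotAtlas γ c) hU) (baseProj_mem_img c hV') (M.res inf_le_left s)
      have e2 := res_pullSec c' inf_le_right (baseProj_mem_img_inf c' hUV) (le_inf hV hc')
        (imgOf_mono (cotAtlas γ c') hU) (baseProj_mem_img c' hV') (M.res inf_le_left s)
      rw [RingedSpace.res_res] at e1 e2
      refine Eq.trans (congrArg (cotHom c c' h h') e2) (Eq.trans ?_ e1.symm)
      exact cotHom_pullSec c c' h h' hc hc' hV' (M.res hV s))

theorem cotPull_apply {V : Opens M.space} {U : Opens (M.CotTotal γ)} (hUV : ∀ t ∈ U, t.proj ∈ V)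
    (c : M.Chart) (hc : V ≤ c.source) (s : M.Sec V) :
    (cotPull V U hUV s).1 c = pullSec c hc (baseProj_mem_img c hUV) s :=
  pullSec_res c hc (baseProj_mem_img c hUV) inf_le_left (baseProj_mem_img_inf c hUV) s

variable (M γ)

/-- The projection of the shifted cotangent bundle. -/
def cotProj : RingedSpace.Hom (M.cotGluing γ).manifold.toRingedSpace M.toRingedSpace where
  base := ⟨fun t => Bundle.TotalSpace.proj (E := (M.cotCore γ).Fiber) t, continuous_cotProj⟩
  pull V := cotPull V _ fun _ h => h
  pull_mem _ _ _ hs c := pullSec_mem c _ _ (RingedSpace.res_mem _ hs)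
  pull_res {V V'} h s := Subtype.ext (funext fun c => by
    have e := res_pullSec c (inf_le_right : V ⊓ c.source ≤ _)
      (baseProj_mem_img_inf c (U := Opens.comap ⟨fun t => Bundle.TotalSpace.proj
        (E := (M.cotCore γ).Fiber) t, continuous_cotProj⟩ V) fun _ h => h)
      (inf_le_inf_right _ h : V' ⊓ c.source ≤ _)
      (imgOf_mono (cotAtlas γ c) (OrderHomClass.mono (Opens.comap _) h))
      (baseProj_mem_img_inf c fun _ h => h) (M.res inf_le_left s)
    rw [RingedSpace.res_res] at e
    refine Eq.trans ?_ e.symm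
    exact congrArg (pullSec c _ _) (RingedSpace.res_res _ _ _))

/-- The `γ`-shifted cotangent bundle. -/
def shiftedCotangentBundle : ShiftedCotangentBundle.{u} M γ where
  total := (M.cotGluing γ).manifold
  proj := M.cotProj γ
  adapted := (M.cotGluing γ).chart
  source_eq c := Opens.ext (Set.ext fun t => mem_cotAtlas_source (γ := γ) c t)
  target_eq := cotAtlas_target
  coord_x c V hV i := by
    set U : Opens (M.CotTotal γ) := Opens.comap (M.cotProj γ).base V
    have hU : (U : Set (M.CotTotal γ)) ⊆ (cotAtlas γ c).source := fun t ht =>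
      (mem_cotAtlas_source c t).2 (show Bundle.TotalSpace.proj t ∈ c.source from hV ht)
    apply ((M.cotGluing γ).readEquiv c U hU).injective
    refine (AlgEquiv.apply_symm_apply _ _).trans ?_
    refine Eq.trans ?_ (cotPull_apply (fun _ h => h) c hV (c.coord V hV i)).symm
    exact (pullSec_coord c hV _ i).symm
  coord_p c c' V hV hV' j := by
    set U : Opens (M.CotTotal γ) := Opens.comap (M.cotProj γ).base V
    have hU : (U : Set (M.CotTotal γ)) ⊆ (cotAtlas γ c).source := fun t ht =>
      (mem_cotAtlas_source c t).2 (show Bundle.TotalSpace.proj t ∈ c.source from hV ht)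
    have hU' : (U : Set (M.CotTotal γ)) ⊆ (cotAtlas γ c').source := fun t ht =>
      (mem_cotAtlas_source c' t).2 (show Bundle.TotalSpace.proj t ∈ c'.source from hV' ht)
    apply ((M.cotGluing γ).readEquiv c U hU).injective
    refine (GluingData.component_readEquiv_symm (G := M.cotGluing γ) c' c U hU' hU _).trans ?_
    refine (cotHom_coord c c' hU hU' (D.pIdx γ j)).trans ?_
    refine (transCoord_pIdx c c' _ hV hV' (baseProj_mem_img c fun _ h => h) j).trans ?_
    refine Eq.trans ?_ (map_sum ((M.cotGluing γ).readEquiv c U hU) _ _).symm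
    refine Finset.sum_congr rfl fun i _ => ?_
    refine Eq.trans ?_ (map_zsmul ((M.cotGluing γ).readEquiv c U hU) _ _).symm
    refine congrArg _ (Eq.trans ?_ (map_mul ((M.cotGluing γ).readEquiv c U hU) _ _).symm)
    refine congrArg₂ (· * ·) ?_ (AlgEquiv.apply_symm_apply _ _).symm
    exact (cotPull_apply (fun _ h => h) c hV (jac c c' hV hV' j i)).symm

end Manifold

end Z2n

end

theorem mainTheorem3 {n : ℕ} {D : Z2n.Coords n} (M : Z2n.Manifold.{u} D) (γ : Z2n.Deg n) :
    Nonempty (Z2n.ShiftedCotangentBundle.{u} M γ) ∧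
    ∀ E : Z2n.ShiftedCotangentBundle.{u} M γ,
      ∃ ω : E.total.DiffForm 2,
        Z2n.Manifold.IsSymplectic γ ω ∧
        (∀ c : M.Chart, ω.loc (E.adapted c) = D.canonicalForm γ _) ∧
        (γ = 0 → ∀ c : M.Chart, ω.loc (E.adapted c) =
          ∑ i, (D.cot γ).dx _ (D.xIdx γ i) * (D.cot γ).dx _ (D.pIdx γ i)) ∧
        ∀ ω' : E.total.DiffForm 2,
          (∀ c : M.Chart, ω'.loc (E.adapted c) = D.canonicalForm γ _) → ω' = ω := by
  refine ⟨⟨M.shiftedCotangentBundle γ⟩, fun E => ⟨E.canonical, E.isSymplectic_canonical,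
    E.canonical_adapted, fun hγ c => ?_, fun ω' h => Z2n.Manifold.DiffForm.eq_of_cover E.adapted E.exists_mem_adapted
      fun c => (h c).trans (E.canonical_adapted c).symm⟩⟩
  rw [E.canonical_adapted, Z2n.Coords.canonicalForm]
  refine Finset.sum_congr rfl fun i _ => ?_
  subst hγ
  rw [dotProduct_zero, Z2n.sgn_zero, one_smul]
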